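/- Let $\Gamma = PSL(2,\mathbb{Z})$. For a hyperbolic conjugacy class $\{P\}$ of $\Gamma$ (represented by matrices with $|\mathrm{tr}| > 2$), conjugate over $SL(2,\mathbb{R})$, up to sign, to $\mathrm{diag}(\lambda,\lambda^{-1})$ with $\lambda>1$, let $NP=\lambda^2$ be its norm. Call $P_0\in\Gamma$ primitive if it is not of the form $Q^j$ with $Q \in \Gamma$, $j \ge 2$, and put $\Lambda(P) = \log NP_0$ if $\{P\}=\{P_0^j\}$ with $j\ge 1$ and $P_0$ primitive hyperbolic. Let $\Psi_\Gamma(x)=\sum_{NP\le x}\Lambda(P)$, the sum being over all hyperbolic conjugacy classes $\{P\}$ with $NP \le x$. For an integer $\delta\equiv 0,1 \pmod 4$ and $q\ge 1$ put $$\rho_q(\delta)=\#\{x \bmod 2q : x^2\equiv\delta \bmod 4q\},\qquad \lambda_q(\delta)=\sum_{q_1^2q_2q_3=q}\mu(q_2)\rho_{q_3}(\delta),\qquad L(s,\delta)=\sum_{q=1}^\infty \lambda_q(\delta)q^{-s}.$$ Let $x\ge 1$ be real and $X=\sqrt{x}+1/\sqrt{x}$. Then there are only finitely many hyperbolic conjugacy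 classes with $NP\le x$; for every integer $n>2$ the series $L(1,n^2-4)=\sum_{q\ge1}\lambda_q(n^2-4)/q$ converges (as the limit of its partial sums over $q \le Q$ as $Q \to \infty$); and $$\Psi_\Gamma(x)=2\sum_{2<n\le X}\sqrt{n^2-4}\,L(1,n^2-4).$$ -/

import Mathlib

open scoped MatrixGroups

namespace PrimeGeodesic

/-- The modular group `Γ = PSL(2, ℤ)`. -/
abbrev Γ : Type := PSL(2, ℤ)

/-- Elements of `SL(2, ℤ)` with the same image in `PSL(2, ℤ)` have the same trace up to sign. -/
theorem natAbs_trace_eq_of_leftRel (A B : SL(2, ℤ))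
    (h : QuotientGroup.leftRel (Subgroup.center SL(2, ℤ)) A B) :
    A.1.trace.natAbs = B.1.trace.natAbs := by
  rw [QuotientGroup.leftRel_apply, Matrix.SpecialLinearGroup.mem_center_iff] at h
  obtain ⟨r, hr, hs⟩ := h
  have hB : B.1 = A.1 * Matrix.scalar (Fin 2) r := by
    rw [hs, ← Matrix.SpecialLinearGroup.coe_mul]; simp
  have hr2 : r = 1 ∨ r = -1 := by
    simpa using hr
  rw [hB]
  rcases hr2 with rfl | rfl <;> simp

/-- The trace of an element of `Γ`: the trace of a lift to `SL(2, ℤ)`, the sign of the lift being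
chosen so that the trace is nonnegative. -/
def tr (P : Γ) : ℕ :=
  Quotient.lift (fun A : SL(2, ℤ) => A.1.trace.natAbs) natAbs_trace_eq_of_leftRel P

/-- Hyperbolic elements of `Γ`: those whose trace is, in absolute value, greater than `2`. -/
def IsHyperbolic (P : Γ) : Prop := 2 < tr P

/-- `P` is primitive if it is not of the form `Q ^ j` with `Q ∈ Γ` and `j ≥ 2`. -/
def IsPrimitive (P : Γ) : Prop := ¬ ∃ (Q : Γ) (j : ℕ), 2 ≤ j ∧ Q ^ j = P

/-- The norm `λ ^ 2` of a hyperbolic element `P`, where `λ > 1` is the number with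
`λ + λ⁻¹ = tr P`; see `norm_mk_eq_sq` for the description of `λ` by diagonalization. -/
noncomputable def norm (P : Γ) : ℝ :=
  (((tr P : ℝ) + Real.sqrt ((tr P : ℝ) ^ 2 - 4)) / 2) ^ 2

/-- If `A` is conjugate over `SL(2, ℝ)` to the diagonal matrix with entries `l, l⁻¹`, `l > 1`, then
the image of `A` in `Γ` is hyperbolic and its norm is `l ^ 2`. -/
theorem norm_mk_eq_sq (A : SL(2, ℤ)) (g : SL(2, ℝ)) (l : ℝ) (hl : 1 < l)
    (h : g.1 * A.1.map (Int.cast : ℤ → ℝ) * (g⁻¹).1 = !![l, 0; 0, l⁻¹]) :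
    IsHyperbolic (QuotientGroup.mk A : Γ) ∧ norm (QuotientGroup.mk A : Γ) = l ^ 2 := by
  have hl0 : (0 : ℝ) < l := by linarith
  have hg : (g⁻¹).1 * g.1 = 1 := by
    rw [← Matrix.SpecialLinearGroup.coe_mul]; simp
  have htr : (A.1.trace : ℝ) = l + l⁻¹ := by
    have h1 := congrArg Matrix.trace h
    rw [Matrix.trace_mul_comm, ← Matrix.mul_assoc, hg, one_mul] at h1
    simpa [Matrix.trace_fin_two] using h1
  have hmul : l * l⁻¹ = 1 := mul_inv_cancel₀ hl0.ne'
  have hinv : l⁻¹ < 1 := inv_lt_one_of_one_lt₀ hl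
  have hinv0 : 0 < l⁻¹ := inv_pos.mpr hl0
  have hT : ((tr (QuotientGroup.mk A : Γ) : ℕ) : ℝ) = l + l⁻¹ := by
    change ((A.1.trace.natAbs : ℕ) : ℝ) = _
    rw [Nat.cast_natAbs, Int.cast_abs, htr, abs_of_pos (by positivity)]
  constructor
  · have : (2 : ℝ) < ((tr (QuotientGroup.mk A : Γ) : ℕ) : ℝ) := by rw [hT]; nlinarith
    unfold IsHyperbolic
    exact_mod_cast this
  · unfold norm
    rw [hT, show (l + l⁻¹) ^ 2 - 4 = (l - l⁻¹) ^ 2 by nlinarith,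
      Real.sqrt_sq (by linarith)]
    ring

theorem tr_mul_comm (P Q : Γ) : tr (P * Q) = tr (Q * P) := by
  induction P using QuotientGroup.induction_on with
  | H A =>
  induction Q using QuotientGroup.induction_on with
  | H B =>
  change (A * B).1.trace.natAbs = (B * A).1.trace.natAbs
  rw [Matrix.SpecialLinearGroup.coe_mul, Matrix.SpecialLinearGroup.coe_mul,
    Matrix.trace_mul_comm]

theorem tr_eq_of_isConj (P Q : Γ) (h : IsConj P Q) : tr P = tr Q := by
  obtain ⟨c, rfl⟩ := isConj_iff.mp h
  rw [tr_mul_comm, ← mul_assoc]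
  simp

/-- The trace of a conjugacy class of `Γ`. -/
def classTr (C : ConjClasses Γ) : ℕ := Quotient.lift tr tr_eq_of_isConj C

/-- The norm of a conjugacy class of `Γ`. -/
noncomputable def classNorm (C : ConjClasses Γ) : ℝ :=
  Quotient.lift norm (fun P Q h => by unfold norm; rw [tr_eq_of_isConj P Q h]) C

/-- The hyperbolic conjugacy classes. -/
def IsHyperbolicClass (C : ConjClasses Γ) : Prop := 2 < classTr C

open Classical in
/-- `Λ(C) = log N(P₀)` if `C` is the class of a power `P₀ ^ j`, `j ≥ 1`, of a primitive hyperbolic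
element `P₀`. -/
noncomputable def vonMangoldt (C : ConjClasses Γ) : ℝ :=
  if h : ∃ P₀ : Γ, IsHyperbolic P₀ ∧ IsPrimitive P₀ ∧
      ∃ j : ℕ, 1 ≤ j ∧ ConjClasses.mk (P₀ ^ j) = C
  then Real.log (norm h.choose) else 0

/-- The hyperbolic conjugacy classes of norm at most `x`. -/
def classesUpTo (x : ℝ) : Set (ConjClasses Γ) :=
  {C | IsHyperbolicClass C ∧ classNorm C ≤ x}

/-- `Ψ_Γ(x) = ∑_{N C ≤ x} Λ(C)`, over hyperbolic conjugacy classes `C`. -/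
noncomputable def Psi (x : ℝ) : ℝ := ∑ᶠ C ∈ classesUpTo x, vonMangoldt C

/-- `ρ_q(δ) = #{x mod 2q : x² ≡ δ mod 4q}`. -/
def rho (q : ℕ) (δ : ℤ) : ℕ :=
  ((Finset.range (2 * q)).filter fun x : ℕ => (x : ℤ) ^ 2 ≡ δ [ZMOD 4 * (q : ℤ)]).card

/-- `λ_q(δ) = ∑_{q₁² q₂ q₃ = q} μ(q₂) ρ_{q₃}(δ)` for `q ≥ 1`. -/
def lam (q : ℕ) (δ : ℤ) : ℤ :=
  ∑ t ∈ (q.divisors ×ˢ q.divisors ×ˢ q.divisors).filter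
      (fun t : ℕ × ℕ × ℕ => t.1 ^ 2 * t.2.1 * t.2.2 = q),
    ArithmeticFunction.moebius t.2.1 * (rho t.2.2 δ : ℤ)

/-- The `q`-th term `λ_q(δ) q^{-s}` of the Dirichlet series, with the value `0` at `q = 0`. -/
noncomputable def zagierTerm (s : ℂ) (δ : ℤ) (q : ℕ) : ℂ :=
  LSeries.term (fun q => (lam q δ : ℂ)) s q

/-- The series `∑ λ_q(δ) q^{-s}` converges, in the sense that its partial sums over `q < Q`
converge as `Q → ∞`. -/
def ZagierLConverges (s : ℂ) (δ : ℤ) : Prop :=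
  Summable (zagierTerm s δ) (SummationFilter.conditional ℕ)

/-- `L(s, δ) = ∑_{q ≥ 1} λ_q(δ) q^{-s}`, the limit of the partial sums over `q < Q`. -/
noncomputable def zagierL (s : ℂ) (δ : ℤ) : ℂ :=
  ∑'[SummationFilter.conditional ℕ] q : ℕ, zagierTerm s δ q

end PrimeGeodesic

/-! Since `NP` and the trace determine each other monotonically, it suffices to treat one trace n >
2 at a time: the sum of Λ over the classes of trace n must equal 2√D·L(1, D) with D = n² - 4. This
follows from counting one set of orbits in two ways; no class number formula is used.

Consider pairs (A, v) with A in SL(2, ℤ) of trace n, v in ℤ², and 0 < Q_A(v) ≤ N, where Q_A(v) =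
det(v, Av). SL(2, ℤ) acts on them by (gAg⁻¹, gv), preserving Q.

Reducing A first: fix a representative A of each class. The vectors v are then counted modulo the
centralizer of A, which is ±B^ℤ for some B of eigenvalue ε > 1. In eigencoordinates (u, w) with Q_A
= uw, the centralizer scales u by ε and w by ε⁻¹, up to a common sign, so each orbit meets the
sector w ≤ u < ε²w of the positive quadrant exactly once (`exists_mulVec_mem_sector`,
`eq_one_of_mem_sector`). Counting lattice points there gives N·log ε/√D + o(N), and Λ of the class
is 2 log ε (`vonMangoldt_mk`).

Reducing v first: move v to (d, 0) with d ≥ 1. What remains is A modulo shears, that is, its lower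
left entry c > 0 and its upper left entry a modulo c, where a² - na + 1 ≡ 0 mod c and d²c ≤ N. The
number of triples (d, c, a) is the sum over q ≤ N of (1_□ * r)(q), with r the root count, which
equals ρ (`rho_eq_rootCount`). `nonempty_equiv_rootTriples` identifies the two counts.

Finally λ = 1_□ * μ * r, so 1_□ * r = 1 * λ, and the mean value of 1 * λ should be Σ λ(q)/q. This is
proved from λ = χ * b (`zagierFn_eq_jacobiFn_mul`): χ is a quadratic character with bounded partial
sums because D is not a square, and Σ |b(m)|/m < ∞ because b lives on the primes dividing 4D.
Partial summation and the hyperbola method handle χ, and dominated convergence passes to χ * b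
(`exists_tendsto_of_convolution`), which also gives convergence of L(1, D). Uniqueness of limits
finishes. -/

namespace PrimeGeodesic

/-! ### Roots of X² - nX + 1 modulo q -/

/-- The number of roots of `X ^ 2 - n X + 1` modulo `q`. -/
def rootCount (n : ℤ) (q : ℕ) : ℕ :=
  ((Finset.range q).filter fun a : ℕ => (q : ℤ) ∣ (a : ℤ) ^ 2 - n * a + 1).card

/-- Complete the square: x = 2a - n turns a² - na + 1 ≡ 0 mod q into x² ≡ n² - 4 mod 4q. Conversely
such an x has the parity of n, so a exists, and a mod q corresponds to x mod 2q. -/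
theorem rho_eq_rootCount (n : ℤ) {q : ℕ} (hq : q ≠ 0) :
    rho q (n ^ 2 - 4) = rootCount n q := by
  have hq0 : (0 : ℤ) < q := by positivity
  symm
  unfold rho rootCount
  have key : ∀ a : ℤ, (q : ℤ) ∣ a ^ 2 - n * a + 1 ↔ 4 * (q : ℤ) ∣ (2 * a - n) ^ 2 - (n ^ 2 - 4) := by
    intro a
    rw [show (2 * a - n) ^ 2 - (n ^ 2 - 4) = 4 * (a ^ 2 - n * a + 1) by ring]
    exact (mul_dvd_mul_iff_left (by norm_num)).symm
  have hnn : ∀ a : ℤ, 0 ≤ (2 * a - n) % (2 * (q : ℤ)) := fun a => Int.emod_nonneg _ (by positivity)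
  have hlt : ∀ a : ℤ, (2 * a - n) % (2 * (q : ℤ)) < 2 * (q : ℤ) :=
    fun a => Int.emod_lt_of_pos _ (by positivity)
  have hsq : ∀ y z : ℤ, 2 * (q : ℤ) ∣ y - z →
      (4 * (q : ℤ) ∣ y ^ 2 - (n ^ 2 - 4) ↔ 4 * (q : ℤ) ∣ z ^ 2 - (n ^ 2 - 4)) := by
    rintro y z ⟨k, hk⟩
    obtain rfl : y = z + 2 * q * k := by linarith
    rw [show (z + 2 * q * k) ^ 2 - (n ^ 2 - 4)
      = (z ^ 2 - (n ^ 2 - 4)) + 4 * q * (z * k + q * k ^ 2) by ring]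
    exact Int.dvd_add_left (Dvd.intro _ rfl)
  refine Finset.card_bij (fun a _ => ((2 * (a : ℤ) - n) % (2 * (q : ℤ))).toNat) ?_ ?_ ?_
  · intro a ha
    rw [Finset.mem_filter, Finset.mem_range] at ha ⊢
    refine ⟨by have := hlt a; have := hnn a; omega, ?_⟩
    rw [Int.toNat_of_nonneg (hnn a)]
    apply Int.ModEq.symm
    rw [Int.modEq_iff_dvd]
    refine (hsq _ (2 * (a : ℤ) - n) ?_).mpr ((key a).mp ha.2)
    have := Int.emod_add_mul_ediv (2 * (a : ℤ) - n) (2 * q)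
    exact ⟨-((2 * (a : ℤ) - n) / (2 * q)), by linarith⟩
  · intro a ha b hb hab
    rw [Finset.mem_filter, Finset.mem_range] at ha hb
    have h1 : (2 * (a : ℤ) - n) % (2 * (q : ℤ)) = (2 * (b : ℤ) - n) % (2 * (q : ℤ)) := by
      have := hnn a
      have := hnn b
      omega
    have h3 : (2 * (q : ℤ)) ∣ 2 * ((b : ℤ) - a) := by
      have := (Int.modEq_iff_dvd (n := 2 * (q : ℤ))).mp h1
      rwa [show (2 * (b : ℤ) - n) - (2 * a - n) = 2 * (b - a) by ring] at this
    have h4 : (q : ℤ) ∣ (b : ℤ) - a := (mul_dvd_mul_iff_left (by norm_num)).mp h3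
    have h5 := Int.eq_zero_of_abs_lt_dvd h4 (by rw [abs_lt]; constructor <;> omega)
    omega
  · intro x hx
    rw [Finset.mem_filter, Finset.mem_range] at hx
    have h1 : 4 * (q : ℤ) ∣ (x : ℤ) ^ 2 - (n ^ 2 - 4) := Int.modEq_iff_dvd.mp hx.2.symm
    have h2 : (2 : ℤ) ∣ x + n := by
      have h4 : (4 : ℤ) ∣ (x : ℤ) ^ 2 - (n ^ 2 - 4) := (Dvd.intro _ rfl).trans h1
      have h6 : (2 : ℤ) ∣ ((x : ℤ) - n) * (x + n) := by
        obtain ⟨k, hk⟩ := h4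
        exact ⟨2 * k - 2, by linarith⟩
      rcases Int.prime_two.dvd_or_dvd h6 with h | h <;> omega
    obtain ⟨m, hm⟩ := h2
    have hm0 : 0 ≤ m % q := Int.emod_nonneg _ hq0.ne'
    have hm1 : m % q < q := Int.emod_lt_of_pos _ hq0
    have hd := Int.emod_add_mul_ediv m q
    have hxd : 2 * (q : ℤ) ∣ (x : ℤ) - (2 * (m % q) - n) := ⟨m / q, by linarith⟩
    refine ⟨(m % q).toNat, ?_, ?_⟩
    · rw [Finset.mem_filter, Finset.mem_range, Int.toNat_of_nonneg hm0]
      exact ⟨by omega, (key _).mpr ((hsq _ _ hxd).mp h1)⟩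
    · rw [Int.toNat_of_nonneg hm0]
      have : (2 * (m % q) - n) % (2 * (q : ℤ)) = x := by
        rw [(Int.modEq_iff_dvd.mpr hxd : (2 * (m % q) - n) % (2 * (q : ℤ)) = x % (2 * (q : ℤ)))]
        exact Int.emod_eq_of_lt (by positivity) (by exact_mod_cast hx.1)
      rw [this]
      simp

theorem rootCount_eq_card (n : ℤ) (q : ℕ) [NeZero q] :
    rootCount n q = Nat.card {z : ZMod q // z ^ 2 - (n : ZMod q) * z + 1 = 0} := by
  have hdvd : ∀ a : ℕ, (q : ℤ) ∣ (a : ℤ) ^ 2 - n * a + 1 ↔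
      (a : ZMod q) ^ 2 - (n : ZMod q) * a + 1 = 0 := by
    intro a
    rw [← ZMod.intCast_zmod_eq_zero_iff_dvd]
    push_cast
    rfl
  rw [Nat.card_eq_fintype_card, Fintype.card_subtype]
  unfold rootCount
  refine Finset.card_bij (fun a _ => (a : ZMod q)) ?_ ?_ ?_
  · intro a ha
    rw [Finset.mem_filter] at ha ⊢
    exact ⟨Finset.mem_univ _, (hdvd a).mp ha.2⟩
  · intro a ha b hb hab
    rw [Finset.mem_filter, Finset.mem_range] at ha hb
    rw [ZMod.natCast_eq_natCast_iff'] at hab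
    rwa [Nat.mod_eq_of_lt ha.1, Nat.mod_eq_of_lt hb.1] at hab
  · intro z hz
    rw [Finset.mem_filter] at hz
    refine ⟨z.val, ?_, ZMod.natCast_rightInverse z⟩
    rw [Finset.mem_filter, Finset.mem_range, hdvd, ZMod.natCast_rightInverse z]
    exact ⟨ZMod.val_lt z, hz.2⟩

theorem rootCount_zero (n : ℤ) : rootCount n 0 = 0 := by simp [rootCount]

theorem rootCount_one (n : ℤ) : rootCount n 1 = 1 := by simp [rootCount]

theorem rootCount_le (n : ℤ) (q : ℕ) : rootCount n q ≤ q := by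
  simpa [rootCount] using Finset.card_filter_le (Finset.range q) _

theorem rootCount_mul (n : ℤ) {a b : ℕ} (h : a.Coprime b) :
    rootCount n (a * b) = rootCount n a * rootCount n b := by
  rcases Nat.eq_zero_or_pos a with rfl | ha
  · simp [rootCount_zero]
  rcases Nat.eq_zero_or_pos b with rfl | hb
  · simp [rootCount_zero]
  have : NeZero a := ⟨ha.ne'⟩
  have : NeZero b := ⟨hb.ne'⟩
  rw [rootCount_eq_card, rootCount_eq_card, rootCount_eq_card, ← Nat.card_prod]
  refine Nat.card_congr
    (((ZMod.chineseRemainder h).toEquiv.subtypeEquiv (q := fun w : ZMod a × ZMod b =>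
      w.1 ^ 2 - (n : ZMod a) * w.1 + 1 = 0 ∧ w.2 ^ 2 - (n : ZMod b) * w.2 + 1 = 0) ?_).trans
      (Equiv.subtypeProdEquivProd (p := fun w : ZMod a => w ^ 2 - (n : ZMod a) * w + 1 = 0)
        (q := fun w : ZMod b => w ^ 2 - (n : ZMod b) * w + 1 = 0)))
  intro z
  rw [← (ZMod.chineseRemainder h).map_eq_zero_iff]
  simp [Prod.ext_iff]

/-- Two roots modulo `p ^ k` agree up to the involution `a ↦ n - a` modulo a power of `p` which is
smaller by at most the valuation of the discriminant. -/
theorem dvd_sub_or_dvd_add_sub (n : ℤ) {p : ℕ} (hp : p.Prime) {e k : ℕ}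
    (he : ¬ (p : ℤ) ^ (e + 1) ∣ n ^ 2 - 4) (hk : e < k) {a b : ℤ}
    (ha : (p : ℤ) ^ k ∣ a ^ 2 - n * a + 1) (hb : (p : ℤ) ^ k ∣ b ^ 2 - n * b + 1) :
    (p : ℤ) ^ (k - e) ∣ a - b ∨ (p : ℤ) ^ (k - e) ∣ a + b - n := by
  have hp' : Prime (p : ℤ) := Nat.prime_iff_prime_int.mp hp
  have hprod : (p : ℤ) ^ k ∣ (a - b) * (a + b - n) := by
    rw [show (a - b) * (a + b - n) = (a ^ 2 - n * a + 1) - (b ^ 2 - n * b + 1) by ring]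
    exact dvd_sub ha hb
  by_contra hcon
  push Not at hcon
  -- The two factors cannot both be divisible by p^(e+1): otherwise 2b - n would be, and hence also
  -- the discriminant (2b - n)² - 4(b² - nb + 1).
  have h0 : ¬ ((p : ℤ) ^ (e + 1) ∣ a - b ∧ (p : ℤ) ^ (e + 1) ∣ a + b - n) := by
    rintro ⟨h1, h2⟩
    apply he
    have h3 : (p : ℤ) ^ (e + 1) ∣ 2 * b - n := by
      rw [show 2 * b - n = (a + b - n) - (a - b) by ring]
      exact dvd_sub h2 h1
    rw [show n ^ 2 - 4 = (2 * b - n) * (2 * b - n) - 4 * (b ^ 2 - n * b + 1) by ring]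
    exact dvd_sub (h3.mul_right _) (((pow_dvd_pow _ hk).trans hb).mul_left _)
  have main : ∀ x y : ℤ, (p : ℤ) ^ k ∣ x * y → ¬ (p : ℤ) ^ (e + 1) ∣ x →
      (p : ℤ) ^ (k - e) ∣ y := by
    intro x y hxy hx
    have hxf : FiniteMultiplicity (p : ℤ) x := by
      by_contra hinf
      exact hx (FiniteMultiplicity.not_iff_forall.mp hinf (e + 1))
    obtain ⟨x', hx', hx''⟩ := hxf.exists_eq_pow_mul_and_not_dvd
    set j := multiplicity (p : ℤ) x
    have hj : j ≤ e := by
      by_contra hj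
      exact hx (hx' ▸ (pow_dvd_pow _ (by omega)).mul_right _)
    rw [hx', mul_assoc, show k = j + (k - j) by omega, pow_add] at hxy
    have h1 := (mul_dvd_mul_iff_left (pow_ne_zero j hp'.ne_zero)).mp hxy
    have h2 := hp'.pow_dvd_of_dvd_mul_left _ hx'' h1
    exact (pow_dvd_pow _ (by omega)).trans h2
  rcases not_and_or.mp h0 with h | h
  · exact hcon.2 (main _ _ hprod h)
  · exact hcon.1 (main _ _ (mul_comm (a - b) _ ▸ hprod) h)

/-- The point is uniformity in k. For k > e, given one root b, every root lies in the class of b or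
of n - b modulo p^(k-e), and each class has p^e members below p^k. -/
theorem rootCount_prime_pow_le (n : ℤ) {p : ℕ} (hp : p.Prime) {e : ℕ}
    (he : ¬ (p : ℤ) ^ (e + 1) ∣ n ^ 2 - 4) (k : ℕ) :
    rootCount n (p ^ k) ≤ 2 * p ^ e := by
  rcases Nat.lt_or_ge e k with hk | hk
  swap
  · exact (rootCount_le _ _).trans
      ((Nat.pow_le_pow_right hp.pos hk).trans (Nat.le_mul_of_pos_left _ two_pos))
  by_cases hne : ((Finset.range (p ^ k)).filter
      fun a : ℕ => ((p ^ k : ℕ) : ℤ) ∣ (a : ℤ) ^ 2 - n * a + 1).Nonempty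
  swap
  · rw [Finset.not_nonempty_iff_eq_empty] at hne
    rw [rootCount, hne]
    simp
  obtain ⟨b, hb⟩ := hne
  rw [Finset.mem_filter] at hb
  have hpos : 0 < p ^ (k - e) := pow_pos hp.pos _
  have hcard : ∀ v : ℕ, ((Finset.range (p ^ k)).filter fun a => a ≡ v [MOD p ^ (k - e)]).card
      = p ^ e := by
    intro v
    have h := Nat.count_modEq_card_eq_ceil (p ^ k) hpos v
    rw [Nat.count_eq_card_filter_range] at h
    have hpk : p ^ k = p ^ (k - e) * p ^ e := by rw [← pow_add]; congr 1; omega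
    zify
    rw [h, hpk]
    have h1 : (0 : ℚ) < p ^ (k - e) := by exact_mod_cast hpos
    have h2 : v % p ^ (k - e) < p ^ (k - e) := Nat.mod_lt _ hpos
    rw [Int.ceil_eq_iff]
    push_cast
    rw [lt_div_iff₀ h1, div_le_iff₀ h1]
    have h3 : ((v % p ^ (k - e) : ℕ) : ℚ) < p ^ (k - e) := by exact_mod_cast h2
    have h4 : (0 : ℚ) ≤ ((v % p ^ (k - e) : ℕ) : ℚ) := Nat.cast_nonneg _
    constructor <;> nlinarith
  have hsub : ((Finset.range (p ^ k)).filter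
      fun a : ℕ => ((p ^ k : ℕ) : ℤ) ∣ (a : ℤ) ^ 2 - n * a + 1) ⊆
      ((Finset.range (p ^ k)).filter fun a => a ≡ b [MOD p ^ (k - e)]) ∪
      ((Finset.range (p ^ k)).filter fun a =>
        a ≡ ((n - b) % (p ^ (k - e) : ℕ)).toNat [MOD p ^ (k - e)]) := by
    intro a ha
    rw [Finset.mem_filter] at ha
    rw [Finset.mem_union, Finset.mem_filter, Finset.mem_filter]
    have h1 := ha.2
    have h2 := hb.2
    push_cast at h1 h2
    rcases dvd_sub_or_dvd_add_sub n hp he hk h1 h2 with h | h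
    · left
      refine ⟨ha.1, Nat.ModEq.symm ?_⟩
      rw [Nat.modEq_iff_dvd]
      push_cast
      exact h
    · right
      refine ⟨ha.1, Nat.ModEq.symm ?_⟩
      rw [Nat.modEq_iff_dvd, Int.toNat_of_nonneg (Int.emod_nonneg _ (by exact_mod_cast hpos.ne'))]
      have := Int.emod_add_mul_ediv (n - b) ((p ^ (k - e) : ℕ) : ℤ)
      have h3 : ((p ^ (k - e) : ℕ) : ℤ) ∣ a + b - n := by push_cast; exact h
      obtain ⟨c, hc⟩ := h3
      refine ⟨c + (n - b) / ((p ^ (k - e) : ℕ) : ℤ), ?_⟩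
      rw [mul_add]
      linarith
  calc rootCount n (p ^ k) ≤ _ := Finset.card_le_card hsub
    _ ≤ _ := Finset.card_union_le _ _
    _ = 2 * p ^ e := by rw [hcard, hcard, two_mul]

end PrimeGeodesic

/-! ### Hensel lifting and the quadratic character of the discriminant -/

namespace PrimeGeodesic

/-- A Newton step. The derivative 2a - n is invertible modulo p because its square is the
discriminant modulo a² - na + 1. -/
theorem exists_root_pow_succ (n : ℤ) {p : ℕ} (hp : p.Prime) (hd : ¬ (p : ℤ) ∣ n ^ 2 - 4)
    {k : ℕ} (hk : 1 ≤ k) {a : ℤ} (ha : (p : ℤ) ^ k ∣ a ^ 2 - n * a + 1) :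
    ∃ b : ℤ, (p : ℤ) ^ (k + 1) ∣ b ^ 2 - n * b + 1 := by
  have hp' : Prime (p : ℤ) := Nat.prime_iff_prime_int.mp hp
  have hpa : (p : ℤ) ∣ a ^ 2 - n * a + 1 := (dvd_pow_self _ (by omega)).trans ha
  have h1 : ¬ (p : ℤ) ∣ 2 * a - n := by
    intro h
    apply hd
    rw [show n ^ 2 - 4 = (2 * a - n) * (2 * a - n) - 4 * (a ^ 2 - n * a + 1) by ring]
    exact dvd_sub (h.mul_right _) (hpa.mul_left _)
  obtain ⟨x, y, hxy⟩ := (Prime.coprime_iff_not_dvd hp').mpr h1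
  obtain ⟨c, hc⟩ := ha
  -- Here c = (a² - na + 1)/p^k and y inverts 2a - n modulo p.
  refine ⟨a - (p : ℤ) ^ k * (c * y), ?_⟩
  obtain ⟨j, rfl⟩ : ∃ j, k = j + 1 := ⟨k - 1, by omega⟩
  refine ⟨c * x + (p : ℤ) ^ j * (c * y) ^ 2, ?_⟩
  have : (a - (p : ℤ) ^ (j + 1) * (c * y)) ^ 2 - n * (a - (p : ℤ) ^ (j + 1) * (c * y)) + 1
      = (a ^ 2 - n * a + 1) - (p : ℤ) ^ (j + 1) * c * (y * (2 * a - n))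
        + ((p : ℤ) ^ (j + 1) * (c * y)) ^ 2 := by ring
  rw [this, hc, show y * (2 * a - n) = 1 - x * p by linarith]
  ring

theorem exists_root_pow (n : ℤ) {p : ℕ} (hp : p.Prime) (hd : ¬ (p : ℤ) ∣ n ^ 2 - 4)
    {a : ℤ} (ha : (p : ℤ) ∣ a ^ 2 - n * a + 1) (k : ℕ) :
    ∃ b : ℤ, (p : ℤ) ^ (k + 1) ∣ b ^ 2 - n * b + 1 := by
  induction k with
  | zero => exact ⟨a, by simpa using ha⟩
  | succ k ih =>
    obtain ⟨b, hb⟩ := ih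
    exact exists_root_pow_succ n hp hd (by omega) hb

/-- The roots are b and n - b for a lifted root b. They differ since p does not divide the
discriminant, and there are no others by the case e = 0 of `dvd_sub_or_dvd_add_sub`. -/
theorem rootCount_prime_pow_of_root (n : ℤ) {p : ℕ} (hp : p.Prime) (hd : ¬ (p : ℤ) ∣ n ^ 2 - 4)
    {a : ℤ} (ha : (p : ℤ) ∣ a ^ 2 - n * a + 1) (k : ℕ) : rootCount n (p ^ (k + 1)) = 2 := by
  obtain ⟨b, hb⟩ := exists_root_pow n hp hd ha k
  have hne : NeZero (p ^ (k + 1)) := ⟨(pow_pos hp.pos _).ne'⟩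
  rw [rootCount_eq_card, Nat.card_eq_fintype_card, Fintype.card_subtype]
  have hz : ∀ c : ℤ, (p : ℤ) ^ (k + 1) ∣ c ↔ (c : ZMod (p ^ (k + 1))) = 0 := by
    intro c
    rw [ZMod.intCast_zmod_eq_zero_iff_dvd]
    push_cast
    rfl
  have hbn : (b : ZMod (p ^ (k + 1))) ≠ ((n - b : ℤ) : ZMod (p ^ (k + 1))) := by
    intro h
    have h2 : (p : ℤ) ^ (k + 1) ∣ 2 * b - n := by
      rw [hz]
      push_cast at h ⊢
      linear_combination h
    apply hd
    refine (dvd_pow_self (p : ℤ) (Nat.succ_ne_zero k)).trans ?_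
    rw [show n ^ 2 - 4 = (2 * b - n) * (2 * b - n) - 4 * (b ^ 2 - n * b + 1) by ring]
    exact dvd_sub (h2.mul_right _) (hb.mul_left _)
  have : (Finset.univ.filter fun z : ZMod (p ^ (k + 1)) => z ^ 2 - (n : ZMod (p ^ (k + 1))) * z + 1 = 0)
      = {(b : ZMod (p ^ (k + 1))), ((n - b : ℤ) : ZMod (p ^ (k + 1)))} := by
    ext z
    simp only [Finset.mem_filter, Finset.mem_univ, true_and, Finset.mem_insert,
      Finset.mem_singleton]
    obtain ⟨c, rfl⟩ := ZMod.intCast_surjective z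
    have hroot : (c : ZMod (p ^ (k + 1))) ^ 2 - (n : ZMod (p ^ (k + 1))) * c + 1 = 0 ↔
        (p : ℤ) ^ (k + 1) ∣ c ^ 2 - n * c + 1 := by
      rw [hz]; push_cast; rfl
    rw [hroot]
    constructor
    · intro hc
      rcases dvd_sub_or_dvd_add_sub n hp (e := 0) (by simpa using hd) (Nat.succ_pos k) hc hb
        with h | h
      · left
        rw [Nat.sub_zero, hz] at h
        push_cast at h
        linear_combination h
      · right
        rw [Nat.sub_zero, hz] at h
        push_cast at h ⊢
        linear_combination h
    · have hb' := (hz _).mp hb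
      rw [hz]
      push_cast at hb' ⊢
      rintro (h | h)
      · rw [h]; exact hb'
      · rw [h]; linear_combination hb'
  rw [this, Finset.card_pair hbn]

theorem rootCount_prime_pow (n : ℤ) {p : ℕ} (hp : p.Prime) (hp2 : p ≠ 2)
    (hd : ¬ (p : ℤ) ∣ n ^ 2 - 4) (k : ℕ) :
    (rootCount n (p ^ (k + 1)) : ℤ) = 1 + jacobiSym (n ^ 2 - 4) p := by
  have : Fact p.Prime := ⟨hp⟩
  have hodd : ¬ (p : ℤ) ∣ 2 := by
    intro h
    have := Int.le_of_dvd two_pos h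
    have := hp.two_le
    omega
  have hp' : Prime (p : ℤ) := Nat.prime_iff_prime_int.mp hp
  rw [← jacobiSym.legendreSym.to_jacobiSym]
  have h0 : ((n ^ 2 - 4 : ℤ) : ZMod p) ≠ 0 := by
    rwa [Ne, ZMod.intCast_zmod_eq_zero_iff_dvd]
  by_cases hr : ∃ a : ℤ, (p : ℤ) ∣ a ^ 2 - n * a + 1
  · obtain ⟨a, ha⟩ := hr
    rw [rootCount_prime_pow_of_root n hp hd ha, (legendreSym.eq_one_iff p h0).mpr]
    · norm_num
    · refine ⟨((2 * a - n : ℤ) : ZMod p), ?_⟩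
      rw [← Int.cast_mul, ZMod.intCast_eq_intCast_iff_dvd_sub]
      rw [show (2 * a - n) * (2 * a - n) - (n ^ 2 - 4) = 4 * (a ^ 2 - n * a + 1) by ring]
      exact ha.mul_left _
  · rw [(legendreSym.eq_neg_one_iff p).mpr]
    · have : rootCount n (p ^ (k + 1)) = 0 := by
        rw [rootCount, Finset.card_eq_zero, Finset.filter_eq_empty_iff]
        intro a _ ha
        refine hr ⟨a, ?_⟩
        refine (dvd_pow_self (p : ℤ) (Nat.succ_ne_zero k)).trans ?_
        exact_mod_cast ha
      rw [this]; norm_num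
    · rintro ⟨z, hz⟩
      apply hr
      obtain ⟨x, rfl⟩ := ZMod.intCast_surjective z
      obtain ⟨u, v, huv⟩ := (Prime.coprime_iff_not_dvd hp').mpr hodd
      rw [← Int.cast_mul, ZMod.intCast_eq_intCast_iff_dvd_sub] at hz
      -- As v inverts 2 modulo p, this is the root (n + √D)/2 of the quadratic formula.
      refine ⟨v * (x + n), ?_⟩
      have h4 : (p : ℤ) ∣ 4 * ((v * (x + n)) ^ 2 - n * (v * (x + n)) + 1) := by
        have hv : 2 * (v * (x + n)) - n = x - u * p * (x + n) := by linear_combination (x + n) * huv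
        rw [show 4 * ((v * (x + n)) ^ 2 - n * (v * (x + n)) + 1)
          = (2 * (v * (x + n)) - n) ^ 2 - (n ^ 2 - 4) by ring, hv]
        obtain ⟨w, hw⟩ := hz
        refine ⟨w - 2 * x * u * (x + n) + u ^ 2 * p * (x + n) ^ 2, ?_⟩
        linear_combination hw
      rcases hp'.dvd_or_dvd h4 with h | h
      · rw [show (4 : ℤ) = 2 * 2 by norm_num] at h
        exact absurd (hp'.dvd_or_dvd h) (by tauto)
      · exact h

/-- The quadratic character attached to `d`, restricted to odd arguments. -/
def jacobiChar (d : ℤ) (q : ℕ) : ℤ := if q % 2 = 1 then jacobiSym d q else 0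

theorem jacobiChar_one (d : ℤ) : jacobiChar d 1 = 1 := by simp [jacobiChar]

theorem jacobiChar_mul (d : ℤ) (a b : ℕ) :
    jacobiChar d (a * b) = jacobiChar d a * jacobiChar d b := by
  unfold jacobiChar
  rcases Nat.mod_two_eq_zero_or_one a with ha | ha <;>
  rcases Nat.mod_two_eq_zero_or_one b with hb | hb <;> simp [Nat.mul_mod, ha, hb]
  exact jacobiSym.mul_right' d (by rintro rfl; simp at ha) (by rintro rfl; simp at hb)

theorem abs_jacobiChar_le (d : ℤ) (q : ℕ) : |jacobiChar d q| ≤ 1 := by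
  unfold jacobiChar
  split_ifs
  · rcases jacobiSym.trichotomy d q with h | h | h <;> simp [h]
  · simp

theorem jacobiChar_mod (d : ℤ) (q : ℕ) :
    jacobiChar d (q % (4 * d.natAbs)) = jacobiChar d q := by
  unfold jacobiChar
  have h : q % (4 * d.natAbs) % 2 = q % 2 :=
    Nat.mod_mod_of_dvd _ ⟨2 * d.natAbs, by ring⟩
  rw [h]
  split_ifs with hq
  · exact (jacobiSym.mod_right d (Nat.odd_iff.mpr hq)).symm
  · rfl

/-- A positive integer which is not a square has a prime divisor of odd exponent. -/
theorem exists_eq_prime_mul_sq_mul {d : ℕ} (hd : ¬ IsSquare d) (hd0 : d ≠ 0) :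
    ∃ p k m : ℕ, p.Prime ∧ ¬ p ∣ m ∧ d = p ^ (2 * k + 1) * m := by
  by_contra hcon
  push Not at hcon
  apply hd
  have heven : ∀ p ∈ d.primeFactors, Even (d.factorization p) := by
    intro p hp
    by_contra hodd
    rw [Nat.not_even_iff_odd] at hodd
    obtain ⟨k, hk⟩ := hodd
    have hpp := Nat.prime_of_mem_primeFactors hp
    refine hcon p k (d / p ^ d.factorization p) hpp (Nat.not_dvd_ordCompl hpp hd0) ?_
    rw [← hk]
    exact (Nat.ordProj_mul_ordCompl_eq_self d p).symm
  rw [← Nat.prod_factorization_pow_eq_self hd0]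
  unfold Finsupp.prod
  refine ⟨∏ p ∈ d.primeFactors, p ^ (d.factorization p / 2), ?_⟩
  rw [← Finset.prod_mul_distrib]
  refine Finset.prod_congr rfl fun p hp => ?_
  obtain ⟨k, hk⟩ := heven p hp
  rw [hk, ← pow_add]
  congr 1
  omega

/-- Write d = p^(2k+1)·m with p ∤ m. Taking b ≡ 1 mod 4m makes (m/b) = 1, so the character at b is
(p/b). For odd p, b is also chosen a nonresidue modulo p and reciprocity applies as b ≡ 1 mod 4. For
p = 2, b ≡ 5 mod 8 is compatible with b ≡ 1 mod 4 and gives (2/b) = -1. -/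
theorem exists_jacobiChar_eq_neg_one {d : ℕ} (hd : ¬ IsSquare d) (hd0 : d ≠ 0) :
    ∃ b : ℕ, b.Coprime (4 * d) ∧ jacobiChar d b = -1 := by
  obtain ⟨p, k, m, hp, hpm, rfl⟩ := exists_eq_prime_mul_sq_mul hd hd0
  have hm0 : m ≠ 0 := by rintro rfl; simp at hd0
  have hJ1 : ∀ b : ℕ, b % 2 = 1 → b ≡ 1 [MOD 4 * m] → jacobiSym (m : ℤ) b = 1 := by
    intro b hb hbm
    rw [jacobiSym.mod_right' m (Nat.odd_iff.mpr hb), hbm,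
      ← jacobiSym.mod_right' m odd_one, jacobiSym.one_right]
  have hJ : ∀ b : ℕ, b % 2 = 1 → b ≡ 1 [MOD 4 * m] → jacobiSym (p : ℤ) b = -1 →
      jacobiChar ((p ^ (2 * k + 1) * m : ℕ) : ℤ) b = -1 := by
    intro b hb hbm hpb
    rw [jacobiChar, if_pos hb]
    push_cast
    rw [jacobiSym.mul_left, jacobiSym.pow_left, hpb, hJ1 b hb hbm]
    simp [pow_succ, pow_mul]
  have hcop : ∀ b : ℕ, b ≡ 1 [MOD 4 * m] → b.Coprime p →
      b.Coprime (4 * (p ^ (2 * k + 1) * m)) := by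
    intro b hbm hbp
    have h1 : b.Coprime (4 * m) := by
      rw [Nat.Coprime, hbm.gcd_eq, Nat.gcd_one_left]
    rw [show 4 * (p ^ (2 * k + 1) * m) = (4 * m) * p ^ (2 * k + 1) by ring]
    exact Nat.Coprime.mul_right h1 (hbp.pow_right _)
  have hodd : ∀ b : ℕ, b ≡ 1 [MOD 4 * m] → b % 2 = 1 := by
    intro b hbm
    exact hbm.of_dvd (Dvd.intro (2 * m) (by ring) : 2 ∣ 4 * m)
  rcases eq_or_ne p 2 with rfl | hp2
  · have h8 : Nat.Coprime 8 m :=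
      Nat.Coprime.pow_left 3 ((Nat.Prime.coprime_iff_not_dvd Nat.prime_two).mpr hpm)
    obtain ⟨b, hb8, hbm⟩ := Nat.chineseRemainder h8 5 1
    have hb4 : b ≡ 1 [MOD 4 * m] := by
      refine (Nat.modEq_and_modEq_iff_modEq_mul ?_).mp ⟨?_, hbm⟩
      · exact Nat.Coprime.coprime_dvd_left (by norm_num) h8
      · exact (hb8.of_dvd (by norm_num : 4 ∣ 8)).trans rfl
    refine ⟨b, hcop b hb4 ?_, hJ b (hodd b hb4) hb4 ?_⟩
    · exact Nat.coprime_two_right.mpr (Nat.odd_iff.mpr (hodd b hb4))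
    · rw [Nat.cast_ofNat, jacobiSym.at_two (Nat.odd_iff.mpr (hodd b hb4)),
        ZMod.χ₈_nat_mod_eight, hb8]
      decide
  · have hfact : Fact p.Prime := ⟨hp⟩
    have hpodd : Odd p := hp.odd_of_ne_two hp2
    obtain ⟨r, hr⟩ := FiniteField.exists_nonsquare (F := ZMod p)
      (by rw [ZMod.ringChar_zmod_n]; exact hp2)
    have hcp : Nat.Coprime p (4 * m) := by
      refine Nat.Coprime.mul_right ?_ ((Nat.Prime.coprime_iff_not_dvd hp).mpr hpm)
      exact Nat.Coprime.pow_right 2 (Nat.coprime_two_right.mpr hpodd)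
    obtain ⟨b, hbp, hbm⟩ := Nat.chineseRemainder hcp r.val 1
    have hbr : (b : ZMod p) = r := by
      rw [(ZMod.natCast_eq_natCast_iff _ _ _).mpr hbp, ZMod.natCast_rightInverse r]
    have hr0 : r ≠ 0 := by rintro rfl; exact hr ⟨0, by simp⟩
    refine ⟨b, hcop b hbm ?_, hJ b (hodd b hbm) hbm ?_⟩
    · rw [Nat.coprime_comm, Nat.Prime.coprime_iff_not_dvd hp, ← ZMod.natCast_eq_zero_iff, hbr]
      exact hr0
    · have hb4 : b % 4 = 1 := hbm.of_dvd (Dvd.intro m rfl : 4 ∣ 4 * m)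
      rw [jacobiSym.quadratic_reciprocity_one_mod_four' hpodd hb4,
        ← jacobiSym.legendreSym.to_jacobiSym, legendreSym.eq_neg_one_iff]
      simpa [hbr] using hr

/-- The partial sums of the quadratic character of a non-square are bounded. -/
theorem exists_abs_sum_jacobiChar_le {d : ℕ} (hd : ¬ IsSquare d) (hd0 : d ≠ 0) :
    ∃ B : ℝ, ∀ N : ℕ, |∑ q ∈ Finset.range N, (jacobiChar d q : ℝ)| ≤ B := by
  set M := 4 * d with hM
  have hM0 : 0 < M := by omega
  have hne : NeZero M := ⟨hM0.ne'⟩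
  have hmod : ∀ q : ℕ, jacobiChar d (q % M) = jacobiChar d q := fun q => by
    simpa using jacobiChar_mod (d : ℤ) q
  obtain ⟨b, hbc, hb⟩ := exists_jacobiChar_eq_neg_one hd hd0
  -- Multiplication by b permutes the residues and flips the sign of every term, so the sum over a
  -- full period vanishes.
  have hz : ∑ z : ZMod M, jacobiChar d z.val = 0 := by
    have h1 : ∑ z : ZMod M, jacobiChar d z.val
        = ∑ z : ZMod M, jacobiChar d (((ZMod.unitOfCoprime b hbc : (ZMod M)ˣ) : ZMod M) * z).val :=
      (Fintype.sum_bijective _ (Units.mulLeft_bijective (ZMod.unitOfCoprime b hbc)) _ _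
        fun _ => rfl).symm
    have h2 : ∀ z : ZMod M, jacobiChar d (((ZMod.unitOfCoprime b hbc : (ZMod M)ˣ) : ZMod M) * z).val
        = - jacobiChar d z.val := by
      intro z
      rw [ZMod.coe_unitOfCoprime, ZMod.val_mul, ZMod.val_natCast, hmod, jacobiChar_mul, hmod, hb]
      ring
    simp only [h2, Finset.sum_neg_distrib] at h1
    omega
  have hper : ∑ q ∈ Finset.range M, jacobiChar d q = 0 := by
    rw [← hz]
    symm
    refine Finset.sum_bij (fun z _ => z.val) ?_ ?_ ?_ ?_
    · intro z _; simpa using ZMod.val_lt z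
    · intro a _ b _ h; exact ZMod.val_injective M h
    · intro q hq
      exact ⟨(q : ZMod M), Finset.mem_univ _, ZMod.val_cast_of_lt (by simpa using hq)⟩
    · intro z _; rfl
  have hadd : ∀ N, ∑ q ∈ Finset.range (M + N), jacobiChar d q
      = ∑ q ∈ Finset.range N, jacobiChar d q := by
    intro N
    rw [Finset.sum_range_add, hper, zero_add]
    refine Finset.sum_congr rfl fun q _ => ?_
    rw [← hmod, Nat.add_mod_left, hmod]
  have hred : ∀ k N, ∑ q ∈ Finset.range (M * k + N), jacobiChar d q
      = ∑ q ∈ Finset.range N, jacobiChar d q := by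
    intro k N
    induction k with
    | zero => simp
    | succ k ih => rw [← ih, ← hadd (M * k + N)]; congr 2; ring
  refine ⟨M, fun N => ?_⟩
  rw [← Nat.div_add_mod N M]
  have h1 : ∑ q ∈ Finset.range (M * (N / M) + N % M), (jacobiChar d q : ℝ)
      = ∑ q ∈ Finset.range (N % M), (jacobiChar d q : ℝ) := by exact_mod_cast hred _ _
  rw [h1]
  refine (Finset.abs_sum_le_sum_abs _ _).trans ?_
  refine (Finset.sum_le_card_nsmul _ _ 1 fun q _ => ?_).trans ?_
  · exact_mod_cast abs_jacobiChar_le d q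
  · have := (Nat.mod_lt N hM0).le
    simpa using (by exact_mod_cast this : ((N % M : ℕ) : ℝ) ≤ M)

end PrimeGeodesic

/-! ### Zagier's coefficients as a convolution and their Euler product -/

namespace PrimeGeodesic

open ArithmeticFunction

/-- The indicator function of the nonzero squares. -/
def squareIndicator : ArithmeticFunction ℤ :=
  ⟨fun n => if n ≠ 0 ∧ IsSquare n then 1 else 0, by simp⟩

/-- `rootCount` as an arithmetic function. -/
def rootFn (n : ℤ) : ArithmeticFunction ℤ := ⟨fun q => rootCount n q, by simp [rootCount_zero]⟩

/-- The coefficients of Zagier's `L`-function of discriminant `n ^ 2 - 4`, as a convolution. -/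
def zagierFn (n : ℤ) : ArithmeticFunction ℤ := squareIndicator * moebius * rootFn n

/-- `jacobiChar` as an arithmetic function. -/
def jacobiFn (d : ℤ) : ArithmeticFunction ℤ := ⟨jacobiChar d, by simp [jacobiChar]⟩

theorem squareIndicator_apply (n : ℕ) :
    squareIndicator n = if n ≠ 0 ∧ IsSquare n then 1 else 0 := rfl

theorem rootFn_apply (n : ℤ) (q : ℕ) : rootFn n q = rootCount n q := rfl

theorem jacobiFn_apply (d : ℤ) (q : ℕ) : jacobiFn d q = jacobiChar d q := rfl

theorem isSquare_of_coprime_mul {a b : ℕ} (h : a.Coprime b) (hs : IsSquare (a * b)) :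
    IsSquare a := by
  obtain ⟨c, hc⟩ := hs
  rw [← sq] at hc
  obtain ⟨e, he⟩ := exists_eq_pow_of_mul_eq_pow (Nat.isUnit_iff.mpr h) hc
  exact ⟨e, by rw [he, sq]⟩

theorem isMultiplicative_squareIndicator : squareIndicator.IsMultiplicative := by
  rw [IsMultiplicative.iff_ne_zero]
  refine ⟨by simp [squareIndicator_apply], fun {a b} ha hb hab => ?_⟩
  simp only [squareIndicator_apply, ne_eq, ha, hb, mul_eq_zero, or_self, not_false_eq_true,
    true_and]
  by_cases h1 : IsSquare a <;> by_cases h2 : IsSquare b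
  · simp [h1, h2, h1.mul h2]
  · rw [if_neg fun h => h2 (isSquare_of_coprime_mul hab.symm (mul_comm a b ▸ h))]
    simp [h2]
  · rw [if_neg fun h => h1 (isSquare_of_coprime_mul hab h)]
    simp [h1]
  · rw [if_neg fun h => h1 (isSquare_of_coprime_mul hab h)]
    simp [h1]

theorem isMultiplicative_rootFn (n : ℤ) : (rootFn n).IsMultiplicative := by
  refine ⟨by simp [rootFn_apply, rootCount_one], fun {a b} hab => ?_⟩
  rw [rootFn_apply, rootCount_mul n hab]
  push_cast
  rfl

theorem isMultiplicative_zagierFn (n : ℤ) : (zagierFn n).IsMultiplicative :=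
  (isMultiplicative_squareIndicator.mul isMultiplicative_moebius).mul (isMultiplicative_rootFn n)

theorem isMultiplicative_jacobiFn (d : ℤ) : (jacobiFn d).IsMultiplicative :=
  ⟨jacobiChar_one d, fun {a b} _ => jacobiChar_mul d a b⟩

/-- The triples (q₁, q₂, q₃) inject into the nested factorizations q = (u·b)·c by u = q₁². The
factorizations that are missed have u not a square and contribute nothing. -/
theorem lam_eq_zagierFn (n : ℤ) {q : ℕ} (hq : q ≠ 0) : lam q (n ^ 2 - 4) = zagierFn n q := by
  unfold lam zagierFn
  rw [mul_apply]
  simp only [mul_apply, Finset.sum_mul]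
  rw [Finset.sum_sigma']
  refine Finset.sum_of_injOn (fun t => ⟨(t.1 ^ 2 * t.2.1, t.2.2), (t.1 ^ 2, t.2.1)⟩) ?_ ?_ ?_ ?_
  · rintro ⟨a, b, c⟩ - ⟨a', b', c'⟩ - h
    simp only [Sigma.mk.injEq, Prod.mk.injEq, heq_eq_eq] at h
    obtain ⟨⟨-, rfl⟩, h1, rfl⟩ := h
    rw [Nat.pow_left_injective (n := 2) (by norm_num) h1]
  · rintro ⟨a, b, c⟩ h
    simp only [Finset.coe_filter, Finset.mem_product, Nat.mem_divisors, Set.mem_ofPred_eq] at h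
    have h1 : a ^ 2 * b ≠ 0 := by rintro h0; rw [h0] at h; simp at h; omega
    simp only [Finset.coe_sigma, Set.mem_sigma_iff, Finset.mem_coe, Nat.mem_divisorsAntidiagonal]
    exact ⟨⟨h.2, hq⟩, trivial, h1⟩
  · rintro ⟨⟨x, c⟩, ⟨u, b⟩⟩ h hn
    simp only [Finset.mem_sigma, Nat.mem_divisorsAntidiagonal] at h
    obtain ⟨⟨h1, -⟩, h2, h3⟩ := h
    suffices hs : ¬ IsSquare u by simp [squareIndicator_apply, hs]
    rintro ⟨a, ha⟩
    apply hn
    rw [← sq] at ha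
    subst ha
    refine ⟨(a, b, c), ?_, ?_⟩
    · simp only [Finset.coe_filter, Finset.mem_product, Nat.mem_divisors, Set.mem_ofPred_eq]
      have h4 : a ^ 2 * b * c = q := by rw [h2]; exact h1
      exact ⟨⟨⟨⟨a * b * c, by rw [← h4]; ring⟩, hq⟩, ⟨⟨a ^ 2 * c, by rw [← h4]; ring⟩, hq⟩,
        ⟨a ^ 2 * b, by rw [← h4]; ring⟩, hq⟩, h4⟩
    · simp only [h2]
  · rintro ⟨a, b, c⟩ h
    simp only [Finset.mem_filter, Finset.mem_product, Nat.mem_divisors] at h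
    have h1 : a ≠ 0 := by rintro rfl; simp at h
    have h2 : c ≠ 0 := by rintro rfl; simp at h
    rw [squareIndicator_apply, if_pos ⟨pow_ne_zero 2 h1, a, sq a⟩, rootFn_apply,
      rho_eq_rootCount n h2, one_mul]

theorem mul_apply_prime_pow (f g : ArithmeticFunction ℤ) {p : ℕ} (hp : p.Prime) (k : ℕ) :
    (f * g) (p ^ k) = ∑ i ∈ Finset.range (k + 1), f (p ^ i) * g (p ^ (k - i)) := by
  rw [mul_apply, Nat.sum_divisorsAntidiagonal (fun a b => f a * g b), Nat.divisors_prime_pow hp,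
    Finset.sum_map]
  refine Finset.sum_congr rfl fun i hi => ?_
  rw [Finset.mem_range] at hi
  simp only [Function.Embedding.coeFn_mk]
  rw [Nat.pow_div (by omega) hp.pos]

theorem isSquare_prime_pow_iff {p : ℕ} (hp : p.Prime) (k : ℕ) : IsSquare (p ^ k) ↔ Even k := by
  constructor
  · rintro ⟨m, hm⟩
    have hm0 : m ≠ 0 := by
      rintro rfl
      exact (pow_pos hp.pos k).ne' hm
    have := congrArg (fun x => x.factorization p) hm
    simp only [hp.factorization_pow, Nat.factorization_mul hm0 hm0] at this
    exact ⟨m.factorization p, by simpa using this⟩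
  · rintro ⟨m, rfl⟩
    exact ⟨p ^ m, pow_add _ _ _⟩

/-- This is Liouville's function, with Dirichlet series ζ(2s)/ζ(s). As μ kills p^j for j ≥ 2, only
the last two terms survive, and exactly one of the two consecutive exponents is even. -/
theorem squareIndicator_mul_moebius_prime_pow {p : ℕ} (hp : p.Prime) (k : ℕ) :
    (squareIndicator * moebius) (p ^ k) = (-1) ^ k := by
  have hs : ∀ i, squareIndicator (p ^ i) = if Even i then 1 else 0 := by
    intro i
    simp only [squareIndicator_apply, isSquare_prime_pow_iff hp, ne_eq, (pow_pos hp.pos i).ne', not_false_eq_true, true_and]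
  rw [mul_apply_prime_pow _ _ hp]
  rcases k with _ | k
  · simp [isMultiplicative_squareIndicator.1]
  rw [Finset.sum_range_succ, Finset.sum_range_succ, Finset.sum_eq_zero]
  · have h1 : k + 1 - k = 1 := by omega
    rw [h1, Nat.sub_self, pow_one, pow_zero, moebius_apply_prime hp, moebius_apply_one, hs, hs]
    rcases Nat.even_or_odd k with h | h
    · have h' : ¬ Even (k + 1) := by rwa [Nat.even_add_one, not_not]
      rw [if_pos h, if_neg h', Odd.neg_one_pow (Nat.not_even_iff_odd.mp h')]
      norm_num
    · have h' : Even (k + 1) := by rwa [Nat.even_add_one, Nat.not_even_iff_odd]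
      rw [if_neg (Nat.not_even_iff_odd.mpr h), if_pos h', Even.neg_one_pow h']
      norm_num
  · intro i hi
    rw [Finset.mem_range] at hi
    rw [moebius_apply_prime_pow hp (by omega), if_neg (by omega), mul_zero]

theorem zagierFn_prime_pow (n : ℤ) {p : ℕ} (hp : p.Prime) (k : ℕ) :
    zagierFn n (p ^ k) = ∑ i ∈ Finset.range (k + 1), (-1) ^ i * (rootCount n (p ^ (k - i)) : ℤ) := by
  unfold zagierFn
  rw [mul_apply_prime_pow _ _ hp]
  refine Finset.sum_congr rfl fun i _ => ?_
  rw [squareIndicator_mul_moebius_prime_pow hp, rootFn_apply]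

theorem zagierFn_prime_pow_succ (n : ℤ) {p : ℕ} (hp : p.Prime) (k : ℕ) :
    zagierFn n (p ^ (k + 1)) = rootCount n (p ^ (k + 1)) - zagierFn n (p ^ k) := by
  rw [zagierFn_prime_pow n hp, zagierFn_prime_pow n hp, Finset.sum_range_succ', sub_eq_neg_add,
    ← Finset.sum_neg_distrib]
  congr 1
  · refine Finset.sum_congr rfl fun i _ => ?_
    rw [Nat.add_sub_add_right]
    ring
  · simp

/-- Writing ε = ±1 for the symbol at p, consecutive coefficients add up to the root count 1 + ε, and
ε^k solves this recursion. -/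
theorem zagierFn_prime_pow_eq_jacobiChar (n : ℤ) {p : ℕ} (hp : p.Prime) (hp2 : p ≠ 2)
    (hd : ¬ (p : ℤ) ∣ n ^ 2 - 4) (k : ℕ) :
    zagierFn n (p ^ k) = jacobiChar (n ^ 2 - 4) (p ^ k) := by
  have hodd : p % 2 = 1 := Nat.odd_iff.mp (hp.odd_of_ne_two hp2)
  have hpow : ∀ j, jacobiChar (n ^ 2 - 4) (p ^ (j + 1))
      = jacobiChar (n ^ 2 - 4) (p ^ j) * jacobiSym (n ^ 2 - 4) p := by
    intro j
    rw [pow_succ p, jacobiChar_mul]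
    congr 1
    simp [jacobiChar, hodd]
  have hpm : jacobiSym (n ^ 2 - 4) p = 1 ∨ jacobiSym (n ^ 2 - 4) p = -1 := by
    rcases jacobiSym.trichotomy (n ^ 2 - 4) p with h | h
    · exfalso
      rw [jacobiSym.eq_zero_iff] at h
      apply h.2
      rw [Int.gcd_comm, ← Int.isCoprime_iff_gcd_eq_one]
      exact (Prime.coprime_iff_not_dvd (Nat.prime_iff_prime_int.mp hp)).mpr hd
    · exact h
  induction k with
  | zero => simp [jacobiChar_one, (isMultiplicative_zagierFn n).1]
  | succ k ih =>
    rw [zagierFn_prime_pow_succ n hp, ih, rootCount_prime_pow n hp hp2 hd, hpow]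
    have : jacobiChar (n ^ 2 - 4) (p ^ k) = jacobiSym (n ^ 2 - 4) p ^ k := by
      clear ih
      induction k with
      | zero => simp [jacobiChar_one]
      | succ k ih => rw [hpow, ih, ← pow_succ]
    rw [this]
    rcases hpm with h | h
    · rw [h]; simp
    · rw [h]; ring

/-- The part of the coefficients of Zagier's `L`-function supported on the integers composed of
prime divisors of `4 d`. -/
def zagierBadFn (n : ℤ) (d : ℕ) : ArithmeticFunction ℤ :=
  ⟨fun m => if m ∈ Nat.factoredNumbers (4 * d).primeFactors then zagierFn n m else 0, by simp⟩

theorem zagierBadFn_apply (n : ℤ) (d m : ℕ) : zagierBadFn n d m =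
    if m ∈ Nat.factoredNumbers (4 * d).primeFactors then zagierFn n m else 0 := rfl

theorem mul_mem_factoredNumbers_iff {s : Finset ℕ} {a b : ℕ} :
    a * b ∈ Nat.factoredNumbers s ↔ a ∈ Nat.factoredNumbers s ∧ b ∈ Nat.factoredNumbers s := by
  constructor
  · intro h
    exact ⟨Nat.mem_factoredNumbers_of_dvd h (Dvd.intro _ rfl),
      Nat.mem_factoredNumbers_of_dvd h (Dvd.intro_left _ rfl)⟩
  · rintro ⟨ha, hb⟩
    exact Nat.mul_mem_factoredNumbers ha hb

theorem isMultiplicative_zagierBadFn (n : ℤ) (d : ℕ) : (zagierBadFn n d).IsMultiplicative := by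
  refine ⟨?_, fun {a b} hab => ?_⟩
  · rw [zagierBadFn_apply, if_pos (by simp [Nat.mem_factoredNumbers]), (isMultiplicative_zagierFn n).1]
  · simp only [zagierBadFn_apply, mul_mem_factoredNumbers_iff]
    rw [(isMultiplicative_zagierFn n).2 hab]
    split_ifs <;> simp_all

theorem zagierBadFn_prime_pow (n : ℤ) {d : ℕ} (hd0 : d ≠ 0) {p : ℕ} (hp : p.Prime) {k : ℕ}
    (hk : k ≠ 0) : zagierBadFn n d (p ^ k) = if p ∣ 4 * d then zagierFn n (p ^ k) else 0 := by
  rw [zagierBadFn_apply]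
  congr 1
  rw [Nat.mem_factoredNumbers_iff_primeFactors_subset, Nat.primeFactors_prime_pow hk hp]
  simp [hp, hd0, hp.ne_zero]

/-- Both sides are multiplicative, so prime powers suffice. At p ∣ 4d the character vanishes and the
bad part supplies the whole coefficient; at other p the bad part is trivial and the coefficient is
the character. -/
theorem zagierFn_eq_jacobiFn_mul (n : ℤ) {d : ℕ} (hd0 : d ≠ 0) (hd : (d : ℤ) = n ^ 2 - 4) :
    zagierFn n = jacobiFn (d : ℤ) * zagierBadFn n d := by
  rw [(isMultiplicative_zagierFn n).eq_iff_eq_on_prime_powers _ _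
    ((isMultiplicative_jacobiFn _).mul (isMultiplicative_zagierBadFn n d))]
  intro p k hp
  rw [mul_apply_prime_pow _ _ hp]
  by_cases hpd : p ∣ 4 * d
  · have hchi : ∀ i, i ≠ 0 → jacobiFn (d : ℤ) (p ^ i) = 0 := by
      intro i hi
      rw [jacobiFn_apply]
      unfold jacobiChar
      split_ifs with h
      · rw [jacobiSym.eq_zero_iff]
        refine ⟨(pow_pos hp.pos i).ne', fun h1 => ?_⟩
        have h2 : Odd (p ^ i) := Nat.odd_iff.mpr h
        have h3 : p ∣ d := by
          rcases hp.dvd_mul.mp hpd with h4 | h4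
          · exfalso
            have h5 : p ∣ 2 := hp.dvd_of_dvd_pow (show p ∣ 2 ^ 2 from h4)
            rw [(Nat.prime_dvd_prime_iff_eq hp Nat.prime_two).mp h5] at h2
            exact (Nat.not_even_iff_odd.mpr h2) ((Nat.even_pow.mpr ⟨even_two, hi⟩))
          · exact h4
        rw [Int.gcd_natCast_natCast] at h1
        exact hp.one_lt.ne' (Nat.eq_one_of_dvd_one (h1 ▸ Nat.dvd_gcd h3 (dvd_pow_self p hi)))
      · rfl
    rw [Finset.sum_range_succ', Finset.sum_eq_zero fun i _ => by
      rw [hchi _ (Nat.succ_ne_zero i), zero_mul], zero_add, pow_zero, Nat.sub_zero,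
      (isMultiplicative_jacobiFn _).1, one_mul]
    rcases eq_or_ne k 0 with rfl | hk
    · simp [(isMultiplicative_zagierFn n).1, (isMultiplicative_zagierBadFn n d).1]
    · rw [zagierBadFn_prime_pow n hd0 hp hk, if_pos hpd]
  · have hp2 : p ≠ 2 := by
      rintro rfl
      exact hpd (Dvd.intro (2 * d) (by ring))
    have hpd' : ¬ (p : ℤ) ∣ n ^ 2 - 4 := by
      rw [← hd, Int.natCast_dvd_natCast]
      exact fun h => hpd (h.mul_left 4)
    rw [Finset.sum_range_succ, Finset.sum_eq_zero fun i hi => by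
      rw [Finset.mem_range] at hi
      rw [zagierBadFn_prime_pow n hd0 hp (by omega), if_neg hpd, mul_zero], zero_add, Nat.sub_self,
      pow_zero, (isMultiplicative_zagierBadFn n d).1, mul_one, jacobiFn_apply, hd]
    exact zagierFn_prime_pow_eq_jacobiChar n hp hp2 hpd' k

theorem abs_zagierFn_prime_pow_le (n : ℤ) (hn : n ^ 2 - 4 ≠ 0) {p : ℕ} (hp : p.Prime) :
    ∃ C : ℝ, ∀ k : ℕ, |(zagierFn n (p ^ k) : ℝ)| ≤ C * (k + 1) := by
  have hfin : FiniteMultiplicity (p : ℤ) (n ^ 2 - 4) :=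
    Int.finiteMultiplicity_iff.mpr ⟨by simpa using hp.one_lt.ne', hn⟩
  obtain ⟨e, he⟩ := hfin
  refine ⟨(2 * p ^ e : ℕ), fun k => ?_⟩
  rw [zagierFn_prime_pow n hp]
  rw [Int.cast_sum]
  refine (Finset.abs_sum_le_sum_abs _ _).trans ((Finset.sum_le_card_nsmul _ _
    ((2 * p ^ e : ℕ) : ℝ) fun i _ => ?_).trans_eq ?_)
  · push_cast
    rw [abs_mul, abs_pow, abs_neg, abs_one, one_pow, one_mul, Nat.abs_cast]
    exact_mod_cast rootCount_prime_pow_le n hp he _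
  · simp
    ring

/-- A finite Euler product over p ∣ 4d. Each factor converges since the coefficients at p^k grow at
most linearly in k and are weighted by p^(-k). -/
theorem summable_abs_zagierBadFn_div (n : ℤ) (hn : n ^ 2 - 4 ≠ 0) (d : ℕ) :
    Summable fun m : ℕ => |(zagierBadFn n d m : ℝ)| / m := by
  have hmul := isMultiplicative_zagierBadFn n d
  set f : ℕ → ℝ := fun m => (zagierBadFn n d m : ℝ) / m with hf
  have hf1 : f 1 = 1 := by simp [hf, hmul.1]
  have hfmul : ∀ {a b : ℕ}, a.Coprime b → f (a * b) = f a * f b := by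
    intro a b hab
    simp only [hf]
    rw [hmul.2 hab]
    push_cast
    exact mul_div_mul_comm _ _ _ _
  have hsum : ∀ {p : ℕ}, p.Prime → Summable fun k : ℕ => ‖f (p ^ k)‖ := by
    intro p hp
    obtain ⟨C, hC⟩ := abs_zagierFn_prime_pow_le n hn hp
    have hC0 : 0 ≤ C := by simpa using (abs_nonneg _).trans (hC 0)
    have hp1 : (1 : ℝ) < p := by exact_mod_cast hp.one_lt
    have hr : ‖(p : ℝ)⁻¹‖ < 1 := by
      rw [norm_inv, Real.norm_natCast]
      exact inv_lt_one_of_one_lt₀ hp1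
    have hs := (((summable_pow_mul_geometric_of_norm_lt_one 1 hr).add
      (summable_geometric_of_norm_lt_one hr)).mul_left C)
    refine Summable.of_nonneg_of_le (fun k => norm_nonneg _) (fun k => ?_) hs
    have h1 : |(zagierBadFn n d (p ^ k) : ℝ)| ≤ C * (k + 1) := by
      rw [zagierBadFn_apply]
      split_ifs
      · exact hC k
      · simp; positivity
    simp only [hf]
    rw [norm_div, Real.norm_eq_abs, Real.norm_natCast, Nat.cast_pow, div_eq_mul_inv, ← inv_pow]
    calc _ ≤ C * (k + 1) * (p : ℝ)⁻¹ ^ k := by gcongr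
      _ = _ := by ring
  have h := (EulerProduct.summable_and_hasSum_factoredNumbers_prod_filter_prime_tsum
    hf1 hfmul hsum (4 * d).primeFactors).1
  have h' : Summable ((Nat.factoredNumbers (4 * d).primeFactors).indicator fun m => ‖f m‖) :=
    summable_subtype_iff_indicator.mp h
  refine h'.congr fun m => ?_
  rw [Set.indicator_apply]
  split_ifs with hm
  · simp [hf]
  · simp [zagierBadFn_apply, hm]

end PrimeGeodesic

/-! ### Mean values of convolutions with an oscillating character -/

namespace PrimeGeodesic

open ArithmeticFunction Filter Topology

/-- Abel summation. The induction controls the sum minus its boundary term, so that the bound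
telescopes to f k - f l; sums of c over an interval are at most 2B. -/
theorem abs_sum_Ico_mul_le {c f : ℕ → ℝ} {B : ℝ} (hB : ∀ N, |∑ q ∈ Finset.range N, c q| ≤ B)
    {k : ℕ} (hf : ∀ m, k ≤ m → f (m + 1) ≤ f m) (hf0 : ∀ m, 0 ≤ f m) {l : ℕ} (hkl : k ≤ l) :
    |∑ m ∈ Finset.Ico k l, c m * f m| ≤ 2 * B * f k := by
  have hT : ∀ j, k ≤ j → |∑ m ∈ Finset.Ico k j, c m| ≤ 2 * B := by
    intro j hj
    rw [Finset.sum_Ico_eq_sub _ hj, two_mul]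
    exact (abs_sub _ _).trans (add_le_add (hB j) (hB k))
  have key : ∀ l, k ≤ l → |∑ m ∈ Finset.Ico k l, c m * f m - (∑ m ∈ Finset.Ico k l, c m) * f l|
      ≤ 2 * B * (f k - f l) := by
    intro l hl
    induction l, hl using Nat.le_induction with
    | base => simp
    | succ l hl ih =>
      have h1 := hT (l + 1) (by omega)
      rw [Finset.sum_Ico_succ_top hl] at h1
      rw [Finset.sum_Ico_succ_top hl, Finset.sum_Ico_succ_top hl]
      have h2 : |(∑ m ∈ Finset.Ico k l, c m + c l) * (f l - f (l + 1))|
          ≤ 2 * B * (f l - f (l + 1)) := by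
        rw [abs_mul, abs_of_nonneg (sub_nonneg.mpr (hf l hl))]
        exact mul_le_mul_of_nonneg_right h1 (sub_nonneg.mpr (hf l hl))
      calc _ = |(∑ m ∈ Finset.Ico k l, c m * f m - (∑ m ∈ Finset.Ico k l, c m) * f l)
            + (∑ m ∈ Finset.Ico k l, c m + c l) * (f l - f (l + 1))| := by congr 1; ring
        _ ≤ _ := (abs_add_le _ _).trans (add_le_add ih h2)
        _ = _ := by ring
  have h1 := key l hkl
  have h2 : |(∑ m ∈ Finset.Ico k l, c m) * f l| ≤ 2 * B * f l := by
    rw [abs_mul, abs_of_nonneg (hf0 l)]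
    exact mul_le_mul_of_nonneg_right (hT l hkl) (hf0 l)
  calc _ = |(∑ m ∈ Finset.Ico k l, c m * f m - (∑ m ∈ Finset.Ico k l, c m) * f l)
        + (∑ m ∈ Finset.Ico k l, c m) * f l| := by congr 1; ring
    _ ≤ _ := (abs_add_le _ _).trans (add_le_add h1 h2)
    _ = _ := by ring

/-- Abel summation with weights 1/m. The rate 1/(k+1), not just convergence, is needed in the
hyperbola method, where the error is multiplied by N. -/
theorem exists_abs_sum_div_sub_le {c : ℕ → ℝ} {B : ℝ}
    (hB : ∀ N, |∑ q ∈ Finset.range N, c q| ≤ B) :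
    ∃ L : ℝ, ∀ k : ℕ, |∑ m ∈ Finset.Ico 1 (k + 1), c m / m - L| ≤ 2 * B / (k + 1) := by
  set E : ℕ → ℝ := fun k => ∑ m ∈ Finset.Ico 1 (k + 1), c m / m with hE
  have hB0 : 0 ≤ B := (abs_nonneg _).trans (hB 0)
  have hdiff : ∀ k l, k ≤ l → |E l - E k| ≤ 2 * B / (k + 1) := by
    intro k l hkl
    have h := abs_sum_Ico_mul_le hB (k := k + 1) (f := fun m => 1 / (m : ℝ))
      (fun m hm => one_div_le_one_div_of_le (by exact_mod_cast (by omega : 0 < m))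
        (by push_cast; linarith)) (fun m => by positivity) (Nat.succ_le_succ hkl)
    have h1 : E l - E k = ∑ m ∈ Finset.Ico (k + 1) (l + 1), c m * (1 / m) := by
      simp only [hE]
      rw [← Finset.sum_Ico_consecutive _ (by omega : 1 ≤ k + 1) (Nat.succ_le_succ hkl),
        add_sub_cancel_left]
      exact Finset.sum_congr rfl fun m _ => by ring
    rw [h1]
    refine h.trans_eq ?_
    push_cast
    ring
  have hlim : Tendsto (fun k : ℕ => 2 * B / ((k : ℝ) + 1)) atTop (𝓝 0) := by
    have := (tendsto_one_div_add_atTop_nhds_zero_nat (𝕜 := ℝ)).const_mul (2 * B)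
    rw [mul_zero] at this
    exact this.congr fun k => by ring
  have hC : CauchySeq E := by
    refine cauchySeq_of_le_tendsto_0' _ (fun k l hkl => ?_) hlim
    rw [dist_comm, Real.dist_eq]
    exact hdiff k l hkl
  obtain ⟨L, hL⟩ := cauchySeq_tendsto_of_complete hC
  refine ⟨L, fun k => ?_⟩
  have h1 : Tendsto (fun l => |E k - E l|) atTop (𝓝 |E k - L|) := (hL.const_sub (E k)).abs
  refine le_of_tendsto h1 ?_
  filter_upwards [eventually_ge_atTop k] with l hl
  rw [abs_sub_comm]
  exact hdiff k l hl

/-- The sum is the summatory function of 1 * c, split at √N. Below, replacing ⌊N/m⌋ by N/m costs at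
most 1 per term, and truncating L costs N·2B/(k+1). Above, ⌊N/m⌋ is nonincreasing and at most k + 1,
so Abel summation applies. -/
theorem abs_sum_mul_div_sub_le {c : ℕ → ℝ} {B : ℝ} (hc : ∀ q, |c q| ≤ 1)
    (hB : ∀ N, |∑ q ∈ Finset.range N, c q| ≤ B) {L : ℝ}
    (hL : ∀ k : ℕ, |∑ m ∈ Finset.Ico 1 (k + 1), c m / m - L| ≤ 2 * B / (k + 1)) (N : ℕ) :
    |∑ m ∈ Finset.Ico 1 (N + 1), c m * ((N / m : ℕ) : ℝ) - N * L|
      ≤ (4 * B + 1) * (Nat.sqrt N + 1) := by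
  have hB0 : 0 ≤ B := (abs_nonneg _).trans (hB 0)
  set k := Nat.sqrt N with hk
  have hkN : k ≤ N := Nat.sqrt_le_self N
  have hNk : N < (k + 1) * (k + 1) := Nat.lt_succ_sqrt N
  have hNk' : (N : ℝ) ≤ (k + 1) * (k + 1) := by exact_mod_cast hNk.le
  rw [← Finset.sum_Ico_consecutive _ (by omega : 1 ≤ k + 1) (Nat.succ_le_succ hkN)]
  have htail := abs_sum_Ico_mul_le hB (k := k + 1) (f := fun m => ((N / m : ℕ) : ℝ))
    (fun m hm => by exact_mod_cast Nat.div_le_div_left (Nat.le_succ m) (by omega))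
    (fun m => by positivity) (Nat.succ_le_succ hkN)
  have hf : ((N / (k + 1) : ℕ) : ℝ) ≤ k + 1 := by
    exact_mod_cast (Nat.div_lt_of_lt_mul hNk).le
  have hhead : |∑ m ∈ Finset.Ico 1 (k + 1), c m * ((N / m : ℕ) : ℝ)
      - N * ∑ m ∈ Finset.Ico 1 (k + 1), c m / m| ≤ k := by
    rw [Finset.mul_sum, ← Finset.sum_sub_distrib]
    refine (Finset.abs_sum_le_sum_abs _ _).trans ?_
    refine (Finset.sum_le_card_nsmul _ _ 1 fun m hm => ?_).trans_eq (by simp)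
    have hm0 : 0 < m := by rw [Finset.mem_Ico] at hm; omega
    have hm1 : (0 : ℝ) < m := by exact_mod_cast hm0
    rw [show c m * ((N / m : ℕ) : ℝ) - N * (c m / m) = c m * (((N / m : ℕ) : ℝ) - N / m) by ring,
      abs_mul]
    have h1 : ((N / m : ℕ) : ℝ) ≤ N / m := Nat.cast_div_le
    have h2 : (N : ℝ) / m < ((N / m : ℕ) : ℝ) + 1 := by
      rw [div_lt_iff₀ hm1]
      exact_mod_cast (by rw [mul_comm]; exact Nat.lt_mul_div_succ N hm0)
    have h3 : |((N / m : ℕ) : ℝ) - N / m| ≤ 1 := by rw [abs_le]; constructor <;> linarith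
    exact mul_le_one₀ (hc m) (abs_nonneg _) h3
  have hmid : |N * (∑ m ∈ Finset.Ico 1 (k + 1), c m / m - L)| ≤ 2 * B * (k + 1) := by
    rw [abs_mul, Nat.abs_cast]
    have hk1 : (0 : ℝ) < k + 1 := by positivity
    calc (N : ℝ) * _ ≤ ((k + 1) * (k + 1)) * (2 * B / (k + 1)) :=
          mul_le_mul hNk' (hL k) (abs_nonneg _) (by positivity)
      _ = _ := by field_simp
  have htail' := htail.trans (mul_le_mul_of_nonneg_left hf (by positivity : 0 ≤ 2 * B))
  calc _ = |(∑ m ∈ Finset.Ico 1 (k + 1), c m * ((N / m : ℕ) : ℝ)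
        - N * ∑ m ∈ Finset.Ico 1 (k + 1), c m / m)
        + N * (∑ m ∈ Finset.Ico 1 (k + 1), c m / m - L)
        + ∑ m ∈ Finset.Ico (k + 1) (N + 1), c m * ((N / m : ℕ) : ℝ)| := by congr 1; ring
    _ ≤ k + 2 * B * (k + 1) + 2 * B * (k + 1) :=
        (abs_add_three _ _ _).trans (add_le_add (add_le_add hhead hmid) htail')
    _ ≤ _ := by linarith

theorem tendsto_natSqrt_add_one_div : Tendsto (fun N : ℕ => ((Nat.sqrt N : ℝ) + 1) / N) atTop (𝓝 0) := by
  have h1 : Tendsto (fun N : ℕ => 2 / Real.sqrt N) atTop (𝓝 0) :=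
    (tendsto_const_nhds (x := (2 : ℝ))).div_atTop
      (Real.tendsto_sqrt_atTop.comp tendsto_natCast_atTop_atTop)
  refine squeeze_zero' (Eventually.of_forall fun N => by positivity) ?_ h1
  filter_upwards [eventually_ge_atTop 1] with N hN
  have hN' : (1 : ℝ) ≤ N := by exact_mod_cast hN
  have h2 : (1 : ℝ) ≤ Real.sqrt N := Real.one_le_sqrt.mpr hN'
  have h3 : (Nat.sqrt N : ℝ) ≤ Real.sqrt N := Real.nat_sqrt_le_real_sqrt
  have h4 : Real.sqrt N * Real.sqrt N = N := Real.mul_self_sqrt (by positivity)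
  rw [div_le_div_iff₀ (by positivity) (by positivity)]
  nlinarith

theorem Ioc_zero_eq_Ico (N : ℕ) : Finset.Ioc 0 N = Finset.Ico 1 (N + 1) := by
  ext; simp; omega

/-- Tannery's theorem for the Dirichlet hyperbola sums of a convolution. -/
theorem tendsto_sum_Ioc_mul_natDiv {b : ℕ → ℝ} {w : ℕ → ℕ → ℝ} {C L : ℝ}
    (hb : Summable fun m => |b m|) (hb0 : b 0 = 0) (hw : ∀ N m, |w N m| ≤ C)
    (hw0 : ∀ N m, N < m → w N m = 0)
    (hlim : ∀ m, m ≠ 0 → Tendsto (fun N => w N m) atTop (𝓝 L)) :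
    Tendsto (fun N => ∑ m ∈ Finset.Ioc 0 N, b m * w N m) atTop (𝓝 ((∑' m, b m) * L)) := by
  rw [← tsum_mul_right]
  have h := tendsto_tsum_of_dominated_convergence (𝓕 := atTop) (f := fun N m => b m * w N m)
    (g := fun m => b m * L) (bound := fun m => |b m| * C) (hb.mul_right C) ?_ ?_
  · refine h.congr fun N => ?_
    refine tsum_eq_sum fun m hm => ?_
    rw [Finset.mem_Ioc, not_and_or, not_lt, not_le] at hm
    rcases hm with hm | hm
    · rw [Nat.le_zero.mp hm, hb0, zero_mul]
    · rw [hw0 N m hm, mul_zero]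
  · intro m
    rcases eq_or_ne m 0 with rfl | hm
    · simp [hb0]
    · exact (hlim m hm).const_mul _
  · refine Eventually.of_forall fun N m => ?_
    rw [Real.norm_eq_abs, abs_mul]
    exact mul_le_mul_of_nonneg_left (hw N m) (abs_nonneg _)

theorem tendsto_natDiv_mul_div {m : ℕ} (hm : m ≠ 0) :
    Tendsto (fun N : ℕ => ((N / m : ℕ) : ℝ) * m / N) atTop (𝓝 1) := by
  have hm0 : 0 < m := Nat.pos_of_ne_zero hm
  have h1 : Tendsto (fun N : ℕ => 1 - (m : ℝ) / N) atTop (𝓝 1) := by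
    have := (tendsto_const_nhds (x := (m : ℝ))).div_atTop (tendsto_natCast_atTop_atTop (R := ℝ))
    simpa using this.const_sub 1
  refine tendsto_of_tendsto_of_tendsto_of_le_of_le' h1 tendsto_const_nhds ?_ ?_
  · filter_upwards [eventually_ge_atTop 1] with N hN
    have hN' : (0 : ℝ) < N := by exact_mod_cast hN
    rw [one_sub_div hN'.ne']
    refine div_le_div_of_nonneg_right ?_ hN'.le
    have : (N : ℝ) < m * (((N / m : ℕ) : ℝ) + 1) := by exact_mod_cast Nat.lt_mul_div_succ N hm0
    linarith
  · filter_upwards [eventually_ge_atTop 1] with N hN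
    have hN' : (0 : ℝ) < N := by exact_mod_cast hN
    rw [div_le_one hN']
    exact_mod_cast Nat.div_mul_le_self N m

/-- Summing over the variable m of a first, both expressions become Σ (a(m)/m)·w(N, m) with w
bounded and w(N, m) → L = Σ c(q)/q for each fixed m. Hence both tend to (Σ a(m)/m)·L. -/
theorem exists_tendsto_of_convolution {c a : ArithmeticFunction ℝ} {B : ℝ} (hc : ∀ q, |c q| ≤ 1)
    (hB : ∀ N, |∑ q ∈ Finset.range N, c q| ≤ B) (ha : Summable fun m : ℕ => |a m| / m) :
    ∃ L : ℝ, Tendsto (fun N => ∑ q ∈ Finset.Ioc 0 N, (c * a) q / q) atTop (𝓝 L) ∧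
      Tendsto (fun N : ℕ => (∑ q ∈ Finset.Ioc 0 N, ((ArithmeticFunction.zeta : ArithmeticFunction ℝ) * (c * a)) q) / N)
        atTop (𝓝 L) := by
  obtain ⟨L, hL⟩ := exists_abs_sum_div_sub_le hB
  have hB0 : 0 ≤ B := (abs_nonneg _).trans (hB 0)
  set b : ℕ → ℝ := fun m => a m / m with hb
  have hbs : Summable fun m => |b m| := ha.congr fun m => by simp [hb, abs_div]
  set E : ℕ → ℝ := fun N => ∑ m ∈ Finset.Ioc 0 N, c m / m with hE
  set G : ℕ → ℝ := fun N => ∑ m ∈ Finset.Ioc 0 N, ((ArithmeticFunction.zeta : ArithmeticFunction ℝ) * c) m with hG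
  have hlimB : Tendsto (fun k : ℕ => 2 * B / ((k : ℝ) + 1)) atTop (𝓝 0) := by
    have := (tendsto_one_div_add_atTop_nhds_zero_nat (𝕜 := ℝ)).const_mul (2 * B)
    rw [mul_zero] at this
    exact this.congr fun k => by ring
  have hElim : Tendsto E atTop (𝓝 L) := by
    rw [tendsto_iff_norm_sub_tendsto_zero]
    refine squeeze_zero (fun _ => norm_nonneg _) (fun N => ?_) hlimB
    simp only [hE, Ioc_zero_eq_Ico]
    exact hL N
  have hGeq : ∀ N, G N = ∑ m ∈ Finset.Ico 1 (N + 1), c m * ((N / m : ℕ) : ℝ) := by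
    intro N
    simp only [hG]
    rw [mul_comm, sum_Ioc_mul_zeta_eq_sum, Ioc_zero_eq_Ico]
  have hGdist : ∀ N : ℕ, |G N - N * L| ≤ (4 * B + 1) * (Nat.sqrt N + 1) := by
    intro N
    rw [hGeq]
    exact abs_sum_mul_div_sub_le hc hB hL N
  have hGlim : Tendsto (fun N : ℕ => G N / N) atTop (𝓝 L) := by
    rw [tendsto_iff_norm_sub_tendsto_zero]
    have h1 := tendsto_natSqrt_add_one_div.const_mul (4 * B + 1)
    rw [mul_zero] at h1
    refine squeeze_zero' (Eventually.of_forall fun _ => norm_nonneg _) ?_ h1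
    filter_upwards [eventually_ge_atTop 1] with N hN
    have hN' : (0 : ℝ) < N := by exact_mod_cast hN
    rw [Real.norm_eq_abs, show G N / N - L = (G N - N * L) / N by field_simp, abs_div,
      abs_of_pos hN', ← mul_div_assoc]
    exact div_le_div_of_nonneg_right (hGdist N) hN'.le
  obtain ⟨C₁, hC₁⟩ := (Metric.isBounded_range_of_tendsto E hElim).exists_norm_le
  obtain ⟨C₂, hC₂⟩ := (Metric.isBounded_range_of_tendsto _ hGlim).exists_norm_le
  have hC₂0 : 0 ≤ C₂ := (norm_nonneg _).trans (hC₂ _ ⟨0, rfl⟩)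
  refine ⟨(∑' m, b m) * L, ?_, ?_⟩
  · have h := tendsto_sum_Ioc_mul_natDiv (w := fun N m => E (N / m)) hbs (by simp [hb])
      (fun N m => hC₁ _ ⟨N / m, rfl⟩)
      (fun N m h => by simp [hE, Nat.div_eq_of_lt h])
      (fun m hm => hElim.comp (Nat.tendsto_div_const_atTop hm))
    refine h.congr fun N => ?_
    set a' : ArithmeticFunction ℝ := ⟨fun m => a m / m, by simp⟩ with ha'
    set c' : ArithmeticFunction ℝ := ⟨fun m => c m / m, by simp⟩ with hc'
    have hca : ∀ q : ℕ, (c * a) q / q = (a' * c') q := by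
      intro q
      rw [mul_comm c a, mul_apply, mul_apply, Finset.sum_div]
      refine Finset.sum_congr rfl fun x hx => ?_
      rw [Nat.mem_divisorsAntidiagonal] at hx
      rw [← hx.1]
      push_cast
      exact mul_div_mul_comm _ _ _ _
    simp only [hca]
    rw [sum_Ioc_mul_eq_sum_sum]
    rfl
  · have h := tendsto_sum_Ioc_mul_natDiv
      -- The natural weight G(⌊N/m⌋)·m/N is split into a bounded factor tending to L and a factor in
      -- [0, 1] tending to 1.
      (w := fun N m => G (N / m) / ((N / m : ℕ) : ℝ) * (((N / m : ℕ) : ℝ) * m / N)) (C := C₂)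
      (L := L) hbs (by simp [hb]) (fun N m => ?_)
      (fun N m h => by simp [hG, Nat.div_eq_of_lt h]) (fun m hm => ?_)
    · refine h.congr fun N => ?_
      rw [mul_comm c a, ← mul_assoc, mul_comm _ a, mul_assoc, sum_Ioc_mul_eq_sum_sum,
        Finset.sum_div]
      refine Finset.sum_congr rfl fun m hm => ?_
      rw [Finset.mem_Ioc] at hm
      have hm0 : (m : ℝ) ≠ 0 := by exact_mod_cast (by omega : m ≠ 0)
      have hN0 : (N : ℝ) ≠ 0 := by exact_mod_cast (by omega : N ≠ 0)
      have hd0 : ((N / m : ℕ) : ℝ) ≠ 0 := by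
        exact_mod_cast (Nat.div_pos hm.2 hm.1).ne'
      simp only [hb, hG]
      field_simp
    · have h1 : ((N / m : ℕ) : ℝ) * m / N ≤ 1 := by
        rcases Nat.eq_zero_or_pos N with rfl | hN
        · simp
        · rw [div_le_one (by exact_mod_cast hN)]
          exact_mod_cast Nat.div_mul_le_self N m
      rw [abs_mul, abs_of_nonneg (by positivity : 0 ≤ ((N / m : ℕ) : ℝ) * m / N)]
      exact (mul_le_of_le_one_right (abs_nonneg _) h1).trans (hC₂ _ ⟨N / m, rfl⟩)
    · simpa using (hGlim.comp (Nat.tendsto_div_const_atTop hm)).mul (tendsto_natDiv_mul_div hm)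

/-- The series `L(1, n ^ 2 - 4)` converges, and its value is the density of the coefficients of
`ζ(2s) ∑ ρ_q(n ^ 2 - 4) q ^ (-s)`. -/
theorem exists_tendsto_zagierFn (n : ℤ) {d : ℕ} (hd : (d : ℤ) = n ^ 2 - 4) (hsq : ¬ IsSquare d) :
    ∃ L : ℝ, Tendsto (fun N => ∑ q ∈ Finset.Ioc 0 N, (zagierFn n q : ℝ) / q) atTop (𝓝 L) ∧
      Tendsto (fun N : ℕ => ((∑ q ∈ Finset.Ioc 0 N, (squareIndicator * rootFn n) q : ℤ) : ℝ) / N)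
        atTop (𝓝 L) := by
  have hd0 : d ≠ 0 := by rintro rfl; exact hsq ⟨0, rfl⟩
  have hn : n ^ 2 - 4 ≠ 0 := by rw [← hd]; exact_mod_cast hd0
  obtain ⟨B, hB⟩ := exists_abs_sum_jacobiChar_le hsq hd0
  obtain ⟨L, h1, h2⟩ := exists_tendsto_of_convolution
    (c := (jacobiFn d : ArithmeticFunction ℝ)) (a := (zagierBadFn n d : ArithmeticFunction ℝ))
    (fun q => by
      rw [intCoe_apply, jacobiFn_apply]
      exact_mod_cast abs_jacobiChar_le d q) hB (summable_abs_zagierBadFn_div n hn d)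
  have hconv : (jacobiFn d : ArithmeticFunction ℝ) * (zagierBadFn n d : ArithmeticFunction ℝ)
      = (zagierFn n : ArithmeticFunction ℝ) := by
    rw [zagierFn_eq_jacobiFn_mul n hd0 hd, intCoe_mul]
  have hzeta : (ArithmeticFunction.zeta : ArithmeticFunction ℝ)
      * (zagierFn n : ArithmeticFunction ℝ)
      = ((squareIndicator * rootFn n : ArithmeticFunction ℤ) : ArithmeticFunction ℝ) := by
    -- Convolving with ζ cancels the μ in `zagierFn`; what is left is exactly the function that
    -- counts root triples.
    have h : (ArithmeticFunction.zeta : ArithmeticFunction ℤ) * zagierFn n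
        = squareIndicator * rootFn n := by
      rw [zagierFn, mul_comm squareIndicator, mul_assoc, ← mul_assoc, coe_zeta_mul_moebius, one_mul]
    rw [← h, intCoe_mul]
    congr 1
  rw [hconv] at h1 h2
  rw [hzeta] at h2
  refine ⟨L, h1, h2.congr fun N => ?_⟩
  simp only [intCoe_apply, Int.cast_sum]

theorem hasSum_zagierTerm (n : ℤ) {L : ℝ}
    (hL : Tendsto (fun N => ∑ q ∈ Finset.Ioc 0 N, (zagierFn n q : ℝ) / q) atTop (𝓝 L)) :
    HasSum (zagierTerm 1 (n ^ 2 - 4)) (L : ℂ) (SummationFilter.conditional ℕ) := by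
  rw [HasSum, SummationFilter.conditional_filter_eq_map_range, tendsto_map'_iff,
    ← tendsto_add_atTop_iff_nat 1]
  refine ((Complex.continuous_ofReal.tendsto L).comp hL).congr fun N => ?_
  simp only [Function.comp_apply, Finset.sum_range_eq_add_Ico _ (Nat.succ_pos N), Ioc_zero_eq_Ico]
  rw [zagierTerm, LSeries.term_zero, zero_add]
  push_cast
  refine Finset.sum_congr rfl fun q hq => ?_
  have hq0 : q ≠ 0 := by rw [Finset.mem_Ico] at hq; omega
  rw [zagierTerm, LSeries.term_of_ne_zero hq0, Complex.cpow_one, lam_eq_zagierFn n hq0]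

end PrimeGeodesic

/-! ### The centralizer of a hyperbolic matrix -/

namespace PrimeGeodesic

section Eigenvalue

variable (A : SL(2, ℤ))

theorem det_entries : A.1 0 0 * A.1 1 1 - A.1 0 1 * A.1 1 0 = 1 := by
  rw [← Matrix.det_fin_two]; exact A.2

theorem trace_entries : A.1.trace = A.1 0 0 + A.1 1 1 := Matrix.trace_fin_two _

/-- The square root of the discriminant of the characteristic polynomial. -/
noncomputable def sqrtDisc : ℝ := Real.sqrt ((A.1.trace : ℝ) ^ 2 - 4)

/-- The linear form `v ↦ v 0 + κ v 1` which is an eigenvector of the transpose of `A`. -/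
noncomputable def expandForm (v : Fin 2 → ℝ) : ℝ :=
  v 0 + ((A.1 1 1 - A.1 0 0 : ℝ) + sqrtDisc A) / (2 * A.1 1 0) * v 1

/-- The linear form complementary to `expandForm`, normalized so that their product is
`quadForm`. -/
noncomputable def contractForm (v : Fin 2 → ℝ) : ℝ :=
  A.1 1 0 * v 0 + ((A.1 1 1 - A.1 0 0 : ℝ) - sqrtDisc A) / 2 * v 1

/-- The binary quadratic form `v ↦ det (v, A v)`. -/
def quadForm (v : Fin 2 → ℤ) : ℤ :=
  A.1 1 0 * v 0 ^ 2 + (A.1 1 1 - A.1 0 0) * (v 0 * v 1) - A.1 0 1 * v 1 ^ 2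

/-- The eigenvalue of `g` on `expandForm A`, when `g` commutes with `A`. -/
noncomputable def eigenvalue (g : SL(2, ℤ)) : ℝ :=
  g.1 0 0 + ((A.1 1 1 - A.1 0 0 : ℝ) + sqrtDisc A) / (2 * A.1 1 0) * g.1 1 0

end Eigenvalue

section Hyperbolic

variable {A : SL(2, ℤ)}

theorem lower_left_ne_zero (hA : 2 < A.1.trace) : A.1 1 0 ≠ 0 := by
  intro h
  have h1 := det_entries A
  rw [trace_entries] at hA
  rw [h, mul_zero, sub_zero] at h1
  rcases Int.eq_one_or_neg_one_of_mul_eq_one' h1 with ⟨h2, h3⟩ | ⟨h2, h3⟩ <;> omega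

/-- The number lies strictly between (n - 1)² and n². -/
theorem not_isSquare_sq_sub_four {n : ℤ} (hn : 2 < n) : ¬ IsSquare (n ^ 2 - 4) := by
  rintro ⟨m, hm⟩
  wlog hm0 : 0 ≤ m generalizing m
  · exact this (-m) (by rw [hm]; ring) (by omega)
  have h1 : m < n := by nlinarith
  have h2 : n - 1 < m := by nlinarith
  omega

theorem sqrtDisc_sq (hA : 2 < A.1.trace) : sqrtDisc A ^ 2 = (A.1.trace : ℝ) ^ 2 - 4 := by
  have h : (2 : ℝ) < A.1.trace := by exact_mod_cast hA
  exact Real.sq_sqrt (by nlinarith)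

theorem sqrtDisc_pos (hA : 2 < A.1.trace) : 0 < sqrtDisc A := by
  have h : (2 : ℝ) < A.1.trace := by exact_mod_cast hA
  exact Real.sqrt_pos.mpr (by nlinarith)

theorem eq_zero_of_add_mul_sqrtDisc (hA : 2 < A.1.trace) {x y : ℤ}
    (h : (x : ℝ) + y * sqrtDisc A = 0) : x = 0 ∧ y = 0 := by
  have hsq : x ^ 2 = y ^ 2 * (A.1.trace ^ 2 - 4) := by
    have h1 : (x : ℝ) ^ 2 = y ^ 2 * ((A.1.trace : ℝ) ^ 2 - 4) := by
      rw [← sqrtDisc_sq hA]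
      linear_combination ((x : ℝ) - y * sqrtDisc A) * h
    exact_mod_cast h1
  have hy : y = 0 := by
    by_contra hy
    apply not_isSquare_sq_sub_four hA
    have hdvd : y ∣ x := (Int.pow_dvd_pow_iff two_ne_zero).mp ⟨_, hsq⟩
    obtain ⟨z, rfl⟩ := hdvd
    refine ⟨z, mul_left_cancel₀ (pow_ne_zero 2 hy) ?_⟩
    rw [← hsq]
    ring
  subst hy
  simpa using hsq

theorem expandForm_mul_contractForm (hA : 2 < A.1.trace) (v : Fin 2 → ℤ) :
    expandForm A (fun i => v i) * contractForm A (fun i => v i) = quadForm A v := by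
  have hc : (A.1 1 0 : ℝ) ≠ 0 := by exact_mod_cast lower_left_ne_zero hA
  have hs := sqrtDisc_sq hA
  have hdet : (A.1 0 0 : ℝ) * A.1 1 1 - A.1 0 1 * A.1 1 0 = 1 := by exact_mod_cast det_entries A
  rw [trace_entries] at hs
  push_cast at hs
  unfold expandForm contractForm quadForm
  push_cast
  field_simp
  linear_combination (-(v 1 : ℝ) ^ 2) * hs - (4 * (v 1 : ℝ) ^ 2) * hdet

theorem commute_entries {g : SL(2, ℤ)} (hg : g * A = A * g) :
    g.1 0 1 * A.1 1 0 = A.1 0 1 * g.1 1 0 ∧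
      A.1 1 0 * (g.1 1 1 - g.1 0 0) = g.1 1 0 * (A.1 1 1 - A.1 0 0) := by
  have h00 := congrArg (fun M : SL(2, ℤ) => M.1 0 0) hg
  have h10 := congrArg (fun M : SL(2, ℤ) => M.1 1 0) hg
  simp only [Matrix.SpecialLinearGroup.coe_mul, Matrix.mul_apply, Fin.sum_univ_two] at h00 h10
  exact ⟨by linear_combination h00, by linear_combination h10⟩

/-- The coefficient row of the form is a left eigenvector of A. A commuting g has off-diagonal
entries and diagonal difference proportional to those of A (`commute_entries`), so it shares this
eigenvector. -/
theorem expandForm_mulVec (hA : 2 < A.1.trace) {g : SL(2, ℤ)} (hg : g * A = A * g)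
    (v : Fin 2 → ℤ) :
    expandForm A (fun i => (g.1.mulVec v) i) = eigenvalue A g * expandForm A (fun i => v i) := by
  have hc : (A.1 1 0 : ℝ) ≠ 0 := by exact_mod_cast lower_left_ne_zero hA
  have hs := sqrtDisc_sq hA
  have hdet : (A.1 0 0 : ℝ) * A.1 1 1 - A.1 0 1 * A.1 1 0 = 1 := by exact_mod_cast det_entries A
  obtain ⟨h1, h2⟩ := commute_entries hg
  have h1' : (g.1 0 1 : ℝ) * A.1 1 0 = A.1 0 1 * g.1 1 0 := by exact_mod_cast h1
  have h2' : (A.1 1 0 : ℝ) * (g.1 1 1 - g.1 0 0) = g.1 1 0 * (A.1 1 1 - A.1 0 0) := by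
    exact_mod_cast h2
  rw [trace_entries] at hs
  push_cast at hs
  unfold expandForm eigenvalue
  simp only [Matrix.mulVec, dotProduct, Fin.sum_univ_two]
  push_cast
  field_simp
  linear_combination (4 * (v 1 : ℝ) * A.1 1 0) * h1'
    + (2 * (v 1 : ℝ) * (A.1 1 1 - A.1 0 0 + sqrtDisc A)) * h2'
    - ((v 1 : ℝ) * g.1 1 0) * hs - (4 * (v 1 : ℝ) * g.1 1 0) * hdet

/-- `eigenvalue A h` is the value of `expandForm A` on the first column of h, so only g has to
commute with A. -/
theorem eigenvalue_mul (hA : 2 < A.1.trace) {g : SL(2, ℤ)} (hg : g * A = A * g) (h : SL(2, ℤ)) :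
    eigenvalue A (g * h) = eigenvalue A g * eigenvalue A h := by
  have := expandForm_mulVec hA hg (fun i => h.1 i 0)
  simp only [expandForm, Matrix.mulVec, dotProduct, Fin.sum_univ_two] at this
  simp only [eigenvalue, Matrix.SpecialLinearGroup.coe_mul, Matrix.mul_apply,
    Fin.sum_univ_two] at this ⊢
  exact this

theorem eigenvalue_one : eigenvalue A 1 = 1 := by simp [eigenvalue]

theorem eigenvalue_neg (g : SL(2, ℤ)) : eigenvalue A (-g) = -eigenvalue A g := by
  simp [eigenvalue]
  ring

theorem eigenvalue_self (hA : 2 < A.1.trace) : 1 < eigenvalue A A := by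
  have hc : (A.1 1 0 : ℝ) ≠ 0 := by exact_mod_cast lower_left_ne_zero hA
  have h : eigenvalue A A = (A.1.trace + sqrtDisc A) / 2 := by
    rw [trace_entries]
    unfold eigenvalue
    push_cast
    field_simp
    ring
  have h1 := sqrtDisc_pos hA
  have h2 : (2 : ℝ) < A.1.trace := by exact_mod_cast hA
  rw [h]
  linarith

/-- As √D is irrational, the eigenvalue determines both entries of the first column; the commutation
relations then give the second, since the lower left entry of A is nonzero. -/
theorem eigenvalue_injective (hA : 2 < A.1.trace) {g h : SL(2, ℤ)} (hg : g * A = A * g)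
    (hh : h * A = A * h) (he : eigenvalue A g = eigenvalue A h) : g = h := by
  have hc := lower_left_ne_zero hA
  have hc' : (A.1 1 0 : ℝ) ≠ 0 := by exact_mod_cast hc
  have key : ((2 * A.1 1 0 * (g.1 0 0 - h.1 0 0) + (g.1 1 0 - h.1 1 0) * (A.1 1 1 - A.1 0 0) : ℤ) : ℝ)
      + ((g.1 1 0 - h.1 1 0 : ℤ) : ℝ) * sqrtDisc A = 0 := by
    unfold eigenvalue at he
    field_simp at he
    push_cast
    linear_combination he
  obtain ⟨h1, h2⟩ := eq_zero_of_add_mul_sqrtDisc hA key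
  rw [h2, zero_mul, add_zero] at h1
  have h10 : g.1 1 0 = h.1 1 0 := by omega
  have h00 : g.1 0 0 = h.1 0 0 := by
    have := (mul_eq_zero.mp h1).resolve_left (mul_ne_zero two_ne_zero hc)
    omega
  obtain ⟨g1, g2⟩ := commute_entries hg
  obtain ⟨h1, h2⟩ := commute_entries hh
  have h01 : g.1 0 1 = h.1 0 1 := mul_right_cancel₀ hc (by rw [g1, h1, h10])
  have h11 : g.1 1 1 = h.1 1 1 := by
    have := mul_left_cancel₀ hc ((g2.trans (by rw [h10])).trans h2.symm)
    omega
  ext i j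
  fin_cases i <;> fin_cases j <;> assumption

theorem commute_inv {g : SL(2, ℤ)} (hg : g * A = A * g) : g⁻¹ * A = A * g⁻¹ :=
  ((show Commute g A from hg).inv_left)

theorem commute_zpow {g : SL(2, ℤ)} (hg : g * A = A * g) (k : ℤ) : g ^ k * A = A * g ^ k :=
  ((show Commute g A from hg).zpow_left k)

theorem commute_neg {g : SL(2, ℤ)} (hg : g * A = A * g) : -g * A = A * -g := by
  rw [neg_mul, mul_neg, hg]

theorem eigenvalue_mul_inv (hA : 2 < A.1.trace) {g : SL(2, ℤ)} (hg : g * A = A * g) :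
    eigenvalue A g * eigenvalue A g⁻¹ = 1 := by
  rw [← eigenvalue_mul hA hg, mul_inv_cancel, eigenvalue_one]

theorem eigenvalue_ne_zero (hA : 2 < A.1.trace) {g : SL(2, ℤ)} (hg : g * A = A * g) :
    eigenvalue A g ≠ 0 := left_ne_zero_of_mul_eq_one (eigenvalue_mul_inv hA hg)

theorem eigenvalue_inv (hA : 2 < A.1.trace) {g : SL(2, ℤ)} (hg : g * A = A * g) :
    eigenvalue A g⁻¹ = (eigenvalue A g)⁻¹ := eq_inv_of_mul_eq_one_right (eigenvalue_mul_inv hA hg)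

theorem eigenvalue_pow (hA : 2 < A.1.trace) {g : SL(2, ℤ)} (hg : g * A = A * g) (k : ℕ) :
    eigenvalue A (g ^ k) = eigenvalue A g ^ k := by
  induction k with
  | zero => simp [eigenvalue_one]
  | succ k ih => rw [pow_succ', eigenvalue_mul hA hg, ih, pow_succ']

theorem eigenvalue_zpow (hA : 2 < A.1.trace) {g : SL(2, ℤ)} (hg : g * A = A * g) (k : ℤ) :
    eigenvalue A (g ^ k) = eigenvalue A g ^ k := by
  obtain ⟨m, rfl | rfl⟩ := k.eq_nat_or_neg
  · rw [zpow_natCast, zpow_natCast, eigenvalue_pow hA hg]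
  · rw [zpow_neg, zpow_neg, zpow_natCast, zpow_natCast, eigenvalue_inv hA, eigenvalue_pow hA hg]
    exact_mod_cast commute_zpow hg m

theorem trace_eq_eigenvalue_add_inv (hA : 2 < A.1.trace) {g : SL(2, ℤ)} (hg : g * A = A * g) :
    (g.1.trace : ℝ) = eigenvalue A g + (eigenvalue A g)⁻¹ := by
  have hc : (A.1 1 0 : ℝ) ≠ 0 := by exact_mod_cast lower_left_ne_zero hA
  obtain ⟨-, h2⟩ := commute_entries hg
  have h2' : (A.1 1 0 : ℝ) * (g.1 1 1 - g.1 0 0) = g.1 1 0 * (A.1 1 1 - A.1 0 0) := by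
    exact_mod_cast h2
  rw [← eigenvalue_inv hA hg, trace_entries]
  unfold eigenvalue
  rw [Matrix.SpecialLinearGroup.SL2_inv_expl]
  simp
  field_simp
  ring

theorem contractForm_mulVec (hA : 2 < A.1.trace) {g : SL(2, ℤ)} (hg : g * A = A * g)
    (v : Fin 2 → ℤ) : contractForm A (fun i => (g.1.mulVec v) i)
      = (eigenvalue A g)⁻¹ * contractForm A (fun i => v i) := by
  have hc : (A.1 1 0 : ℝ) ≠ 0 := by exact_mod_cast lower_left_ne_zero hA
  have hs := sqrtDisc_sq hA
  have hdet : (A.1 0 0 : ℝ) * A.1 1 1 - A.1 0 1 * A.1 1 0 = 1 := by exact_mod_cast det_entries A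
  obtain ⟨h1, h2⟩ := commute_entries hg
  have h1' : (g.1 0 1 : ℝ) * A.1 1 0 = A.1 0 1 * g.1 1 0 := by exact_mod_cast h1
  have h2' : (A.1 1 0 : ℝ) * (g.1 1 1 - g.1 0 0) = g.1 1 0 * (A.1 1 1 - A.1 0 0) := by
    exact_mod_cast h2
  have h3 := trace_eq_eigenvalue_add_inv hA hg
  rw [show (eigenvalue A g)⁻¹ = g.1.trace - eigenvalue A g by rw [h3]; ring, trace_entries]
  rw [trace_entries] at hs
  push_cast at hs
  unfold contractForm eigenvalue
  simp only [Matrix.mulVec, dotProduct, Fin.sum_univ_two]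
  push_cast
  field_simp
  linear_combination (4 * (v 1 : ℝ) * A.1 1 0) * h1' - (4 * (v 0 : ℝ) * A.1 1 0) * h2'
    - ((v 1 : ℝ) * g.1 1 0) * hs - (4 * (v 1 : ℝ) * g.1 1 0) * hdet

/-- Discreteness. The difference of the eigenvalue and its inverse is a fixed multiple of the lower
left entry of g, which is therefore bounded; then so is the upper left entry, and the first column
determines g. -/
theorem finite_eigenvalue_le (hA : 2 < A.1.trace) (T : ℝ) :
    {g : SL(2, ℤ) | g * A = A * g ∧ 1 ≤ eigenvalue A g ∧ eigenvalue A g ≤ T}.Finite := by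
  have hc := lower_left_ne_zero hA
  have hc' : (A.1 1 0 : ℝ) ≠ 0 := by exact_mod_cast hc
  have hs := sqrtDisc_pos hA
  set κ : ℝ := ((A.1 1 1 - A.1 0 0 : ℝ) + sqrtDisc A) / (2 * A.1 1 0) with hκ
  set R : ℝ := |(A.1 1 0 : ℝ)| * T / sqrtDisc A with hR
  have hfin : ∀ b : ℝ, {z : ℤ | |(z : ℝ)| ≤ b}.Finite := by
    intro b
    refine (Set.finite_Icc (-⌊b⌋) ⌊b⌋).subset fun z hz => ?_
    have h1 : |z| ≤ ⌊b⌋ := by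
      rw [Int.le_floor]
      exact_mod_cast hz
    exact abs_le.mp h1
  refine Set.Finite.of_finite_image (f := fun g : SL(2, ℤ) => (g.1 0 0, g.1 1 0))
    (((hfin (T + |κ| * R)).prod (hfin R)).subset ?_) ?_
  · rintro _ ⟨g, ⟨hg, h1, hT⟩, rfl⟩
    have htr := trace_eq_eigenvalue_add_inv hA hg
    obtain ⟨-, h2⟩ := commute_entries hg
    have h2' : (A.1 1 0 : ℝ) * (g.1 1 1 - g.1 0 0) = g.1 1 0 * (A.1 1 1 - A.1 0 0) := by
      exact_mod_cast h2
    have hinv1 : (eigenvalue A g)⁻¹ ≤ 1 := inv_le_one_of_one_le₀ h1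
    have hinv0 : 0 < (eigenvalue A g)⁻¹ := inv_pos.mpr (by linarith)
    have hdiff : (g.1 1 0 : ℝ) * sqrtDisc A
        = A.1 1 0 * (eigenvalue A g - (eigenvalue A g)⁻¹) := by
      rw [show (eigenvalue A g)⁻¹ = g.1.trace - eigenvalue A g by rw [htr]; ring, trace_entries]
      unfold eigenvalue
      push_cast
      field_simp
      linear_combination 2 * h2'
    have hr : |(g.1 1 0 : ℝ)| ≤ R := by
      rw [hR, le_div_iff₀ hs]
      calc |(g.1 1 0 : ℝ)| * sqrtDisc A = |(g.1 1 0 : ℝ) * sqrtDisc A| := by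
            rw [abs_mul, abs_of_pos hs]
        _ = |(A.1 1 0 : ℝ)| * |eigenvalue A g - (eigenvalue A g)⁻¹| := by rw [hdiff, abs_mul]
        _ ≤ _ := by
          refine mul_le_mul_of_nonneg_left ?_ (abs_nonneg _)
          rw [abs_le]
          constructor <;> linarith
    refine ⟨?_, hr⟩
    have hp : (g.1 0 0 : ℝ) = eigenvalue A g - κ * g.1 1 0 := by
      rw [hκ, eigenvalue]; ring
    change |(g.1 0 0 : ℝ)| ≤ T + |κ| * R
    rw [hp]
    refine (abs_sub _ _).trans (add_le_add ?_ ?_)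
    · rw [abs_le]; constructor <;> linarith
    · rw [abs_mul]
      exact mul_le_mul_of_nonneg_left hr (abs_nonneg _)
  · rintro g ⟨hg, -⟩ h ⟨hh, -⟩ he
    rw [Prod.mk.injEq] at he
    refine eigenvalue_injective hA hg hh ?_
    rw [eigenvalue, eigenvalue, he.1, he.2]

/-- `B` generates the centralizer of `A` up to sign. -/
def IsCentralizerGenerator (A B : SL(2, ℤ)) : Prop :=
  B * A = A * B ∧ 1 < eigenvalue A B ∧ ∀ g : SL(2, ℤ), g * A = A * g → ∃ k : ℤ, g = B ^ k ∨ g = -B ^ k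

/-- Take B with the least eigenvalue above 1; A itself shows that candidates exist. Dividing a
commuting g of positive eigenvalue by a power of B puts its eigenvalue in [1, eigenvalue of B), so
it is 1 by minimality. For a negative eigenvalue, use -g. -/
theorem exists_isCentralizerGenerator (hA : 2 < A.1.trace) : ∃ B, IsCentralizerGenerator A B := by
  set S := {g : SL(2, ℤ) | g * A = A * g ∧ 1 < eigenvalue A g ∧ eigenvalue A g ≤ eigenvalue A A}
  have hSf : S.Finite := (finite_eigenvalue_le hA (eigenvalue A A)).subset
    fun g hg => ⟨hg.1, hg.2.1.le, hg.2.2⟩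
  have hSn : S.Nonempty := ⟨A, rfl, eigenvalue_self hA, le_rfl⟩
  obtain ⟨B, ⟨hB, hB1, hBA⟩, hmin⟩ := Set.exists_min_image S (eigenvalue A) hSf hSn
  have hpos : ∀ g : SL(2, ℤ), g * A = A * g → 0 < eigenvalue A g → ∃ k : ℤ, g = B ^ k := by
    intro g hg hg0
    obtain ⟨k, hk1, hk2⟩ := exists_mem_Ico_zpow hg0 hB1
    refine ⟨k, ?_⟩
    have hBk := commute_zpow hB k
    have hk0 : 0 < eigenvalue A B ^ k := zpow_pos (by linarith) k
    have hgB : g * (B ^ k)⁻¹ * A = A * (g * (B ^ k)⁻¹) := by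
      rw [mul_assoc, commute_inv hBk, ← mul_assoc, hg, mul_assoc]
    have he : eigenvalue A (g * (B ^ k)⁻¹) = eigenvalue A g * (eigenvalue A B ^ k)⁻¹ := by
      rw [eigenvalue_mul hA hg, eigenvalue_inv hA hBk, eigenvalue_zpow hA hB]
    have h1 : 1 ≤ eigenvalue A (g * (B ^ k)⁻¹) := by
      rw [he, ← div_eq_mul_inv, le_div_iff₀ hk0, one_mul]
      exact hk1
    have h2 : eigenvalue A (g * (B ^ k)⁻¹) < eigenvalue A B := by
      rw [he, ← div_eq_mul_inv, div_lt_iff₀ hk0, ← zpow_one_add₀ (by linarith), add_comm]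
      exact hk2
    have h3 : eigenvalue A (g * (B ^ k)⁻¹) = eigenvalue A 1 := by
      rw [eigenvalue_one]
      by_contra hne
      have := hmin _ ⟨hgB, lt_of_le_of_ne h1 (Ne.symm hne), by linarith⟩
      linarith
    exact mul_inv_eq_one.mp (eigenvalue_injective hA hgB (by simp) h3)
  refine ⟨B, hB, hB1, fun g hg => ?_⟩
  rcases lt_or_gt_of_ne (eigenvalue_ne_zero hA hg) with h | h
  · obtain ⟨k, hk⟩ := hpos (-g) (commute_neg hg) (by rw [eigenvalue_neg]; linarith)
    exact ⟨k, Or.inr (by rw [← hk, neg_neg])⟩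
  · obtain ⟨k, hk⟩ := hpos g hg h
    exact ⟨k, Or.inl hk⟩

end Hyperbolic

end PrimeGeodesic

/-! ### Hyperbolic classes of PSL(2, ℤ) and their von Mangoldt values -/

namespace PrimeGeodesic

theorem mk_eq_mk_iff (A B : SL(2, ℤ)) :
    (QuotientGroup.mk A : Γ) = QuotientGroup.mk B ↔ B = A ∨ B = -A := by
  rw [QuotientGroup.eq, Matrix.SpecialLinearGroup.mem_center_iff]
  constructor
  · rintro ⟨r, hr, hs⟩
    have hB : B.1 = A.1 * Matrix.scalar (Fin 2) r := by
      rw [hs, ← Matrix.SpecialLinearGroup.coe_mul]; simp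
    have hr2 : r = 1 ∨ r = -1 := by simpa using hr
    rcases hr2 with rfl | rfl
    · left; exact Subtype.ext (by rw [hB]; simp)
    · right; exact Subtype.ext (by rw [hB]; simp)
  · rintro (rfl | rfl)
    · exact ⟨1, by simp, by simp⟩
    · exact ⟨-1, by simp, by simp⟩

theorem tr_mk (A : SL(2, ℤ)) : tr (QuotientGroup.mk A : Γ) = A.1.trace.natAbs := rfl

theorem trace_neg (A : SL(2, ℤ)) : (-A).1.trace = -A.1.trace := by
  rw [Matrix.SpecialLinearGroup.coe_neg, Matrix.trace_neg]

theorem trace_conj (A g : SL(2, ℤ)) : (g * A * g⁻¹).1.trace = A.1.trace := by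
  rw [Matrix.SpecialLinearGroup.coe_mul, Matrix.trace_mul_comm,
    ← Matrix.SpecialLinearGroup.coe_mul, inv_mul_cancel_left]

/-- Commuting with a hyperbolic element in `Γ` lifts to `SL(2, ℤ)`. -/
theorem commute_of_commute_mk {A B : SL(2, ℤ)} (hA : 2 < A.1.trace)
    (h : (QuotientGroup.mk B : Γ) * QuotientGroup.mk A = QuotientGroup.mk A * QuotientGroup.mk B) :
    B * A = A * B := by
  have h' : (QuotientGroup.mk (B * A) : Γ) = QuotientGroup.mk (A * B) := h
  rcases (mk_eq_mk_iff _ _).mp h' with h1 | h1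
  · exact h1.symm
  · exfalso
    have h2 : B * A * B⁻¹ = -A := by
      rw [← neg_neg (B * A), ← h1, neg_mul, mul_inv_cancel_right]
    have h3 := trace_conj A B
    rw [h2, trace_neg] at h3
    omega

theorem norm_mk_of_commute {A B : SL(2, ℤ)} (hA : 2 < A.1.trace) (hB : B * A = A * B)
    (h1 : 1 < eigenvalue A B) :
    IsHyperbolic (QuotientGroup.mk B : Γ) ∧
      norm (QuotientGroup.mk B : Γ) = eigenvalue A B ^ 2 := by
  set l := eigenvalue A B
  have hl0 : 0 < l := by linarith
  have htr := trace_eq_eigenvalue_add_inv hA hB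
  have hmul : l * l⁻¹ = 1 := mul_inv_cancel₀ hl0.ne'
  have hinv : l⁻¹ < 1 := inv_lt_one_of_one_lt₀ h1
  have hinv0 : 0 < l⁻¹ := inv_pos.mpr hl0
  have hT : ((tr (QuotientGroup.mk B : Γ) : ℕ) : ℝ) = l + l⁻¹ := by
    rw [tr_mk, Nat.cast_natAbs, Int.cast_abs, htr, abs_of_pos (by positivity)]
  constructor
  · have : (2 : ℝ) < ((tr (QuotientGroup.mk B : Γ) : ℕ) : ℝ) := by rw [hT]; nlinarith
    unfold IsHyperbolic
    exact_mod_cast this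
  · unfold norm
    rw [hT, show (l + l⁻¹) ^ 2 - 4 = (l - l⁻¹) ^ 2 by nlinarith, Real.sqrt_sq (by linarith)]
    ring

theorem tr_inv (P : Γ) : tr P⁻¹ = tr P := by
  induction P using QuotientGroup.induction_on with
  | H A =>
  change (A⁻¹).1.trace.natAbs = A.1.trace.natAbs
  rw [trace_entries, trace_entries, Matrix.SpecialLinearGroup.SL2_inv_expl]
  simp [add_comm]

theorem norm_eq_of_tr_eq {P Q : Γ} (h : tr P = tr Q) : norm P = norm Q := by
  unfold norm; rw [h]

theorem mk_eq_zpow_of_commute {A B : SL(2, ℤ)} (hA : 2 < A.1.trace)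
    (hB : IsCentralizerGenerator A B) {P : Γ}
    (hP : P * QuotientGroup.mk A = QuotientGroup.mk A * P) :
    ∃ k : ℤ, P = (QuotientGroup.mk B : Γ) ^ k := by
  induction P using QuotientGroup.induction_on with
  | H g =>
  obtain ⟨k, rfl | rfl⟩ := hB.2.2 g (commute_of_commute_mk hA hP)
  · exact ⟨k, rfl⟩
  · refine ⟨k, ?_⟩
    change _ = (QuotientGroup.mk (B ^ k) : Γ)
    exact (mk_eq_mk_iff _ _).mpr (Or.inr (neg_neg _).symm)

theorem exists_pow_of_isCentralizerGenerator {A B : SL(2, ℤ)} (hA : 2 < A.1.trace)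
    (hB : IsCentralizerGenerator A B) : ∃ j : ℕ, 1 ≤ j ∧ B ^ j = A := by
  have h1 := eigenvalue_self hA
  obtain ⟨k, hk | hk⟩ := hB.2.2 A rfl
  · have h2 : 1 < eigenvalue A B ^ k := by
      rw [← eigenvalue_zpow hA hB.1, ← hk]
      exact h1
    have hk0 : 0 < k := by
      by_contra hk0
      have := zpow_le_one_of_nonpos₀ hB.2.1.le (not_lt.mp hk0)
      linarith
    refine ⟨k.toNat, by omega, ?_⟩
    rw [← zpow_natCast, Int.toNat_of_nonneg hk0.le, ← hk]
  · exfalso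
    have h2 : eigenvalue A A = -eigenvalue A B ^ k := by
      rw [← eigenvalue_zpow hA hB.1, ← eigenvalue_neg, ← hk]
    have h3 : 0 < eigenvalue A B ^ k := zpow_pos (by linarith [hB.2.1]) k
    linarith

/-- If Q^i is the image of B, then Q commutes with the image of A = B^j, so Q is the image of B^l
for some l. Comparing eigenvalues gives l·i = 1, impossible for i ≥ 2. -/
theorem isPrimitive_mk_of_isCentralizerGenerator {A B : SL(2, ℤ)} (hA : 2 < A.1.trace)
    (hB : IsCentralizerGenerator A B) : IsPrimitive (QuotientGroup.mk B : Γ) := by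
  rintro ⟨Q, i, hi, hQ⟩
  obtain ⟨j, -, hj⟩ := exists_pow_of_isCentralizerGenerator hA hB
  have hQA : Q * QuotientGroup.mk A = QuotientGroup.mk A * Q := by
    rw [← hj, QuotientGroup.mk_pow, ← hQ, ← pow_mul]
    exact (Commute.refl Q).pow_right _
  obtain ⟨l, rfl⟩ := mk_eq_zpow_of_commute hA hB hQA
  rw [← zpow_natCast, ← zpow_mul] at hQ
  have hQ' : (QuotientGroup.mk (B ^ (l * i)) : Γ) = QuotientGroup.mk B := hQ
  have hpos : 0 < eigenvalue A B ^ (l * i) := zpow_pos (by linarith [hB.2.1]) _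
  rcases (mk_eq_mk_iff _ _).mp hQ' with h | h
  · have h2 := congrArg (eigenvalue A) h
    rw [eigenvalue_zpow hA hB.1] at h2
    have h3 : l * i = 1 := by
      refine (zpow_right_injective₀ (by linarith [hB.2.1] : 0 < eigenvalue A B) hB.2.1.ne' ?_)
      simp only [zpow_one]
      exact h2.symm
    have h4 := Int.isUnit_iff.mp (IsUnit.of_mul_eq_one_right l h3)
    omega
  · have h2 := congrArg (eigenvalue A) h
    rw [eigenvalue_neg, eigenvalue_zpow hA hB.1] at h2
    linarith [hB.2.1]

/-- The value of the von Mangoldt function in terms of a generator of the centralizer. -/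
theorem vonMangoldt_mk {A B : SL(2, ℤ)} (hA : 2 < A.1.trace) (hB : IsCentralizerGenerator A B) :
    vonMangoldt (ConjClasses.mk (QuotientGroup.mk A : Γ)) = 2 * Real.log (eigenvalue A B) := by
  obtain ⟨hhyp, hnorm⟩ := norm_mk_of_commute hA hB.1 hB.2.1
  have hex : ∃ P₀ : Γ, IsHyperbolic P₀ ∧ IsPrimitive P₀ ∧
      ∃ j : ℕ, 1 ≤ j ∧ ConjClasses.mk (P₀ ^ j) = ConjClasses.mk (QuotientGroup.mk A : Γ) := by
    obtain ⟨j, hj1, hj⟩ := exists_pow_of_isCentralizerGenerator hA hB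
    refine ⟨QuotientGroup.mk B, hhyp, isPrimitive_mk_of_isCentralizerGenerator hA hB, j, hj1, ?_⟩
    rw [← QuotientGroup.mk_pow, hj]
  -- `vonMangoldt` selects some P₀ by choice, so every admissible one must have the same norm. A
  -- conjugate of P₀ commutes with A, hence is B^k in Γ. Primitivity leaves |k| ≤ 1, hyperbolicity
  -- excludes k = 0, and inversion preserves the trace.
  have hmain : ∀ P : Γ, IsHyperbolic P → IsPrimitive P →
      (∃ j : ℕ, 1 ≤ j ∧ ConjClasses.mk (P ^ j) = ConjClasses.mk (QuotientGroup.mk A : Γ)) →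
      tr P = tr (QuotientGroup.mk B : Γ) := by
    rintro P hP hprim ⟨j, hj, hconj⟩
    rw [ConjClasses.mk_eq_mk_iff_isConj, isConj_iff] at hconj
    obtain ⟨c, hc⟩ := hconj
    rw [← conj_pow] at hc
    have htr : tr P = tr (c * P * c⁻¹) := tr_eq_of_isConj _ _ (isConj_iff.mpr ⟨c, rfl⟩)
    obtain ⟨k, hk⟩ := mk_eq_zpow_of_commute hA hB (P := c * P * c⁻¹) (by
      rw [← hc]
      exact (Commute.refl _).pow_right _)
    have hP' : P = c⁻¹ * (QuotientGroup.mk B : Γ) ^ k * c := by rw [← hk]; group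
    have hnot : ∀ (Q : Γ) (i : ℕ), 2 ≤ i → Q ^ i ≠ (QuotientGroup.mk B : Γ) ^ k := by
      intro Q i hi hQ
      refine hprim ⟨c⁻¹ * Q * c, i, hi, ?_⟩
      have := conj_pow (i := i) (a := c⁻¹) (b := Q)
      rw [inv_inv] at this
      rw [this, hQ, ← hP']
    rw [htr, hk]
    obtain ⟨m, rfl | rfl⟩ := k.eq_nat_or_neg
    · rcases Nat.lt_or_ge m 2 with hm | hm
      · interval_cases m
        · exfalso
          unfold IsHyperbolic at hP
          rw [htr, hk] at hP
          have h1 : tr (1 : Γ) = 2 := by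
            change (1 : SL(2, ℤ)).1.trace.natAbs = 2
            simp
          simp [h1] at hP
        · simp
      · exact absurd (by rw [zpow_natCast]) (hnot (QuotientGroup.mk B) m hm)
    · rcases Nat.lt_or_ge m 2 with hm | hm
      · interval_cases m
        · exfalso
          unfold IsHyperbolic at hP
          rw [htr, hk] at hP
          have h1 : tr (1 : Γ) = 2 := by
            change (1 : SL(2, ℤ)).1.trace.natAbs = 2
            simp
          simp [h1] at hP
        · simp [tr_inv]
      · exact absurd (by rw [zpow_neg, zpow_natCast, inv_pow])
          (hnot (QuotientGroup.mk B)⁻¹ m hm)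
  unfold vonMangoldt
  rw [dif_pos hex]
  obtain ⟨h1, h2, h3⟩ := hex.choose_spec
  rw [norm_eq_of_tr_eq (hmain _ h1 h2 h3), hnorm, Real.log_pow]
  norm_num

/-- Each hyperbolic conjugacy class is represented by a matrix of positive trace. -/
theorem exists_rep (C : ConjClasses Γ) :
    ∃ A : SL(2, ℤ), ConjClasses.mk (QuotientGroup.mk A : Γ) = C ∧ A.1.trace = classTr C := by
  obtain ⟨P, rfl⟩ := ConjClasses.exists_rep C
  induction P using QuotientGroup.induction_on with
  | H A =>
  change ∃ A' : SL(2, ℤ), _ ∧ A'.1.trace = (A.1.trace.natAbs : ℤ)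
  rcases le_total 0 A.1.trace with h | h
  · exact ⟨A, rfl, by omega⟩
  · refine ⟨-A, ?_, by rw [trace_neg]; omega⟩
    rw [(mk_eq_mk_iff A (-A)).mpr (Or.inr rfl)]

/-- Matrices of equal positive trace which are conjugate in `Γ` are conjugate in `SL(2, ℤ)`. -/
theorem exists_conj_of_mk_eq {A B : SL(2, ℤ)} (hA : 2 < A.1.trace) (hB : 2 < B.1.trace)
    (h : ConjClasses.mk (QuotientGroup.mk A : Γ) = ConjClasses.mk (QuotientGroup.mk B : Γ)) :
    ∃ g : SL(2, ℤ), g * A = B * g := by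
  rw [ConjClasses.mk_eq_mk_iff_isConj, isConj_iff] at h
  obtain ⟨c, hc⟩ := h
  induction c using QuotientGroup.induction_on with
  | H g =>
  have h' : (QuotientGroup.mk (g * A * g⁻¹) : Γ) = QuotientGroup.mk B := hc
  rcases (mk_eq_mk_iff _ _).mp h' with h1 | h1
  · exact ⟨g, by rw [h1, inv_mul_cancel_right]⟩
  · have := trace_neg (g * A * g⁻¹)
    rw [← h1, trace_conj] at this
    omega

theorem mk_eq_of_conj {A B g : SL(2, ℤ)} (h : g * A = B * g) :
    ConjClasses.mk (QuotientGroup.mk A : Γ) = ConjClasses.mk (QuotientGroup.mk B : Γ) := by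
  rw [ConjClasses.mk_eq_mk_iff_isConj, isConj_iff]
  refine ⟨QuotientGroup.mk g, ?_⟩
  change (QuotientGroup.mk (g * A * g⁻¹) : Γ) = _
  rw [h, mul_inv_cancel_right]

theorem classTr_mk (A : SL(2, ℤ)) :
    classTr (ConjClasses.mk (QuotientGroup.mk A : Γ)) = A.1.trace.natAbs := rfl

/-! ### Reduction theory and finiteness of the classes of given trace -/

/-- The upper triangular unipotent matrix with entry `k`. -/
def shear (k : ℤ) : SL(2, ℤ) := ⟨!![1, k; 0, 1], by simp⟩

theorem mul_entry (A B : SL(2, ℤ)) (i j : Fin 2) :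
    (A * B).1 i j = A.1 i 0 * B.1 0 j + A.1 i 1 * B.1 1 j := by
  rw [Matrix.SpecialLinearGroup.coe_mul, Matrix.mul_apply, Fin.sum_univ_two]

theorem inv_entries (A : SL(2, ℤ)) : A⁻¹.1 0 0 = A.1 1 1 ∧ A⁻¹.1 0 1 = -A.1 0 1 ∧
    A⁻¹.1 1 0 = -A.1 1 0 ∧ A⁻¹.1 1 1 = A.1 0 0 := by
  rw [Matrix.SpecialLinearGroup.SL2_inv_expl]
  simp

theorem shear_entries (k : ℤ) : (shear k).1 0 0 = 1 ∧ (shear k).1 0 1 = k ∧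
    (shear k).1 1 0 = 0 ∧ (shear k).1 1 1 = 1 := by
  simp [shear]

theorem shear_conj_entries (k : ℤ) (A : SL(2, ℤ)) :
    (shear k * A * (shear k)⁻¹).1 0 0 = A.1 0 0 + k * A.1 1 0 ∧
    (shear k * A * (shear k)⁻¹).1 1 0 = A.1 1 0 ∧
    (shear k * A * (shear k)⁻¹).1 1 1 = A.1 1 1 - k * A.1 1 0 := by
  obtain ⟨h1, h2, h3, h4⟩ := shear_entries k
  obtain ⟨i1, i2, i3, i4⟩ := inv_entries (shear k)
  simp only [mul_entry, h1, h2, h3, h4, i1, i2, i3, i4]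
  refine ⟨by ring, by ring, by ring⟩

theorem exists_abs_add_two_mul_le (y : ℤ) {c : ℤ} (hc : c ≠ 0) :
    ∃ k : ℤ, |y + 2 * k * c| ≤ |c| := by
  have h0 : 0 < 2 * |c| := by positivity
  have h1 := Int.emod_nonneg (y + |c|) h0.ne'
  have h2 := Int.emod_lt_of_pos (y + |c|) h0
  have h3 := Int.emod_add_mul_ediv (y + |c|) (2 * |c|)
  rcases abs_choice c with hc | hc
  · refine ⟨-((y + |c|) / (2 * |c|)), abs_le.mpr ?_⟩
    have : 2 * |c| * ((y + |c|) / (2 * |c|)) = 2 * ((y + |c|) / (2 * |c|)) * c := by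
      nth_rw 1 [hc]; ring
    constructor <;> linarith
  · refine ⟨(y + |c|) / (2 * |c|), abs_le.mpr ?_⟩
    have : 2 * |c| * ((y + |c|) / (2 * |c|)) = -(2 * ((y + |c|) / (2 * |c|)) * c) := by
      nth_rw 1 [hc]; ring
    constructor <;> linarith

/-- From 4bc = t² - 4 - (a - d)², with t = a + d, and (a - d)² ≤ c² ≤ |bc|, it follows that bc > 0.
Then |c| ≤ |b| ≤ bc ≤ t², which also bounds the diagonal. -/
theorem abs_le_of_reduced {a b c d : ℤ} (hc : c ≠ 0) (hdet : a * d - b * c = 1)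
    (hdiag : |a - d| ≤ |c|) (hcb : |c| ≤ |b|) (ht : 2 < a + d) :
    |a| ≤ (a + d) ^ 2 ∧ |b| ≤ (a + d) ^ 2 ∧ |c| ≤ (a + d) ^ 2 ∧ |d| ≤ (a + d) ^ 2 := by
  have hcpos : 1 ≤ |c| := Int.one_le_abs hc
  have hsq : (a - d) ^ 2 ≤ c ^ 2 := sq_le_sq.mpr hdiag
  have hcsq : c ^ 2 ≤ |b * c| := by
    rw [abs_mul, ← sq_abs, sq]
    exact mul_le_mul_of_nonneg_right hcb (abs_nonneg _)
  have hcp : 0 < c ^ 2 := by positivity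
  have hdisc : 4 * (b * c) = (a + d) ^ 2 - (a - d) ^ 2 - 4 := by linear_combination (-4) * hdet
  have ht2 : 9 ≤ (a + d) ^ 2 := by nlinarith
  have hbc : 0 < b * c := by
    by_contra hneg
    rw [abs_of_nonpos (not_lt.mp hneg)] at hcsq
    linarith
  have hb : |b| ≤ (a + d) ^ 2 := by
    have h1 : |b| * 1 ≤ |b| * |c| := mul_le_mul_of_nonneg_left hcpos (abs_nonneg _)
    rw [← abs_mul, abs_of_pos hbc] at h1
    linarith [sq_nonneg (a - d)]
  have hc' : |c| ≤ (a + d) ^ 2 := hcb.trans hb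
  have hdiag' := abs_le.mp (hdiag.trans hc')
  have ht3 : a + d ≤ (a + d) ^ 2 := by nlinarith
  exact ⟨abs_le.mpr ⟨by linarith, by linarith⟩, hb, hc', abs_le.mpr ⟨by linarith, by linarith⟩⟩

theorem S_conj_entry (A : SL(2, ℤ)) : (ModularGroup.S * A * ModularGroup.S⁻¹).1 1 0 = -A.1 0 1 := by
  obtain ⟨i1, i2, i3, i4⟩ := inv_entries ModularGroup.S
  have h2 : ModularGroup.S.1 1 0 = 1 := rfl
  have h3 : ModularGroup.S.1 1 1 = 0 := rfl
  simp only [mul_entry, i1, i3, h2, h3]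
  ring

/-- Gauss reduction. Choose a conjugate with |c| minimal and shear it until |a - d| ≤ |c|.
Conjugation by `ModularGroup.S` puts -b in the place of c, so minimality gives |c| ≤ |b|. -/
theorem exists_conj_reduced {A : SL(2, ℤ)} (hA : 2 < A.1.trace) :
    ∃ g : SL(2, ℤ), ∀ i j, |(g * A * g⁻¹).1 i j| ≤ A.1.trace ^ 2 := by
  obtain ⟨g, hmin⟩ : ∃ g : SL(2, ℤ), ∀ h : SL(2, ℤ),
      |(g * A * g⁻¹).1 1 0| ≤ |(h * A * h⁻¹).1 1 0| := by
    obtain ⟨g, -, hg⟩ := exists_minimalFor_of_wellFoundedLT (fun _ : SL(2, ℤ) => True)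
      (fun g => ((g * A * g⁻¹).1 1 0).natAbs) ⟨1, trivial⟩
    refine ⟨g, fun h => ?_⟩
    rw [Int.abs_eq_natAbs, Int.abs_eq_natAbs, Nat.cast_le]
    rcases le_total ((g * A * g⁻¹).1 1 0).natAbs ((h * A * h⁻¹).1 1 0).natAbs with h1 | h1
    · exact h1
    · exact hg trivial h1
  obtain ⟨B, hB⟩ : ∃ B, B = g * A * g⁻¹ := ⟨_, rfl⟩
  rw [← hB] at hmin
  have hBc : B.1 1 0 ≠ 0 := lower_left_ne_zero (by rw [hB, trace_conj]; exact hA)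
  obtain ⟨k, hk⟩ := exists_abs_add_two_mul_le (B.1 0 0 - B.1 1 1) hBc
  obtain ⟨D, hD⟩ : ∃ D, D = (shear k * g) * A * (shear k * g)⁻¹ := ⟨_, rfl⟩
  have hDB : shear k * B * (shear k)⁻¹ = D := by
    simp only [hD, hB, mul_inv_rev, mul_assoc]
  have hDtr : D.1.trace = A.1.trace := by rw [hD]; exact trace_conj A (shear k * g)
  have hS : (ModularGroup.S * (shear k * g)) * A * (ModularGroup.S * (shear k * g))⁻¹
      = ModularGroup.S * D * ModularGroup.S⁻¹ := by
    simp only [hD, mul_inv_rev, mul_assoc]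
  obtain ⟨e1, e2, e3⟩ := shear_conj_entries k B
  rw [hDB] at e1 e2 e3
  have h1 := hmin (ModularGroup.S * (shear k * g))
  rw [hS, S_conj_entry, abs_neg, ← e2] at h1
  refine ⟨shear k * g, ?_⟩
  rw [← hD]
  rw [← hDtr] at hA ⊢
  rw [trace_entries] at hA ⊢
  obtain ⟨b1, b2, b3, b4⟩ := abs_le_of_reduced (by rw [e2]; exact hBc) (det_entries D)
    (by rw [e1, e2, e3]; refine (le_of_eq ?_).trans hk; congr 1; ring) h1 hA
  exact Fin.forall_fin_two.mpr ⟨Fin.forall_fin_two.mpr ⟨b1, b2⟩, Fin.forall_fin_two.mpr ⟨b3, b4⟩⟩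

theorem finite_classTr_eq {n : ℕ} (hn : 2 < n) : {C : ConjClasses Γ | classTr C = n}.Finite := by
  have hfin : {M : Matrix (Fin 2) (Fin 2) ℤ | ∀ i j, M i j ∈ Set.Icc (-(n : ℤ) ^ 2) (n ^ 2)}.Finite := by
    have := Set.Finite.pi' fun _ : Fin 2 => Set.Finite.pi' fun _ : Fin 2 =>
      Set.finite_Icc (-(n : ℤ) ^ 2) (n ^ 2)
    exact this
  have hfin' := hfin.preimage (f := fun A : SL(2, ℤ) => A.1) (Subtype.val_injective.injOn)
  refine (hfin'.image fun A : SL(2, ℤ) => ConjClasses.mk (QuotientGroup.mk A : Γ)).subset ?_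
  intro C hC
  obtain ⟨A, rfl, hA⟩ := exists_rep C
  rw [Set.mem_ofPred_eq] at hC
  rw [hC] at hA
  obtain ⟨g, hg⟩ := exists_conj_reduced (A := A) (by omega)
  refine ⟨g * A * g⁻¹, fun i j => ?_, ?_⟩
  · have := hg i j
    rw [hA] at this
    rw [Set.mem_Icc, neg_eq_neg_one_mul] 
    have h2 := abs_le.mp this
    constructor <;> linarith [h2.1, h2.2]
  · exact (mk_eq_of_conj (g := g) (by group)).symm

end PrimeGeodesic

/-! ### Lattice points in a hyperbolic sector -/

namespace PrimeGeodesic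

open Filter Topology MeasureTheory

/-- The sector in the positive quadrant between the lines `u = w` and `u = m ^ 2 w`. -/
def sector (m : ℝ) : Set (ℝ × ℝ) := {z | 0 < z.1 ∧ 0 < z.2 ∧ z.2 ≤ z.1 ∧ z.1 < m ^ 2 * z.2}

/-- The part of the sector below the hyperbola `u w = 1`. -/
def cuspSector (m : ℝ) : Set (ℝ × ℝ) := {z | z ∈ sector m ∧ z.1 * z.2 ≤ 1}

theorem cuspSector_eq (m : ℝ) : cuspSector m =
    {z | 0 < z.1} ∩ ({z | 0 < z.2} ∩ ({z | z.2 ≤ z.1} ∩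
      ({z | z.1 < m ^ 2 * z.2} ∩ {z | z.1 * z.2 ≤ 1}))) := by
  ext z
  simp [cuspSector, sector, and_assoc]

theorem measurableSet_cuspSector (m : ℝ) : MeasurableSet (cuspSector m) := by
  rw [cuspSector_eq]
  refine (measurableSet_lt measurable_const measurable_fst).inter
    ((measurableSet_lt measurable_const measurable_snd).inter
    ((measurableSet_le measurable_snd measurable_fst).inter
    ((measurableSet_lt measurable_fst (by fun_prop)).inter
    (measurableSet_le (by fun_prop) measurable_const))))

theorem frontier_cuspSector_subset (m : ℝ) : frontier (cuspSector m) ⊆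
    {z | z.1 = 0 ∨ z.2 = 0 ∨ z.2 = z.1 ∨ z.1 = m ^ 2 * z.2 ∨ z.1 * z.2 = 1} := by
  have key : ∀ {s t : Set (ℝ × ℝ)} {z : ℝ × ℝ}, z ∈ frontier (s ∩ t) →
      z ∈ frontier s ∨ z ∈ frontier t := fun {s t z} hz =>
    (frontier_inter_subset s t hz).elim (fun h => Or.inl h.1) fun h => Or.inr h.2
  intro z hz
  rw [cuspSector_eq] at hz
  rcases key hz with h | hz
  · exact Or.inl (frontier_lt_subset_eq continuous_const continuous_fst h).symm
  rcases key hz with h | hz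
  · exact Or.inr (Or.inl (frontier_lt_subset_eq continuous_const continuous_snd h).symm)
  rcases key hz with h | hz
  · exact Or.inr (Or.inr (Or.inl (frontier_le_subset_eq continuous_snd continuous_fst h)))
  rcases key hz with h | h
  · exact Or.inr (Or.inr (Or.inr (Or.inl
      (frontier_lt_subset_eq continuous_fst (by fun_prop : Continuous fun z : ℝ × ℝ => m ^ 2 * z.2) h))))
  · exact Or.inr (Or.inr (Or.inr (Or.inr
      (frontier_le_subset_eq (by fun_prop : Continuous fun z : ℝ × ℝ => z.1 * z.2)
        continuous_const h))))

theorem volume_frontier_cuspSector {m : ℝ} (hm : m ≠ 0) :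
    volume (frontier (cuspSector m)) = 0 := by
  rw [Measure.volume_eq_prod, Measure.measure_prod_null isClosed_frontier.measurableSet]
  have h0 : ∀ᵐ u : ℝ, u ≠ 0 := by simp [ae_iff]
  filter_upwards [h0] with u hu
  refine Set.Finite.measure_zero ((Set.toFinite {0, u, u / m ^ 2, 1 / u}).subset ?_) _
  intro w hw
  have h := frontier_cuspSector_subset m hw
  simp only [Set.mem_ofPred_eq] at h
  simp only [Set.mem_insert_iff, Set.mem_singleton_iff]
  rcases h with h | h | h | h | h
  · exact absurd h hu
  · exact Or.inl h
  · exact Or.inr (Or.inl h)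
  · refine Or.inr (Or.inr (Or.inl ?_))
    field_simp
    linarith
  · refine Or.inr (Or.inr (Or.inr ?_))
    field_simp
    linarith

/-- The integrand is the length of the slice u/m² < w ≤ min(u, 1/u) of `cuspSector`. Splitting at u
= 1 gives 1/2 + log m - 1/2. -/
theorem integral_sector_slices {m : ℝ} (hm : 1 < m) :
    IntervalIntegrable (fun u : ℝ => min u (1 / u) - u / m ^ 2) volume 0 m ∧
    ∫ u in (0 : ℝ)..m, (min u (1 / u) - u / m ^ 2) = Real.log m := by
  have hm0 : 0 < m := by linarith
  have e1 : Set.EqOn (fun u : ℝ => u - u / m ^ 2) (fun u : ℝ => min u (1 / u) - u / m ^ 2)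
      (Set.uIcc 0 1) := by
    intro u hu
    rw [Set.uIcc_of_le zero_le_one, Set.mem_Icc] at hu
    simp only
    rcases hu.1.eq_or_lt with rfl | h0
    · simp
    · rw [min_eq_left]
      rw [le_div_iff₀ h0]
      nlinarith
  have e2 : Set.EqOn (fun u : ℝ => 1 / u - u / m ^ 2) (fun u : ℝ => min u (1 / u) - u / m ^ 2)
      (Set.uIcc 1 m) := by
    intro u hu
    rw [Set.uIcc_of_le hm.le, Set.mem_Icc] at hu
    simp only
    rw [min_eq_right]
    rw [div_le_iff₀ (by linarith)]
    nlinarith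
  have c1 : IntervalIntegrable (fun u : ℝ => u - u / m ^ 2) volume 0 1 :=
    (by fun_prop : Continuous fun u : ℝ => u - u / m ^ 2).intervalIntegrable _ _
  have c2a : IntervalIntegrable (fun u : ℝ => 1 / u) volume 1 m := by
    refine intervalIntegral.intervalIntegrable_one_div (fun u hu => ?_) continuousOn_id
    rw [Set.uIcc_of_le hm.le, Set.mem_Icc] at hu
    exact (by linarith : (0 : ℝ) < u).ne'
  have c2b : IntervalIntegrable (fun u : ℝ => u / m ^ 2) volume 1 m :=
    (by fun_prop : Continuous fun u : ℝ => u / m ^ 2).intervalIntegrable _ _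
  have i1 := (intervalIntegrable_congr (e1.mono Set.uIoc_subset_uIcc)).mp c1
  have i2 := (intervalIntegrable_congr (e2.mono Set.uIoc_subset_uIcc)).mp (c2a.sub c2b)
  refine ⟨i1.trans i2, ?_⟩
  rw [← intervalIntegral.integral_add_adjacent_intervals i1 i2,
    ← intervalIntegral.integral_congr e1, ← intervalIntegral.integral_congr e2,
    intervalIntegral.integral_sub c2a c2b, integral_one_div_of_pos one_pos hm0,
    intervalIntegral.integral_sub (by simp)
      ((by fun_prop : Continuous fun u : ℝ => u / m ^ 2).intervalIntegrable _ _),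
    intervalIntegral.integral_div, intervalIntegral.integral_div, integral_id, integral_id]
  field_simp
  ring

theorem volume_cuspSector {m : ℝ} (hm : 1 < m) :
    volume (cuspSector m) = ENNReal.ofReal (Real.log m) := by
  have hm0 : 0 < m := by linarith
  obtain ⟨hint, hval⟩ := integral_sector_slices hm
  have hslice : ∀ u : ℝ, volume (Prod.mk u ⁻¹' cuspSector m) =
      (Set.Ioc 0 m).indicator (fun u => ENNReal.ofReal (min u (1 / u) - u / m ^ 2)) u := by
    intro u
    rcases le_or_gt u 0 with h0 | h0
    · have : Prod.mk u ⁻¹' cuspSector m = ∅ := by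
        ext w
        simp only [Set.mem_preimage, cuspSector, sector, Set.mem_ofPred_eq, Set.mem_empty_iff_false,
          iff_false]
        rintro ⟨⟨h, -⟩, -⟩
        linarith
      rw [this, measure_empty, Set.indicator_of_notMem]
      rw [Set.mem_Ioc]
      rintro ⟨h, -⟩
      linarith
    · have : Prod.mk u ⁻¹' cuspSector m = Set.Ioc (u / m ^ 2) (min u (1 / u)) := by
        ext w
        simp only [Set.mem_preimage, cuspSector, sector, Set.mem_ofPred_eq, Set.mem_Ioc, le_min_iff]
        rw [div_lt_iff₀ (by positivity), le_div_iff₀ h0]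
        constructor
        · rintro ⟨⟨-, h2, h3, h4⟩, h5⟩
          exact ⟨by linarith, h3, by linarith⟩
        · rintro ⟨h1, h2, h3⟩
          refine ⟨⟨h0, ?_, h2, by linarith⟩, by linarith⟩
          by_contra h
          nlinarith [sq_nonneg m]
      rw [this, Real.volume_Ioc]
      rcases le_or_gt u m with h1 | h1
      · rw [Set.indicator_of_mem (show u ∈ Set.Ioc 0 m from ⟨h0, h1⟩)]
      · rw [Set.indicator_of_notMem (fun h => absurd h.2 (not_le.mpr h1)),
          ENNReal.ofReal_eq_zero, sub_nonpos]
        refine (min_le_right _ _).trans ?_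
        rw [div_le_div_iff₀ h0 (by positivity)]
        nlinarith
  rw [Measure.volume_eq_prod, Measure.prod_apply (measurableSet_cuspSector m)]
  simp only [hslice]
  rw [lintegral_indicator measurableSet_Ioc, ← ofReal_integral_eq_lintegral_ofReal,
    ← intervalIntegral.integral_of_le hm0.le, hval]
  · exact (intervalIntegrable_iff_integrableOn_Ioc_of_le hm0.le).mp hint
  · filter_upwards [ae_restrict_mem measurableSet_Ioc] with u hu
    simp only [Pi.zero_apply, sub_nonneg, le_min_iff]
    have hm1 : (1 : ℝ) ≤ m ^ 2 := by nlinarith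
    constructor
    · rw [div_le_iff₀ (by positivity)]
      nlinarith [hu.1]
    · rw [div_le_div_iff₀ (by positivity) hu.1]
      nlinarith [hu.1, hu.2]

theorem covolume_pi_basisFun :
    ZLattice.covolume (Submodule.span ℤ (Set.range (Pi.basisFun ℝ (Fin 2)))) = 1 := by
  rw [ZLattice.covolume_eq_measure_fundamentalDomain _ _
    (ZSpan.isAddFundamentalDomain (Pi.basisFun ℝ (Fin 2)) volume),
    ZSpan.fundamentalDomain_pi_basisFun, Measure.real, volume_pi, Measure.pi_pi]
  simp

/-- The number of integer points in a sector of `u w ≤ x`, for linear coordinates `u, w`. -/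
theorem tendsto_card_sector {p q r t : ℝ} (hD : p * t - q * r ≠ 0) {m : ℝ} (hm : 1 < m) :
    Tendsto (fun x : ℝ => (Nat.card {v : Fin 2 → ℤ |
        (p * v 0 + q * v 1, r * v 0 + t * v 1) ∈ sector m ∧
          (p * v 0 + q * v 1) * (r * v 0 + t * v 1) ≤ x} : ℝ) / x) atTop
      (𝓝 (Real.log m / |p * t - q * r|)) := by
  have hm0 : 0 < m := by linarith
  set T : (Fin 2 → ℝ) →ₗ[ℝ] (Fin 2 → ℝ) := Matrix.toLin' !![p, q; r, t] with hT
  have hT0 : ∀ v, T v 0 = p * v 0 + q * v 1 := by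
    intro v; simp [hT, Matrix.toLin'_apply, Matrix.mulVec, dotProduct, Fin.sum_univ_two]
  have hT1 : ∀ v, T v 1 = r * v 0 + t * v 1 := by
    intro v; simp [hT, Matrix.toLin'_apply, Matrix.mulVec, dotProduct, Fin.sum_univ_two]
  have hdet : LinearMap.det T = p * t - q * r := by
    rw [hT, LinearMap.det_toLin', Matrix.det_fin_two_of]
  set f : (Fin 2 → ℝ) → ℝ × ℝ := fun v => MeasurableEquiv.finTwoArrow (T v) with hf
  have hf' : ∀ v, f v = (p * v 0 + q * v 1, r * v 0 + t * v 1) := by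
    intro v; rw [← hT0, ← hT1]; rfl
  have hfc : Continuous f := by
    rw [show f = fun v => (p * v 0 + q * v 1, r * v 0 + t * v 1) from funext hf']
    fun_prop
  have hvol : ∀ s, MeasurableSet s → volume (f ⁻¹' s)
      = ENNReal.ofReal |(p * t - q * r)⁻¹| * volume s := by
    intro s hs
    have h1 : f ⁻¹' s = T ⁻¹' (MeasurableEquiv.finTwoArrow ⁻¹' s) := rfl
    rw [h1, Measure.addHaar_preimage_linearMap _ (by rw [hdet]; exact hD), hdet,
      (volume_preserving_finTwoArrow ℝ).measure_preimage hs.nullMeasurableSet]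
  set X : Set (Fin 2 → ℝ) := f ⁻¹' sector m with hX
  set F : (Fin 2 → ℝ) → ℝ := fun v => (f v).1 * (f v).2 with hF
  have hX1 : {v ∈ X | F v ≤ 1} = f ⁻¹' cuspSector m := rfl
  have hsmul : ∀ (v : Fin 2 → ℝ) (c : ℝ), f (c • v) = c • f v := by
    intro v c
    rw [hf', hf']
    simp only [Pi.smul_apply, smul_eq_mul, Prod.smul_mk]
    congr 1 <;> ring
  -- The sector is a cone and uw is homogeneous of degree 2, the dimension. The other hypotheses are
  -- that the region uw ≤ 1 is bounded and measurable with null frontier.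
  have hmain := ZLattice.covolume.tendsto_card_le_div
    (L := Submodule.span ℤ (Set.range (Pi.basisFun ℝ (Fin 2)))) (X := X) (F := F) ?_ ?_ ?_ ?_ ?_
  · rw [covolume_pi_basisFun, hX1, Measure.real, hvol _ (measurableSet_cuspSector m),
      volume_cuspSector hm, ENNReal.toReal_mul, ENNReal.toReal_ofReal (abs_nonneg _),
      ENNReal.toReal_ofReal (Real.log_nonneg hm.le), div_one, abs_inv, inv_mul_eq_div] at hmain
    refine hmain.congr fun x => ?_
    congr 2
    symm
    refine Nat.card_congr (Equiv.ofBijective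
      (fun v => ⟨fun i => ((v.1 i : ℤ) : ℝ), ?_, ?_⟩) ⟨?_, ?_⟩)
    · refine ⟨?_, ?_⟩
      · change f _ ∈ sector m
        rw [hf']
        exact v.2.1
      · simp only [hF, hf']
        exact v.2.2
    · rw [SetLike.mem_coe, Module.Basis.mem_span_iff_repr_mem]
      intro i
      exact ⟨v.1 i, by simp⟩
    · intro v w h
      have h' := congrArg Subtype.val h
      refine Subtype.ext (funext fun i => ?_)
      exact Int.cast_injective (α := ℝ) (congrFun h' i)
    · rintro ⟨w, ⟨hw1, hw2⟩, hw⟩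
      rw [SetLike.mem_coe, Module.Basis.mem_span_iff_repr_mem] at hw
      choose z hz using hw
      simp only [Pi.basisFun_repr, algebraMap_int_eq, eq_intCast] at hz
      refine ⟨⟨z, ?_, ?_⟩, ?_⟩
      · rw [hz, hz, ← hf']
        exact hw1
      · simp only [hF, hf'] at hw2
        rw [hz, hz]
        exact hw2
      · exact Subtype.ext (funext hz)
  · intro v c hv hc
    change f (c • v) ∈ sector m
    rw [hsmul]
    obtain ⟨h1, h2, h3, h4⟩ := hv
    refine ⟨mul_pos hc h1, mul_pos hc h2, mul_le_mul_of_nonneg_left h3 hc.le, ?_⟩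
    have := mul_lt_mul_of_pos_left h4 hc
    simp only [Prod.smul_fst, Prod.smul_snd, smul_eq_mul]
    linarith
  · intro v c _
    simp only [hF, hsmul, Prod.smul_fst, Prod.smul_snd, smul_eq_mul, Fintype.card_fin]
    ring
  · rw [isBounded_iff_forall_norm_le]
    refine ⟨(|p| + |q| + |r| + |t|) * m / |p * t - q * r|, fun v hv => ?_⟩
    have hDpos : 0 < |p * t - q * r| := abs_pos.mpr hD
    rw [hX1, Set.mem_preimage, hf'] at hv
    obtain ⟨⟨h1, h2, h3, h4⟩, h5⟩ := hv
    simp only at h1 h2 h3 h4 h5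
    set u := p * v 0 + q * v 1 with hu
    set w := r * v 0 + t * v 1 with hw
    -- Since u < m²w and uw ≤ 1, u² ≤ m²·uw ≤ m². Cramer's rule then bounds v.
    have hum : u ≤ m := by
      refine le_of_sq_le_sq ?_ hm0.le
      nlinarith
    have hu' : |u| ≤ m := by rw [abs_of_pos h1]; exact hum
    have hw' : |w| ≤ m := by rw [abs_of_pos h2]; linarith
    have e0 : v 0 * (p * t - q * r) = t * u - q * w := by rw [hu, hw]; ring
    have e1 : v 1 * (p * t - q * r) = p * w - r * u := by rw [hu, hw]; ring
    have hb : ∀ a b c d : ℝ, |c| ≤ m → |d| ≤ m → |a * c - b * d| ≤ (|a| + |b|) * m := by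
      intro a b c d hc hd
      refine (abs_sub _ _).trans ?_
      rw [abs_mul, abs_mul, add_mul]
      exact add_le_add (mul_le_mul_of_nonneg_left hc (abs_nonneg _))
        (mul_le_mul_of_nonneg_left hd (abs_nonneg _))
    rw [pi_norm_le_iff_of_nonneg (by positivity), Fin.forall_fin_two]
    constructor
    · rw [le_div_iff₀ hDpos, Real.norm_eq_abs, ← abs_mul, e0]
      refine (hb _ _ _ _ hu' hw').trans (mul_le_mul_of_nonneg_right ?_ hm0.le)
      linarith [abs_nonneg p, abs_nonneg r]
    · rw [le_div_iff₀ hDpos, Real.norm_eq_abs, ← abs_mul, e1]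
      refine (hb _ _ _ _ hw' hu').trans (mul_le_mul_of_nonneg_right ?_ hm0.le)
      linarith [abs_nonneg q, abs_nonneg t]
  · rw [hX1]
    exact hfc.measurable (measurableSet_cuspSector m)
  · change volume (frontier (f ⁻¹' cuspSector m)) = 0
    refine measure_mono_null (hfc.frontier_preimage_subset _) ?_
    rw [hvol _ isClosed_frontier.measurableSet, volume_frontier_cuspSector hm0.ne', mul_zero]

end PrimeGeodesic

/-! ### Counting orbits of pairs (matrix, vector) in two ways -/

namespace PrimeGeodesic

theorem mulVec_entry (g : SL(2, ℤ)) (v : Fin 2 → ℤ) (i : Fin 2) :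
    g.1.mulVec v i = g.1 i 0 * v 0 + g.1 i 1 * v 1 := by
  simp [Matrix.mulVec, dotProduct, Fin.sum_univ_two]

theorem mul_mulVec (g h : SL(2, ℤ)) (v : Fin 2 → ℤ) :
    (g * h).1.mulVec v = g.1.mulVec (h.1.mulVec v) := by
  rw [Matrix.SpecialLinearGroup.coe_mul, Matrix.mulVec_mulVec]

theorem one_mulVec (v : Fin 2 → ℤ) : (1 : SL(2, ℤ)).1.mulVec v = v := by simp

theorem quadForm_eq (A : SL(2, ℤ)) (v : Fin 2 → ℤ) :
    quadForm A v = v 0 * A.1.mulVec v 1 - v 1 * A.1.mulVec v 0 := by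
  rw [mulVec_entry, mulVec_entry, quadForm]; ring

/-- The form is det(v, Av), and det(gv, M(gv)) = det(gv, g(Av)) with det g = 1. -/
theorem quadForm_conj {A M g : SL(2, ℤ)} (h : g * A = M * g) (v : Fin 2 → ℤ) :
    quadForm M (g.1.mulVec v) = quadForm A v := by
  have hdet := det_entries g
  rw [quadForm_eq, quadForm_eq, ← mul_mulVec, ← h, mul_mulVec, mulVec_entry g v 0,
    mulVec_entry g v 1, mulVec_entry g (A.1.mulVec v) 0, mulVec_entry g (A.1.mulVec v) 1]
  linear_combination (v 0 * A.1.mulVec v 1 - v 1 * A.1.mulVec v 0) * hdet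

theorem quadForm_axis (A : SL(2, ℤ)) (d : ℤ) : quadForm A ![d, 0] = A.1 1 0 * d ^ 2 := by
  simp [quadForm]

theorem shear_mulVec_axis (k d : ℤ) : (shear k).1.mulVec ![d, 0] = ![d, 0] := by
  obtain ⟨h1, h2, h3, h4⟩ := shear_entries k
  ext i
  fin_cases i <;> simp [mulVec_entry, h1, h3]

theorem exists_mulVec_eq_axis {v : Fin 2 → ℤ} (hv : v ≠ 0) :
    ∃ (g : SL(2, ℤ)) (d : ℕ), 1 ≤ d ∧ g.1.mulVec v = ![(d : ℤ), 0] := by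
  have hgcd : 0 < Int.gcd (v 0) (v 1) := by
    rw [Int.gcd_pos_iff]
    by_contra h
    push Not at h
    apply hv
    ext i
    fin_cases i
    · exact h.1
    · exact h.2
  obtain ⟨x, y, hxy, hx, hy⟩ := Int.exists_gcd_one hgcd
  rw [← Int.isCoprime_iff_gcd_eq_one] at hxy
  obtain ⟨u, w, huw⟩ := hxy
  obtain ⟨g, h1, h2, h3, h4⟩ : ∃ g : SL(2, ℤ),
      g.1 0 0 = u ∧ g.1 0 1 = w ∧ g.1 1 0 = -y ∧ g.1 1 1 = x :=
    ⟨⟨!![u, w; -y, x], by rw [Matrix.det_fin_two_of]; linarith⟩, rfl, rfl, rfl, rfl⟩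
  refine ⟨g, Int.gcd (v 0) (v 1), hgcd, ?_⟩
  ext i
  rw [mulVec_entry]
  fin_cases i
  · simp [h1, h2]
    linear_combination u * hx + w * hy + (Int.gcd (v 0) (v 1) : ℤ) * huw
  · simp [h3, h4]
    linear_combination (-y) * hx + x * hy

theorem eq_shear_of_mulVec_axis {h : SL(2, ℤ)} {d d' : ℕ} (hd : 1 ≤ d) (hd' : 1 ≤ d')
    (heq : h.1.mulVec ![(d : ℤ), 0] = ![(d' : ℤ), 0]) : d = d' ∧ h = shear (h.1 0 1) := by
  have h0 := congrFun heq 0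
  have h1 := congrFun heq 1
  rw [mulVec_entry] at h0 h1
  simp at h0 h1
  have h10 : h.1 1 0 = 0 := by omega
  have hdet := det_entries h
  rw [h10, mul_zero, sub_zero] at hdet
  have hpos : 0 < h.1 0 0 := by
    have : (0 : ℤ) < h.1 0 0 * d := by rw [h0]; omega
    exact pos_of_mul_pos_left this (by omega)
  have h00 : h.1 0 0 = 1 := by
    rcases Int.eq_one_or_neg_one_of_mul_eq_one hdet with h2 | h2
    · exact h2
    · omega
  rw [h00, one_mul] at hdet h0
  refine ⟨by omega, ?_⟩
  obtain ⟨s1, s2, s3, s4⟩ := shear_entries (h.1 0 1)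
  ext i j
  fin_cases i <;> fin_cases j
  · exact h00.trans s1.symm
  · exact s2.symm
  · exact h10.trans s3.symm
  · exact hdet.trans s4.symm

/-- The integer points of a fundamental sector for the action of the centralizer of `A` with
generator `B`, at which `quadForm A` is at most `x`. -/
def sectorPoints (A B : SL(2, ℤ)) (x : ℝ) : Set (Fin 2 → ℤ) :=
  {v | (expandForm A (fun i => v i), contractForm A (fun i => v i)) ∈ sector (eigenvalue A B) ∧
    expandForm A (fun i => v i) * contractForm A (fun i => v i) ≤ x}

section Sector

variable {A B : SL(2, ℤ)}

theorem quadForm_pos_of_mem_sector (hA : 2 < A.1.trace) {v : Fin 2 → ℤ} {m : ℝ}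
    (hv : (expandForm A (fun i => v i), contractForm A (fun i => v i)) ∈ sector m) :
    0 < quadForm A v := by
  have h := mul_pos hv.1 hv.2.1
  simp only at h
  rw [expandForm_mul_contractForm hA] at h
  exact_mod_cast h

theorem ne_zero_of_quadForm_pos {v : Fin 2 → ℤ} (h : 0 < quadForm A v) : v ≠ 0 := by
  rintro rfl
  simp [quadForm] at h

/-- B multiplies the ratio u/w by m², so some power of B moves it into [1, m²). As uw > 0, the
coordinates have equal signs, and a factor -1 makes both positive if needed. -/
theorem exists_mulVec_mem_sector (hA : 2 < A.1.trace) (hB : IsCentralizerGenerator A B)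
    {v : Fin 2 → ℤ} (hv : 0 < quadForm A v) : ∃ γ : SL(2, ℤ), γ * A = A * γ ∧
      (expandForm A (fun i => γ.1.mulVec v i), contractForm A (fun i => γ.1.mulVec v i))
        ∈ sector (eigenvalue A B) := by
  set m := eigenvalue A B with hm
  have hm1 : 1 < m := hB.2.1
  have hm0 : 0 < m := by linarith
  set u := expandForm A (fun i => v i) with hu
  set w := contractForm A (fun i => v i) with hw
  have huw : 0 < u * w := by
    rw [hu, hw, expandForm_mul_contractForm hA]
    exact_mod_cast hv
  obtain ⟨k, hk1, hk2⟩ := exists_mem_Ico_zpow (x := u / w) (y := m ^ 2)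
    (by rcases (mul_pos_iff.mp huw) with h | h
        · exact div_pos h.1 h.2
        · exact div_pos_of_neg_of_neg h.1 h.2) (by nlinarith)
  have hmk : 0 < m ^ k := zpow_pos hm0 k
  have hmk2 : (m ^ 2) ^ k = m ^ k * m ^ k := by
    rw [← zpow_natCast, ← zpow_mul, ← zpow_add₀ hm0.ne']
    congr 1
    push_cast
    ring
  rw [hmk2] at hk1
  rw [zpow_add_one₀ (by positivity), hmk2] at hk2
  have hBk := commute_zpow hB.1 (-k)
  have hU := expandForm_mulVec hA hBk v
  have hW := contractForm_mulVec hA hBk v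
  have hneg : -(B ^ (-k)) * A = A * -(B ^ (-k)) := commute_neg hBk
  have hU' := expandForm_mulVec hA hneg v
  have hW' := contractForm_mulVec hA hneg v
  rw [eigenvalue_neg] at hU' hW'
  rw [eigenvalue_zpow hA hB.1, ← hm, ← hu, zpow_neg m] at hU hU'
  rw [eigenvalue_zpow hA hB.1, ← hm, ← hw, zpow_neg m] at hW hW'
  rcases (mul_pos_iff.mp huw) with ⟨h1, h2⟩ | ⟨h1, h2⟩
  · refine ⟨B ^ (-k), hBk, ?_⟩
    rw [hU, hW, inv_inv]
    rw [le_div_iff₀ h2] at hk1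
    rw [div_lt_iff₀ h2] at hk2
    refine ⟨by positivity, by positivity, ?_, ?_⟩
    · simp only
      rw [inv_mul_eq_div, le_div_iff₀ hmk]
      linarith
    · simp only
      rw [inv_mul_eq_div, div_lt_iff₀ hmk]
      linarith
  · refine ⟨-B ^ (-k), hneg, ?_⟩
    rw [hU', hW', inv_neg, inv_inv]
    rw [le_div_iff_of_neg h2] at hk1
    rw [div_lt_iff_of_neg h2] at hk2
    have hinv : 0 < (m ^ k)⁻¹ := inv_pos.mpr hmk
    refine ⟨by simp only; nlinarith, by simp only; nlinarith, ?_, ?_⟩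
    · simp only
      rw [neg_mul, neg_mul, neg_le_neg_iff, inv_mul_eq_div, div_le_iff₀ hmk]
      linarith
    · simp only
      rw [neg_mul, neg_mul, mul_neg, neg_lt_neg_iff, inv_mul_eq_div, lt_div_iff₀ hmk]
      linarith

/-- Positivity rules out γ = -B^k. For γ = B^k both ratios lie in [1, m²), so m^(2k) lies strictly
between m⁻² and m², forcing k = 0. -/
theorem eq_one_of_mem_sector (hA : 2 < A.1.trace) (hB : IsCentralizerGenerator A B)
    {v : Fin 2 → ℤ} {γ : SL(2, ℤ)} (hγ : γ * A = A * γ)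
    (hv : (expandForm A (fun i => v i), contractForm A (fun i => v i))
      ∈ sector (eigenvalue A B))
    (hγv : (expandForm A (fun i => γ.1.mulVec v i), contractForm A (fun i => γ.1.mulVec v i))
      ∈ sector (eigenvalue A B)) : γ = 1 := by
  rw [expandForm_mulVec hA hγ, contractForm_mulVec hA hγ] at hγv
  set m := eigenvalue A B with hm
  have hm1 : 1 < m := hB.2.1
  have hm0 : 0 < m := by linarith
  set u := expandForm A (fun i => v i) with hu
  set w := contractForm A (fun i => v i) with hw
  obtain ⟨h1, h2, h3, h4⟩ := hv
  obtain ⟨g1, g2, g3, g4⟩ := hγv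
  simp only at h1 h2 h3 h4 g1 g2 g3 g4
  have hepos : 0 < eigenvalue A γ := pos_of_mul_pos_left g1 h1.le
  obtain ⟨k, rfl | rfl⟩ := hB.2.2 γ hγ
  · rw [eigenvalue_zpow hA hB.1, ← hm] at g1 g2 g3 g4
    have hmk : 0 < m ^ k := zpow_pos hm0 k
    rw [inv_mul_eq_div] at g3 g4
    rw [div_le_iff₀ hmk] at g3
    rw [← mul_div_assoc, lt_div_iff₀ hmk] at g4
    have k1 : m ^ k * m ^ k < m ^ 2 := by
      have : (m ^ k * m ^ k) * u < m ^ 2 * u := by nlinarith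
      exact lt_of_mul_lt_mul_right this h1.le
    have k2 : 1 < (m ^ k * m ^ k) * m ^ 2 := by
      have : 1 * w < ((m ^ k * m ^ k) * m ^ 2) * w := by
        have : m ^ k * m ^ k * u < m ^ k * m ^ k * (m ^ 2 * w) :=
          mul_lt_mul_of_pos_left h4 (by positivity)
        linarith
      exact lt_of_mul_lt_mul_right this h2.le
    have hsq : m ^ k * m ^ k = m ^ (2 * k) := by
      rw [← zpow_add₀ hm0.ne']; congr 1; ring
    rw [hsq, ← zpow_natCast] at k1 k2
    rw [← zpow_add₀ hm0.ne', ← zpow_zero m] at k2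
    rw [zpow_lt_zpow_iff_right₀ hm1] at k1 k2
    push_cast at k1 k2
    have : k = 0 := by omega
    rw [this, zpow_zero]
  · exfalso
    rw [eigenvalue_neg, eigenvalue_zpow hA hB.1] at hepos
    have := zpow_pos hm0 k
    linarith

end Sector

/-- Triples `(d, c, a)` with `d ^ 2 c ≤ N` and `a` a root of `X ^ 2 - n X + 1` modulo `c`. -/
def rootTriples (n : ℤ) (N : ℕ) : Finset (Σ _ : ℕ × ℕ, ℕ) :=
  ((Finset.Ioc 0 N ×ˢ Finset.Ioc 0 N).filter fun p => p.1 ^ 2 * p.2 ≤ N).sigma fun p =>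
    (Finset.range p.2).filter fun a : ℕ => (p.2 : ℤ) ∣ (a : ℤ) ^ 2 - n * a + 1

theorem mem_rootTriples {n : ℤ} {N d c a : ℕ} : (⟨(d, c), a⟩ : Σ _ : ℕ × ℕ, ℕ) ∈ rootTriples n N ↔
    1 ≤ d ∧ a < c ∧ d ^ 2 * c ≤ N ∧ (c : ℤ) ∣ (a : ℤ) ^ 2 - n * a + 1 := by
  simp only [rootTriples, Finset.mem_sigma, Finset.mem_filter, Finset.mem_product, Finset.mem_Ioc,
    Finset.mem_range]
  constructor
  · rintro ⟨⟨⟨h1, h2⟩, h3⟩, h4, h5⟩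
    exact ⟨h1.1, h4, h3, h5⟩
  · rintro ⟨h1, h2, h3, h4⟩
    have hd : d ≤ d ^ 2 * c := by nlinarith [Nat.mul_le_mul h1 h1]
    have hc : c ≤ d ^ 2 * c := Nat.le_mul_of_pos_left _ (by positivity)
    exact ⟨⟨⟨⟨h1, by omega⟩, by omega, by omega⟩, h3⟩, h2, h4⟩

theorem card_rootTriples (n : ℤ) (N : ℕ) :
    ((rootTriples n N).card : ℤ) = ∑ q ∈ Finset.Ioc 0 N, (squareIndicator * rootFn n) q := by
  rw [ArithmeticFunction.sum_Ioc_mul_eq_sum_prod_filter, rootTriples, Finset.card_sigma]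
  push_cast
  refine Finset.sum_of_injOn (fun p => (p.1 ^ 2, p.2)) ?_ ?_ ?_ ?_
  · rintro ⟨a, b⟩ - ⟨a', b'⟩ - h
    simp only [Prod.mk.injEq] at h
    rw [Nat.pow_left_injective (n := 2) (by norm_num) h.1, h.2]
  · rintro ⟨d, c⟩ h
    simp only [Finset.coe_filter, Finset.mem_product, Finset.mem_Ioc, Set.mem_ofPred_eq] at h ⊢
    have : d ^ 2 ≤ d ^ 2 * c := Nat.le_mul_of_pos_right _ h.1.2.1
    exact ⟨⟨⟨pow_pos h.1.1.1 2, by omega⟩, h.1.2⟩, h.2⟩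
  · rintro ⟨m, c⟩ h hn
    simp only [Finset.mem_filter, Finset.mem_product, Finset.mem_Ioc] at h
    suffices hs : ¬ IsSquare m by simp [squareIndicator_apply, hs]
    rintro ⟨d, rfl⟩
    apply hn
    refine ⟨(d, c), ?_, by simp [sq]⟩
    simp only [Finset.coe_filter, Finset.mem_product, Finset.mem_Ioc, Set.mem_ofPred_eq]
    have hd : 0 < d := Nat.pos_of_ne_zero (by rintro rfl; simp at h)
    have : d ≤ d * d := Nat.le_mul_self d
    exact ⟨⟨⟨hd, by omega⟩, h.1.2⟩, by rw [sq]; exact h.2⟩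
  · rintro ⟨d, c⟩ h
    simp only [Finset.mem_filter, Finset.mem_product, Finset.mem_Ioc] at h
    rw [squareIndicator_apply, if_pos ⟨(pow_pos h.1.1.1 2).ne', d, sq d⟩, one_mul]
    rfl

theorem nonempty_equiv_of_biunique {α β : Type*} (r : α → β → Prop) (h₁ : ∀ a, ∃! b, r a b)
    (h₂ : ∀ b, ∃! a, r a b) : Nonempty (α ≃ β) := by
  choose f hf hf' using h₁
  refine ⟨Equiv.ofBijective f ⟨fun a a' h => ?_, fun b => ?_⟩⟩
  · exact (h₂ (f a)).unique (hf a) (h ▸ hf a')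
  · obtain ⟨a, ha, -⟩ := h₂ b
    exact ⟨a, (hf' a b ha).symm⟩

theorem eq_of_entries {M M' : SL(2, ℤ)} (h00 : M.1 0 0 = M'.1 0 0) (h10 : M.1 1 0 = M'.1 1 0)
    (htr : M.1.trace = M'.1.trace) (hc : M.1 1 0 ≠ 0) : M = M' := by
  rw [trace_entries, trace_entries] at htr
  have h11 : M.1 1 1 = M'.1 1 1 := by omega
  have h1 := det_entries M
  have h2 := det_entries M'
  have h01 : M.1 0 1 = M'.1 0 1 := by
    refine mul_right_cancel₀ hc ?_
    rw [← h00, ← h10, ← h11] at h2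
    linarith
  ext i j
  fin_cases i <;> fin_cases j <;> assumption

/-- Orbits of pairs (matrix of trace `n`, integer vector on which its form is positive and at most
`N`) can be counted by first reducing the matrix or by first reducing the vector. -/
theorem nonempty_equiv_rootTriples {n : ℕ} (hn : 2 < n) (N : ℕ)
    (A B : {C : ConjClasses Γ // classTr C = n} → SL(2, ℤ))
    (hA : ∀ C, (A C).1.trace = n)
    (hAC : ∀ C, ConjClasses.mk (QuotientGroup.mk (A C) : Γ) = C)
    (hB : ∀ C, IsCentralizerGenerator (A C) (B C)) :
    Nonempty ((Σ C, sectorPoints (A C) (B C) N) ≃ rootTriples n N) := by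
  have hA2 : ∀ C, 2 < (A C).1.trace := fun C => by rw [hA]; exact_mod_cast hn
  -- A pair and a triple correspond when one g moves the vector to (d, 0) and gives the matrix first
  -- column (a, c). With the trace fixed and c ≠ 0, this column determines the matrix.
  refine nonempty_equiv_of_biunique (fun s t => ∃ g : SL(2, ℤ),
    (g * A s.1 * g⁻¹).1 0 0 = t.1.2 ∧ (g * A s.1 * g⁻¹).1 1 0 = t.1.1.2 ∧
      g.1.mulVec s.2.1 = ![(t.1.1.1 : ℤ), 0]) ?_ ?_
  · rintro ⟨C, v, hv, hvN⟩
    have hq := quadForm_pos_of_mem_sector (hA2 C) hv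
    rw [expandForm_mul_contractForm (hA2 C)] at hvN
    have hqN : quadForm (A C) v ≤ N := by exact_mod_cast hvN
    refine existsUnique_of_exists_of_unique ?_ ?_
    · obtain ⟨g, d, hd, hg⟩ := exists_mulVec_eq_axis (ne_zero_of_quadForm_pos hq)
      obtain ⟨M, hM⟩ : ∃ M, M = g * A C * g⁻¹ := ⟨_, rfl⟩
      have hgM : g * A C = M * g := by rw [hM, inv_mul_cancel_right]
      have hMq := quadForm_conj hgM v
      rw [hg, quadForm_axis] at hMq
      have hMtr : M.1.trace = n := by rw [hM, trace_conj, hA]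
      have hc : 0 < M.1 1 0 := by
        rw [← hMq] at hq
        exact pos_of_mul_pos_left hq (sq_nonneg _)
      -- Shears fix (d, 0) and change the upper left entry by multiples of c; this k reduces it to
      -- its residue modulo c.
      obtain ⟨k, hk⟩ : ∃ k : ℤ, k = -(M.1 0 0 / M.1 1 0) := ⟨_, rfl⟩
      obtain ⟨e1, e2, e3⟩ := shear_conj_entries k M
      have hconj : (shear k * g) * A C * (shear k * g)⁻¹ = shear k * M * (shear k)⁻¹ := by
        simp only [hM, mul_inv_rev, mul_assoc]
      have ha : M.1 0 0 + k * M.1 1 0 = M.1 0 0 % M.1 1 0 := by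
        have := Int.emod_add_mul_ediv (M.1 0 0) (M.1 1 0)
        rw [hk]
        linarith
      rw [ha] at e1
      have ha0 := Int.emod_nonneg (M.1 0 0) hc.ne'
      have ha1 := Int.emod_lt_of_pos (M.1 0 0) hc
      rw [← hconj] at e1 e2 e3
      refine ⟨⟨⟨(d, (M.1 1 0).toNat), (M.1 0 0 % M.1 1 0).toNat⟩, ?_⟩, shear k * g, ?_, ?_, ?_⟩
      · rw [mem_rootTriples]
        refine ⟨hd, by omega, ?_, ?_⟩
        · zify
          rw [Int.toNat_of_nonneg hc.le, mul_comm, hMq]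
          exact hqN
        · rw [Int.toNat_of_nonneg hc.le, Int.toNat_of_nonneg ha0]
          have hdet := det_entries ((shear k * g) * A C * (shear k * g)⁻¹)
          rw [e1, e2, e3] at hdet
          rw [trace_entries] at hMtr
          refine ⟨-((shear k * g) * A C * (shear k * g)⁻¹).1 0 1, ?_⟩
          rw [← hMtr, ← ha] at *
          linear_combination -hdet
      · exact e1.trans (Int.toNat_of_nonneg ha0).symm
      · exact e2.trans (Int.toNat_of_nonneg hc.le).symm
      · rw [mul_mulVec, hg, shear_mulVec_axis]
    · rintro ⟨⟨⟨d, c⟩, a⟩, ht⟩ ⟨⟨⟨d', c'⟩, a'⟩, ht'⟩ ⟨g, h1, h2, h3⟩ ⟨g', h1', h2', h3'⟩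
      rw [mem_rootTriples] at ht ht'
      simp only at h1 h2 h3 h1' h2' h3'
      -- Two normalizations differ by an element preserving the positive axis, hence by a shear. So
      -- d and c agree, and a ≡ a' mod c with both in [0, c).
      have hax : (g' * g⁻¹).1.mulVec ![(d : ℤ), 0] = ![(d' : ℤ), 0] := by
        rw [← h3, ← mul_mulVec, inv_mul_cancel_right, h3']
      obtain ⟨hdd, hsh⟩ := eq_shear_of_mulVec_axis ht.1 ht'.1 hax
      obtain ⟨k, hk⟩ : ∃ k, k = (g' * g⁻¹).1 0 1 := ⟨_, rfl⟩
      rw [← hk] at hsh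
      have hg' : g' = shear k * g := by rw [← hsh, inv_mul_cancel_right]
      have hconj : g' * A C * g'⁻¹ = shear k * (g * A C * g⁻¹) * (shear k)⁻¹ := by
        simp only [hg', mul_inv_rev, mul_assoc]
      obtain ⟨e1, e2, -⟩ := shear_conj_entries k (g * A C * g⁻¹)
      rw [← hconj, h1', h1, h2] at e1
      rw [← hconj, h2', h2] at e2
      have hcc : c' = c := by exact_mod_cast e2
      subst hdd hcc
      have hk0 : k = 0 := by
        have hlt : |k * (c' : ℤ)| < c' := by
          rw [abs_lt]
          constructor <;> omega
        have := Int.eq_zero_of_abs_lt_dvd (Dvd.intro_left k rfl) hlt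
        rcases mul_eq_zero.mp this with h | h
        · exact h
        · omega
      rw [hk0, zero_mul, add_zero] at e1
      have haa : a' = a := by exact_mod_cast e1
      subst haa
      rfl
  · rintro ⟨⟨⟨d, c⟩, a⟩, ht⟩
    rw [mem_rootTriples] at ht
    obtain ⟨hd, hac, hN, b, hb⟩ := ht
    refine existsUnique_of_exists_of_unique ?_ ?_
    · obtain ⟨M, hM00, hM10, hMtr⟩ : ∃ M : SL(2, ℤ), M.1 0 0 = a ∧ M.1 1 0 = c ∧ M.1.trace = n := by
        -- The determinant is 1 because c·b = a² - na + 1.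
        refine ⟨⟨!![(a : ℤ), -b; (c : ℤ), n - a], ?_⟩, by simp, by simp, ?_⟩
        · rw [Matrix.det_fin_two_of]
          linear_combination -hb
        · rw [Matrix.trace_fin_two_of]
          ring
      have hM2 : 2 < M.1.trace := by rw [hMtr]; exact_mod_cast hn
      have hCn : classTr (ConjClasses.mk (QuotientGroup.mk M : Γ)) = n := by
        rw [classTr_mk, hMtr, Int.natAbs_natCast]
      obtain ⟨C, hC⟩ : ∃ C : {C : ConjClasses Γ // classTr C = n},
          C.1 = ConjClasses.mk (QuotientGroup.mk M : Γ) := ⟨⟨_, hCn⟩, rfl⟩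
      obtain ⟨g, hg⟩ := exists_conj_of_mk_eq hM2 (hA2 C) (hC.symm.trans (hAC C).symm)
      have hq := quadForm_conj hg ![(d : ℤ), 0]
      rw [quadForm_axis, hM10] at hq
      have hcd : (0 : ℤ) < c * (d : ℤ) ^ 2 := by
        have : 0 < c := by omega
        positivity
      obtain ⟨γ, hγ, hγs⟩ := exists_mulVec_mem_sector (hA2 C) (hB C)
        (v := g.1.mulVec ![(d : ℤ), 0]) (by rw [hq]; exact hcd)
      refine ⟨⟨C, γ.1.mulVec (g.1.mulVec ![(d : ℤ), 0]), hγs, ?_⟩, (γ * g)⁻¹, ?_⟩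
      · rw [expandForm_mul_contractForm (hA2 C), quadForm_conj hγ, hq]
        have : (c * d ^ 2 : ℤ) ≤ N := by
          rw [mul_comm]
          exact_mod_cast hN
        exact_mod_cast this
      · have hMc : (γ * g)⁻¹ * A C * (γ * g)⁻¹⁻¹ = M := by
          rw [inv_inv, mul_assoc, ← mul_assoc (A C), ← hγ, mul_assoc γ, ← hg]
          group
        simp only [hMc]
        refine ⟨hM00, hM10, ?_⟩
        rw [← mul_mulVec γ g, ← mul_mulVec, inv_mul_cancel, one_mulVec]
    · rintro ⟨C, v, hv, hvN⟩ ⟨C', v', hv', hvN'⟩ ⟨g, h1, h2, h3⟩ ⟨g', h1', h2', h3'⟩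
      simp only at h1 h2 h3 h1' h2' h3'
      have hMM : g * A C * g⁻¹ = g' * A C' * g'⁻¹ := by
        refine eq_of_entries (h1.trans h1'.symm) (h2.trans h2'.symm) ?_ ?_
        · rw [trace_conj, trace_conj, hA, hA]
        · rw [h2]
          omega
      have hconj : (g'⁻¹ * g) * A C = A C' * (g'⁻¹ * g) := by
        have : g * A C = g' * A C' * g'⁻¹ * g := by rw [← hMM, inv_mul_cancel_right]
        rw [mul_assoc, this]
        group
      have hCC : C = C' := by
        refine Subtype.ext ?_
        rw [← hAC, ← hAC]
        exact mk_eq_of_conj hconj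
      subst hCC
      have hvv : v' = (g'⁻¹ * g).1.mulVec v := by
        rw [mul_mulVec, h3, ← h3', ← mul_mulVec, inv_mul_cancel, one_mulVec]
      -- The element g'⁻¹g centralizes A and carries one point of the fundamental sector to another.
      have hone := eq_one_of_mem_sector (hA2 C) (hB C) hconj hv (by rw [← hvv]; exact hv')
      rw [hone, one_mulVec] at hvv
      subst hvv
      rfl

end PrimeGeodesic

/-! ### Comparison of the two densities and summation over traces -/

namespace PrimeGeodesic

open Filter Topology

theorem tendsto_card_sectorPoints {A B : SL(2, ℤ)} (hA : 2 < A.1.trace)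
    (hB : IsCentralizerGenerator A B) :
    Tendsto (fun x : ℝ => (Nat.card (sectorPoints A B x) : ℝ) / x) atTop
      (𝓝 (Real.log (eigenvalue A B) / sqrtDisc A)) := by
  have hc : (A.1 1 0 : ℝ) ≠ 0 := by exact_mod_cast lower_left_ne_zero hA
  have hs := sqrtDisc_pos hA
  -- The change to eigencoordinates has determinant -√D, the source of the factor √D in the formula.
  have hD : (1 : ℝ) * (((A.1 1 1 - A.1 0 0 : ℝ) - sqrtDisc A) / 2)
      - ((A.1 1 1 - A.1 0 0 : ℝ) + sqrtDisc A) / (2 * A.1 1 0) * A.1 1 0 = -sqrtDisc A := by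
    field_simp
    ring
  have h := tendsto_card_sector (by rw [hD]; exact neg_ne_zero.mpr hs.ne') hB.2.1
  rw [hD, abs_neg, abs_of_pos hs] at h
  simp only [one_mul] at h
  exact h

/-- The sum of the von Mangoldt function over the classes of trace `n`. -/
theorem finsum_vonMangoldt {n : ℕ} (hn : 2 < n) {L : ℝ}
    (hL : Tendsto (fun N : ℕ =>
      ((∑ q ∈ Finset.Ioc 0 N, (squareIndicator * rootFn n) q : ℤ) : ℝ) / N) atTop (𝓝 L)) :
    ∑ᶠ C ∈ {C : ConjClasses Γ | classTr C = n}, vonMangoldt C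
      = 2 * (Real.sqrt ((n : ℝ) ^ 2 - 4) * L) := by
  have hex : ∀ C : {C : ConjClasses Γ // classTr C = n}, ∃ A : SL(2, ℤ),
      ConjClasses.mk (QuotientGroup.mk A : Γ) = C ∧ A.1.trace = n := by
    intro C
    obtain ⟨A, h1, h2⟩ := exists_rep C.1
    exact ⟨A, h1, by rw [h2, C.2]⟩
  choose A hAC hA using hex
  have hA2 : ∀ C, 2 < (A C).1.trace := fun C => by rw [hA]; exact_mod_cast hn
  choose B hB using fun C => exists_isCentralizerGenerator (hA2 C)
  have hfin : Finite {C : ConjClasses Γ // classTr C = n} := finite_classTr_eq hn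
  have := Fintype.ofFinite {C : ConjClasses Γ // classTr C = n}
  have hs : ∀ C, sqrtDisc (A C) = Real.sqrt ((n : ℝ) ^ 2 - 4) := by
    intro C
    rw [sqrtDisc, hA, Int.cast_natCast]
  have hspos : 0 < Real.sqrt ((n : ℝ) ^ 2 - 4) := by
    refine Real.sqrt_pos.mpr ?_
    have : (2 : ℝ) < n := by exact_mod_cast hn
    nlinarith
  have hsum : ∀ N : ℕ, ((∑ q ∈ Finset.Ioc 0 N, (squareIndicator * rootFn n) q : ℤ) : ℝ)
      = ∑ C, (Nat.card (sectorPoints (A C) (B C) N) : ℝ) := by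
    intro N
    obtain ⟨e⟩ := nonempty_equiv_rootTriples hn N A B hA hAC hB
    have hfinS := Finite.of_equiv _ e.symm
    have hfinC : ∀ C, Finite (sectorPoints (A C) (B C) N) := fun C =>
      Finite.of_injective (fun v => (⟨C, v⟩ : Σ C, sectorPoints (A C) (B C) N))
        fun v w h => by simpa using h
    rw [← card_rootTriples, ← Nat.card_eq_finsetCard, ← Nat.card_congr e, Nat.card_sigma]
    push_cast
    rfl
  have hlim : Tendsto (fun N : ℕ =>
      ((∑ q ∈ Finset.Ioc 0 N, (squareIndicator * rootFn n) q : ℤ) : ℝ) / N) atTop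
      (𝓝 (∑ C, Real.log (eigenvalue (A C) (B C)) / Real.sqrt ((n : ℝ) ^ 2 - 4))) := by
    simp only [hsum, Finset.sum_div]
    refine tendsto_finsetSum _ fun C _ => ?_
    have h := (tendsto_card_sectorPoints (hA2 C) (hB C)).comp tendsto_natCast_atTop_atTop
    rw [hs] at h
    exact h
  rw [tendsto_nhds_unique hL hlim, ← finsum_set_coe_eq_finsum_mem, Finset.mul_sum, Finset.mul_sum]
  change ∑ᶠ C : {C : ConjClasses Γ // classTr C = n}, vonMangoldt C = _
  rw [finsum_eq_sum_of_fintype]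
  refine Finset.sum_congr rfl fun C _ => ?_
  rw [← hAC C, vonMangoldt_mk (hA2 C) (hB C), mul_div_cancel₀ _ hspos.ne']

theorem le_iff_add_one_div_le {a b : ℝ} (ha : 1 ≤ a) (hb : 1 ≤ b) :
    a ≤ b ↔ a + 1 / a ≤ b + 1 / b := by
  have ha0 : 0 < a := by linarith
  have hb0 : 0 < b := by linarith
  have hid : b + 1 / b - (a + 1 / a) = (b - a) * (a * b - 1) / (a * b) := by
    field_simp
    ring
  have hab : 0 < a * b := mul_pos ha0 hb0
  rw [← sub_nonneg (b := a + 1 / a), hid]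
  constructor
  · intro h
    exact div_nonneg (mul_nonneg (by linarith) (by nlinarith)) hab.le
  · intro h
    by_contra hlt
    push Not at hlt
    have : (b - a) * (a * b - 1) / (a * b) < 0 :=
      div_neg_of_neg_of_pos (mul_neg_of_neg_of_pos (by linarith) (by nlinarith)) hab
    linarith

/-- The norm is l² with l ≥ 1 and l + 1/l equal to the trace, and t + 1/t is increasing on [1, ∞);
compare at l and √x. -/
theorem norm_le_iff {P : Γ} (hP : 2 ≤ tr P) {x : ℝ} (hx : 1 ≤ x) :
    norm P ≤ x ↔ (tr P : ℝ) ≤ Real.sqrt x + 1 / Real.sqrt x := by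
  have hT : (2 : ℝ) ≤ tr P := by exact_mod_cast hP
  unfold norm
  set T : ℝ := ((tr P : ℕ) : ℝ)
  have hs : Real.sqrt (T ^ 2 - 4) ^ 2 = T ^ 2 - 4 := Real.sq_sqrt (by nlinarith)
  have hs0 := Real.sqrt_nonneg (T ^ 2 - 4)
  set l := (T + Real.sqrt (T ^ 2 - 4)) / 2 with hl
  have hl1 : 1 ≤ l := by rw [hl]; linarith
  have hTl : T = l + 1 / l := by
    have hl0 : l ≠ 0 := by linarith
    field_simp
    rw [hl]
    linear_combination (-1 / 4 : ℝ) * hs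
  rw [hTl, ← le_iff_add_one_div_le hl1 (Real.one_le_sqrt.mpr hx),
    Real.le_sqrt' (by linarith)]

theorem classesUpTo_eq {x : ℝ} (hx : 1 ≤ x) : classesUpTo x =
    ⋃ n ∈ (Finset.Ioc 2 ⌊Real.sqrt x + 1 / Real.sqrt x⌋₊ : Set ℕ),
      {C : ConjClasses Γ | classTr C = n} := by
  ext C
  obtain ⟨P, rfl⟩ := ConjClasses.exists_rep C
  simp only [Set.mem_iUnion, Set.mem_ofPred_eq, Finset.coe_Ioc, Set.mem_Ioc, exists_prop,
    exists_eq_right']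
  change 2 < tr P ∧ norm P ≤ x ↔ 2 < tr P ∧ tr P ≤ _
  refine and_congr_right fun h => ?_
  rw [norm_le_iff h.le hx, Nat.le_floor_iff (by positivity)]

end PrimeGeodesic

theorem proposition2p2 (x : ℝ) (hx : 1 ≤ x) :
    (PrimeGeodesic.classesUpTo x).Finite ∧
    (∀ n : ℕ, 2 < n → PrimeGeodesic.ZagierLConverges 1 ((n : ℤ) ^ 2 - 4)) ∧
    (PrimeGeodesic.Psi x : ℂ) =
      2 * ∑ n ∈ Finset.Ioc 2 ⌊Real.sqrt x + 1 / Real.sqrt x⌋₊,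
        (Real.sqrt ((n : ℝ) ^ 2 - 4) : ℂ) * PrimeGeodesic.zagierL 1 ((n : ℤ) ^ 2 - 4) := by
  have hlim : ∀ n : ℕ, 2 < n → ∃ L : ℝ,
      HasSum (PrimeGeodesic.zagierTerm 1 ((n : ℤ) ^ 2 - 4)) (L : ℂ)
        (SummationFilter.conditional ℕ) ∧
      ∑ᶠ C ∈ {C : ConjClasses PrimeGeodesic.Γ | PrimeGeodesic.classTr C = n},
        PrimeGeodesic.vonMangoldt C = 2 * (Real.sqrt ((n : ℝ) ^ 2 - 4) * L) := by
    intro n hn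
    have h4 : 4 ≤ n ^ 2 := by nlinarith
    have hd : ((n ^ 2 - 4 : ℕ) : ℤ) = (n : ℤ) ^ 2 - 4 := by push_cast [h4]; ring
    have hsq : ¬ IsSquare (n ^ 2 - 4 : ℕ) := by
      rintro ⟨m, hm⟩
      refine PrimeGeodesic.not_isSquare_sq_sub_four (n := n) (by exact_mod_cast hn) ⟨m, ?_⟩
      rw [← hd, hm]
      push_cast
      rfl
    obtain ⟨L, h1, h2⟩ := PrimeGeodesic.exists_tendsto_zagierFn (n : ℤ) hd hsq
    exact ⟨L, PrimeGeodesic.hasSum_zagierTerm _ h1, PrimeGeodesic.finsum_vonMangoldt hn h2⟩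
  have hfin : ∀ n ∈ (Finset.Ioc 2 ⌊Real.sqrt x + 1 / Real.sqrt x⌋₊ : Set ℕ),
      {C : ConjClasses PrimeGeodesic.Γ | PrimeGeodesic.classTr C = n}.Finite := fun n hn =>
    PrimeGeodesic.finite_classTr_eq (Finset.mem_Ioc.mp (Finset.mem_coe.mp hn)).1
  refine ⟨?_, fun n hn => ?_, ?_⟩
  · rw [PrimeGeodesic.classesUpTo_eq hx]
    exact (Finset.finite_toSet _).biUnion hfin
  · obtain ⟨L, h, -⟩ := hlim n hn
    exact h.summable
  · have hPsi : PrimeGeodesic.Psi x = ∑ n ∈ Finset.Ioc 2 ⌊Real.sqrt x + 1 / Real.sqrt x⌋₊,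
        ∑ᶠ C ∈ {C : ConjClasses PrimeGeodesic.Γ | PrimeGeodesic.classTr C = n},
          PrimeGeodesic.vonMangoldt C := by
      rw [PrimeGeodesic.Psi, PrimeGeodesic.classesUpTo_eq hx, finsum_mem_biUnion _
        (Finset.finite_toSet _) hfin, finsum_mem_coe_finset]
      intro n _ m _ hnm
      refine Set.disjoint_left.mpr fun C hC hC' => hnm ?_
      exact hC.symm.trans hC'
    rw [hPsi, Finset.mul_sum]
    push_cast
    refine Finset.sum_congr rfl fun n hn => ?_
    obtain ⟨L, h1, h2⟩ := hlim n (Finset.mem_Ioc.mp hn).1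
    rw [h2, PrimeGeodesic.zagierL, h1.tsum_eq]
    push_cast
    rfl
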